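/- Let $N\ge 1$, let $\Omega\subset\mathbb R^N$ be a bounded convex domain, and let $\rho_0,\rho_1\ge 0$ be functions in $C^1(\Omega)$ such that $\rho:=\rho_0+\rho_1$ satisfies $c_\rho<\rho<c_\rho^{-1}$ in $\Omega$ for some constant $c_\rho>0$. For $A\subset\mathbb R^N$ let $A^1$ be the set of points of Lebesgue density $1$ of $A$. For $A\subset\Omega$ write $A^c=\Omega\setminus A$ and put $$\operatorname{sdist}(\cdot,A)=\operatorname{dist}(\cdot,A^1)-\operatorname{dist}(\cdot,\Omega\setminus A^1).$$ For $\varepsilon>0$ and measurable $u:\Omega\to\mathbb R$ let $$\mathrm{TV}_\varepsilon(u)=\frac1\varepsilon\Big[\int_\Omega\Big(\operatorname*{ess\,sup}_{B(x,\varepsilon)\cap\Omega}u-u(x)\Big)\rho_0(x)\,dx+\int_\Omega\Big(u(x)-\operatorname*{ess\,inf}_{B(x,\varepsilon)\cap\Omega}u\Big)\rho_1(x)\,dx\Big]\in[0,\infty],$$ and define $S_\varepsilon(A)=\{w>0\}^1$, where $w$ is the minimizer (unique up to null sets) over $u\in L^2(\Omega)$ of $$\frac1{2\varepsilon}\int_\Omega|u-\operatorname{sdist}(\cdot,A^c)|^2\rho\,dx+\mathrm{TV}_\varepsilon(u).$$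 Let $A(t)$, $t\in[t_0,t_1]$, be sets with $\overline{A(t)}\subset\Omega$, and let $d(x,t)=\operatorname{sdist}(x,A(t)^c)$. Assume that each $A(t)$ lies on one side of its boundary, i.e. $\operatorname{int}\overline{A(t)}\subset A(t)\subset\overline{\operatorname{int}A(t)}$, and that the space-time boundary $\Sigma=\bigcup_{t\in[t_0,t_1]}\partial A(t)\times\{t\}$ is closed. The family $A(\cdot)$ is called a subflow if there are a relatively open set $B\subset\Omega\times[t_0,t_1]$ containing $\Sigma$, on which $d$ is $C^2$ in $x$ and $C^1$ in $t$ ($d,\nabla d,\nabla^2d,\partial_td$ continuous on $B$), and a number $\delta>0$ such that $$\partial_t d(x,t)\ \ge\ \frac1{\rho(x)}\operatorname{div}\big(\rho(x)\nabla d(x,t)\big)+\delta\qquad\text{for all }(x,t)\in B.$$ It is called a superflow if the same holds with $\delta<0$ and the reverse inequality. Then $S_\varepsilon$ is consistent with sub- and superflows of the weighted mean curvature flow: (i) for every subflow $A(t)$, $t\in[t_0,t_1]$, there is $\varepsilon_0>0$ such that $S_\varepsilon(A(t))\subset A(t+\varepsilon)$ for all $0<\varepsilon<\varepsilon_0$ and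 all $t\in[t_0,t_1-\varepsilon]$; (ii) for every superflow $A(t)$, $t\in[t_0,t_1]$, there is $\varepsilon_0>0$ such that $A(t+\varepsilon)\subset S_\varepsilon(A(t))$ for all $0<\varepsilon<\varepsilon_0$ and all $t\in[t_0,t_1-\varepsilon]$. -/

import Mathlib

open MeasureTheory Set Filter Topology
open scoped ENNReal

noncomputable section

namespace AdvMCF

variable {N : ℕ}

/-- The points of Lebesgue density one of a set `A` (written `A¹`). It does not change when `A` is
modified on a Lebesgue null set. -/
def densityOne (A : Set (EuclideanSpace ℝ (Fin N))) : Set (EuclideanSpace ℝ (Fin N)) :=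
  {x | Tendsto (fun r : ℝ => volume (A ∩ Metric.ball x r) / volume (Metric.ball x r))
    (𝓝[>] 0) (𝓝 1)}

/-- The signed distance function of `A` relative to `Ω`:
`sdist(x, A) = dist(x, A¹) - dist(x, Ω \ A¹)`. -/
def sdist (Ω A : Set (EuclideanSpace ℝ (Fin N))) (x : EuclideanSpace ℝ (Fin N)) : ℝ :=
  Metric.infDist x (densityOne A) - Metric.infDist x (Ω \ densityOne A)

/-- The signed distance `sdist(x, Aᶜ)` to the complement `Aᶜ = Ω \ A`; it is positive inside `A`
and negative outside. -/
def sdistCompl (Ω A : Set (EuclideanSpace ℝ (Fin N))) (x : EuclideanSpace ℝ (Fin N)) : ℝ :=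
  sdist Ω (Ω \ A) x

/-- The essential supremum of `u` over `B(x, ε) ∩ Ω`, with values in `[-∞, ∞]`. -/
def localEssSup (Ω : Set (EuclideanSpace ℝ (Fin N))) (ε : ℝ)
    (u : EuclideanSpace ℝ (Fin N) → ℝ) (x : EuclideanSpace ℝ (Fin N)) : EReal :=
  essSup (fun y => (u y : EReal)) (volume.restrict (Metric.ball x ε ∩ Ω))

/-- The essential infimum of `u` over `B(x, ε) ∩ Ω`, with values in `[-∞, ∞]`. -/
def localEssInf (Ω : Set (EuclideanSpace ℝ (Fin N))) (ε : ℝ)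
    (u : EuclideanSpace ℝ (Fin N) → ℝ) (x : EuclideanSpace ℝ (Fin N)) : EReal :=
  essInf (fun y => (u y : EReal)) (volume.restrict (Metric.ball x ε ∩ Ω))

/-- The nonlocal total variation
`TV_ε(u) = (1/ε) [ ∫_Ω (ess sup_{B(x,ε) ∩ Ω} u - u(x)) dρ₀ + ∫_Ω (u(x) - ess inf_{B(x,ε) ∩ Ω} u) dρ₁ ]`
with values in `[0, ∞]`. Both integrands are nonnegative for almost every `x ∈ Ω`. -/
def TV (Ω : Set (EuclideanSpace ℝ (Fin N))) (ρ₀ ρ₁ : EuclideanSpace ℝ (Fin N) → ℝ) (ε : ℝ)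
    (u : EuclideanSpace ℝ (Fin N) → ℝ) : ℝ≥0∞ :=
  ENNReal.ofReal (1 / ε) *
    ((∫⁻ x in Ω, (localEssSup Ω ε u x - (u x : EReal)).toENNReal * ENNReal.ofReal (ρ₀ x)) +
      ∫⁻ x in Ω, ((u x : EReal) - localEssInf Ω ε u x).toENNReal * ENNReal.ofReal (ρ₁ x))

/-- The energy `(1/(2ε)) ∫_Ω |u - f|² dρ + TV_ε(u)` with `ρ = ρ₀ + ρ₁`. -/
def energy (Ω : Set (EuclideanSpace ℝ (Fin N))) (ρ₀ ρ₁ : EuclideanSpace ℝ (Fin N) → ℝ) (ε : ℝ)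
    (f u : EuclideanSpace ℝ (Fin N) → ℝ) : ℝ≥0∞ :=
  ENNReal.ofReal (1 / (2 * ε)) *
      (∫⁻ x in Ω, ENNReal.ofReal (|u x - f x| ^ 2) * ENNReal.ofReal (ρ₀ x + ρ₁ x)) +
    TV Ω ρ₀ ρ₁ ε u

/-- `w` is a minimizer of the energy over `L²(Ω)`. -/
def IsMinimizer (Ω : Set (EuclideanSpace ℝ (Fin N))) (ρ₀ ρ₁ : EuclideanSpace ℝ (Fin N) → ℝ)
    (ε : ℝ) (f w : EuclideanSpace ℝ (Fin N) → ℝ) : Prop :=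
  MemLp w 2 (volume.restrict Ω) ∧
    ∀ u : EuclideanSpace ℝ (Fin N) → ℝ, MemLp u 2 (volume.restrict Ω) →
      energy Ω ρ₀ ρ₁ ε f w ≤ energy Ω ρ₀ ρ₁ ε f u

/-- The one-step operator `S_ε(A) = {w > 0}`, where `w` is the minimizer of the energy with data
`f = sdist(·, Aᶜ)`. The representative of `{w > 0}` is fixed by `{w > 0} = {w > 0}¹`. The minimizer
is unique up to null sets, so every minimizer `w` yields the same set. -/
def oneStep (Ω : Set (EuclideanSpace ℝ (Fin N))) (ρ₀ ρ₁ : EuclideanSpace ℝ (Fin N) → ℝ) (ε : ℝ)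
    (A : Set (EuclideanSpace ℝ (Fin N))) : Set (EuclideanSpace ℝ (Fin N)) :=
  {x | ∃ w : EuclideanSpace ℝ (Fin N) → ℝ,
    IsMinimizer Ω ρ₀ ρ₁ ε (sdistCompl Ω A) w ∧ x ∈ densityOne {y | y ∈ Ω ∧ 0 < w y}}

/-- The divergence `∑ᵢ ∂ᵢ Fᵢ` of a vector field. -/
def divergence (F : EuclideanSpace ℝ (Fin N) → EuclideanSpace ℝ (Fin N))
    (x : EuclideanSpace ℝ (Fin N)) : ℝ :=
  ∑ i : Fin N, (fderiv ℝ F x (EuclideanSpace.single i 1)) i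

/-- The weighted operator `(1/ρ) div(ρ ∇g)`. -/
def weightedLaplacian (ρ g : EuclideanSpace ℝ (Fin N) → ℝ) (x : EuclideanSpace ℝ (Fin N)) : ℝ :=
  1 / ρ x * divergence (fun y => ρ y • gradient g y) x

/-- The time derivative of `d` on the time interval `[t₀, t₁]` (one-sided at the end points). -/
def timeDeriv (t₀ t₁ : ℝ) (d : EuclideanSpace ℝ (Fin N) → ℝ → ℝ)
    (x : EuclideanSpace ℝ (Fin N)) (t : ℝ) : ℝ :=
  derivWithin (fun s => d x s) (Icc t₀ t₁) t

/-- `d ∈ C^{2,1}_{x,t}(B)`: on the relatively open set `B ⊆ Ω × [t₀, t₁]`, `d` is twice continuously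
differentiable in space and continuously differentiable in time, with `d` and all the derivatives
involved continuous on `B`. -/
structure IsC21On (t₀ t₁ : ℝ) (d : EuclideanSpace ℝ (Fin N) → ℝ → ℝ)
    (B : Set (EuclideanSpace ℝ (Fin N) × ℝ)) : Prop where
  space : ∀ p ∈ B, ContDiffAt ℝ 2 (fun y => d y p.2) p.1
  time : ∀ p ∈ B, DifferentiableWithinAt ℝ (fun s => d p.1 s) (Icc t₀ t₁) p.2
  continuousOn : ContinuousOn (fun p => d p.1 p.2) B
  continuousOn_fderiv : ContinuousOn (fun p => fderiv ℝ (fun y => d y p.2) p.1) B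
  continuousOn_fderiv_fderiv :
    ContinuousOn (fun p => fderiv ℝ (fderiv ℝ (fun y => d y p.2)) p.1) B
  continuousOn_timeDeriv : ContinuousOn (fun p => timeDeriv t₀ t₁ d p.1 p.2) B

/-- The space-time boundary `⋃_{t ∈ [t₀, t₁]} ∂A(t) × {t}`. -/
def spaceTimeBoundary (t₀ t₁ : ℝ) (A : ℝ → Set (EuclideanSpace ℝ (Fin N))) :
    Set (EuclideanSpace ℝ (Fin N) × ℝ) :=
  {p | p.2 ∈ Icc t₀ t₁ ∧ p.1 ∈ frontier (A p.2)}

/-- `t ↦ A(t) ⊂⊂ Ω`, `t ∈ [t₀, t₁]`, is a smooth evolution of smooth sets, with regularity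
neighbourhood `B` of the moving boundary. A smooth set lies on one side of its boundary
(it has no isolated or removed lower-dimensional parts), and the boundary of a smooth evolution
cannot vanish abruptly: its space-time boundary is closed. -/
structure IsSmoothEvolution (Ω : Set (EuclideanSpace ℝ (Fin N))) (t₀ t₁ : ℝ)
    (A : ℝ → Set (EuclideanSpace ℝ (Fin N))) (B : Set (EuclideanSpace ℝ (Fin N) × ℝ)) : Prop where
  compactly_contained : ∀ t ∈ Icc t₀ t₁, closure (A t) ⊆ Ω
  interior_closure_subset : ∀ t ∈ Icc t₀ t₁, interior (closure (A t)) ⊆ A t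
  subset_closure_interior : ∀ t ∈ Icc t₀ t₁, A t ⊆ closure (interior (A t))
  isClosed_boundary : IsClosed (spaceTimeBoundary t₀ t₁ A)
  relatively_open : ∃ U : Set (EuclideanSpace ℝ (Fin N) × ℝ),
    IsOpen U ∧ B = U ∩ (Ω ×ˢ Icc t₀ t₁)
  boundary_subset : spaceTimeBoundary t₀ t₁ A ⊆ B
  regularity : IsC21On t₀ t₁ (fun x t => sdistCompl Ω (A t) x) B

/-- `A` is a subflow of `∂ₜ d = (1/ρ) div(ρ ∇d)` on `[t₀, t₁]`, where `d(x, t) = sdist(x, A(t)ᶜ)`. -/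
def IsSubflow (Ω : Set (EuclideanSpace ℝ (Fin N))) (ρ : EuclideanSpace ℝ (Fin N) → ℝ) (t₀ t₁ : ℝ)
    (A : ℝ → Set (EuclideanSpace ℝ (Fin N))) : Prop :=
  ∃ B : Set (EuclideanSpace ℝ (Fin N) × ℝ), IsSmoothEvolution Ω t₀ t₁ A B ∧
    ∃ δ : ℝ, 0 < δ ∧ ∀ x t, (x, t) ∈ B →
      weightedLaplacian ρ (sdistCompl Ω (A t)) x + δ ≤
        timeDeriv t₀ t₁ (fun y s => sdistCompl Ω (A s) y) x t

/-- `A` is a superflow of `∂ₜ d = (1/ρ) div(ρ ∇d)` on `[t₀, t₁]`, where `d(x, t) = sdist(x, A(t)ᶜ)`. -/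
def IsSuperflow (Ω : Set (EuclideanSpace ℝ (Fin N))) (ρ : EuclideanSpace ℝ (Fin N) → ℝ)
    (t₀ t₁ : ℝ) (A : ℝ → Set (EuclideanSpace ℝ (Fin N))) : Prop :=
  ∃ B : Set (EuclideanSpace ℝ (Fin N) × ℝ), IsSmoothEvolution Ω t₀ t₁ A B ∧
    ∃ δ : ℝ, δ < 0 ∧ ∀ x t, (x, t) ∈ B →
      timeDeriv t₀ t₁ (fun y s => sdistCompl Ω (A s) y) x t ≤
        weightedLaplacian ρ (sdistCompl Ω (A t)) x + δ

/-- Consistency of the family of operators `S_ε` with sub- and superflows. -/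
def IsConsistent (Ω : Set (EuclideanSpace ℝ (Fin N))) (ρ₀ ρ₁ : EuclideanSpace ℝ (Fin N) → ℝ) :
    Prop :=
  (∀ (t₀ t₁ : ℝ) (A : ℝ → Set (EuclideanSpace ℝ (Fin N))),
    IsSubflow Ω (fun x => ρ₀ x + ρ₁ x) t₀ t₁ A →
      ∃ ε₀ : ℝ, 0 < ε₀ ∧ ∀ ε : ℝ, 0 < ε → ε < ε₀ → ∀ t ∈ Icc t₀ (t₁ - ε),
        oneStep Ω ρ₀ ρ₁ ε (A t) ⊆ A (t + ε)) ∧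
  (∀ (t₀ t₁ : ℝ) (A : ℝ → Set (EuclideanSpace ℝ (Fin N))),
    IsSuperflow Ω (fun x => ρ₀ x + ρ₁ x) t₀ t₁ A →
      ∃ ε₀ : ℝ, 0 < ε₀ ∧ ∀ ε : ℝ, 0 < ε → ε < ε₀ → ∀ t ∈ Icc t₀ (t₁ - ε),
        A (t + ε) ⊆ oneStep Ω ρ₀ ρ₁ ε (A t))

end AdvMCF

end

noncomputable section

namespace AdvMCF

/-! The proof is a barrier argument for one step from `t` to `t' = t + ε`. Replacing `u` by `-u` and
exchanging `ρ₀` with `ρ₁` preserves the energy (`energy_neg`), so a sign `σ = ±1` treats subflows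
and superflows by the same estimate, `IsTube.exists_step`. With `δ > 0` the strictness of the flow
and `k = δε/8`, raise the data to `f = σ d(·,t) + k` and put `D = σ d(·,t') - k`. The claim is that
a minimizer `w` for `f` is nonpositive a.e. on `{D < 0}`. The margin `k` turns this a.e. statement
into an inclusion of sets: each point to be tested has a neighbourhood on which the original
minimizer has a strict sign almost everywhere.

The claim is `IsMinimizer.nonpos_of_front`. Let `g` be the positive part of `w` on `{D < 0}` and
zero elsewhere, and compare `w` with `w - g`. Since `g (w - g) = 0`, the quadratic term drops by
exactly `(g² - 2fg) ρ / (2ε)`. The supremum over `B(x,ε)` sees `w` at points transported by `ε`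
along the normal field `V = ∇(σ d(·,t'))`. With a cutoff `λ` of `D`, the upper oscillation drops by
at least `λ (g(x + εV) - g(x))` and the lower one by at least `λ (g(x) - g(x - εV))`, the
transported values being read as zero outside the image of the zone (`ae_upOsc_competitor_le`,
`ae_upOsc_neg_competitor_le`). As `V` is constant along its characteristics, the area formula moves
`g(x ± εV)` back to `g(y)`, at the price of Jacobians on the densities.

The coefficient of `g(y)/ε` near the front is then `-fρ - ε div(ρV)` up to a small multiple of `ε`.
It is nonnegative because `f = D + 2k - ε σ ∂ₜd` up to a small error, `D < 0`, and the flow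
inequality is strict. Farther out `f` is below a fixed negative constant while the transport terms
are `O(ε)`; beyond that `λ = 0` and `f ≤ 0`. Hence `energy(w - g) + (1/2ε) ∫ g²ρ ≤ energy(w)`, and
minimality forces `g = 0`.

The geometry needed is a compact tube around the space-time boundary on which all expansions are
uniform (`IsSmoothEvolution.exists_isTube`), together with `|∇d| = 1` there, which follows from
one-sidedness (`IsOneSided.norm_fderiv_eq_one`). For subflows the argument applies to every
minimizer; for superflows one minimizer must also be exhibited (`exists_isMinimizer`). -/

/-- Euclidean space of dimension `N`. -/
abbrev Pt (N : ℕ) := EuclideanSpace ℝ (Fin N)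

/-! ### Local essential suprema and the symmetries of the energy -/

section LocalEss

variable {N : ℕ} {Ω : Set (Pt N)} {ε : ℝ} {u v : Pt N → ℝ} {x : Pt N}

theorem localEssSup_le_iff {a : EReal} : localEssSup Ω ε u x ≤ a ↔
    ∀ᵐ y ∂(volume.restrict (Metric.ball x ε ∩ Ω)), (u y : EReal) ≤ a := by
  constructor
  · intro h
    filter_upwards [ae_le_essSup (f := fun y => (u y : EReal))
      (μ := volume.restrict (Metric.ball x ε ∩ Ω))] with y hy
    exact hy.trans h
  · intro h
    exact essSup_le_of_ae_le a h

theorem le_localEssInf_iff {a : EReal} : a ≤ localEssInf Ω ε u x ↔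
    ∀ᵐ y ∂(volume.restrict (Metric.ball x ε ∩ Ω)), a ≤ (u y : EReal) := by
  constructor
  · intro h
    filter_upwards [ae_essInf_le (f := fun y => (u y : EReal))
      (μ := volume.restrict (Metric.ball x ε ∩ Ω))] with y hy
    exact h.trans hy
  · intro h
    exact le_essInf_of_ae_le a h

theorem localEssSup_neg : localEssSup Ω ε (fun y => -u y) x = -localEssInf Ω ε u x := by
  refine eq_of_forall_ge_iff fun a => ?_
  rw [localEssSup_le_iff, EReal.neg_le, le_localEssInf_iff]
  simp only [EReal.coe_neg, EReal.neg_le]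

theorem localEssInf_neg : localEssInf Ω ε (fun y => -u y) x = -localEssSup Ω ε u x := by
  have := localEssSup_neg (Ω := Ω) (ε := ε) (u := fun y => -u y) (x := x)
  simp only [neg_neg] at this
  rw [this, neg_neg]

theorem ae_ball_inter_of_ae {P : Pt N → Prop}
    (h : ∀ᵐ y ∂(volume.restrict Ω), P y) :
    ∀ᵐ y ∂(volume.restrict (Metric.ball x ε ∩ Ω)), P y :=
  ae_mono (Measure.restrict_mono inter_subset_right le_rfl) h

theorem localEssSup_mono (h : ∀ᵐ y ∂(volume.restrict (Metric.ball x ε ∩ Ω)), u y ≤ v y) :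
    localEssSup Ω ε u x ≤ localEssSup Ω ε v x :=
  essSup_mono_ae (by filter_upwards [h] with y hy using EReal.coe_le_coe hy)

theorem localEssInf_mono (h : ∀ᵐ y ∂(volume.restrict (Metric.ball x ε ∩ Ω)), u y ≤ v y) :
    localEssInf Ω ε u x ≤ localEssInf Ω ε v x :=
  essInf_mono_ae (by filter_upwards [h] with y hy using EReal.coe_le_coe hy)

theorem localEssSup_congr (h : u =ᵐ[volume.restrict Ω] v) :
    localEssSup Ω ε u x = localEssSup Ω ε v x :=
  essSup_congr_ae (by
    filter_upwards [ae_ball_inter_of_ae h] with y hy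
    rw [hy])

theorem localEssInf_congr (h : u =ᵐ[volume.restrict Ω] v) :
    localEssInf Ω ε u x = localEssInf Ω ε v x :=
  essInf_congr_ae (by
    filter_upwards [ae_ball_inter_of_ae h] with y hy
    rw [hy])

/-- If `u > a` on a set of positive measure in an open ball, this already holds in a slightly
smaller concentric ball, and that one is contained in every `ε`-ball with a nearby centre. The point
of the lemma is measurability. -/
theorem lowerSemicontinuous_localEssSup (hΩ : MeasurableSet Ω) :
    LowerSemicontinuous (localEssSup Ω ε u) := by
  intro x a ha
  have h1 : volume ({y | ¬ (u y : EReal) ≤ a} ∩ (Metric.ball x ε ∩ Ω)) ≠ 0 := by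
    intro h
    refine absurd ha (not_lt.2 (localEssSup_le_iff.2 ?_))
    rw [ae_iff, Measure.restrict_apply' (Metric.isOpen_ball.measurableSet.inter hΩ)]
    exact h
  have h2 : {y | ¬ (u y : EReal) ≤ a} ∩ (Metric.ball x ε ∩ Ω) =
      ⋃ n : ℕ, {y | ¬ (u y : EReal) ≤ a} ∩ (Metric.ball x (ε - 1 / ((n : ℝ) + 1)) ∩ Ω) := by
    ext y
    simp only [mem_inter_iff, mem_iUnion, Metric.mem_ball]
    constructor
    · rintro ⟨h1, h2, h3⟩
      obtain ⟨n, hn⟩ := exists_nat_one_div_lt (sub_pos.2 h2)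
      exact ⟨n, h1, by linarith, h3⟩
    · rintro ⟨n, h1, h2, h3⟩
      have : (0 : ℝ) < 1 / ((n : ℝ) + 1) := by positivity
      exact ⟨h1, by linarith, h3⟩
  rw [h2] at h1
  obtain ⟨n, hn⟩ : ∃ n : ℕ, volume ({y | ¬ (u y : EReal) ≤ a} ∩
      (Metric.ball x (ε - 1 / ((n : ℝ) + 1)) ∩ Ω)) ≠ 0 := by
    by_contra h
    exact h1 (measure_iUnion_null (not_exists_not.1 h))
  have hpos : (0 : ℝ) < 1 / ((n : ℝ) + 1) := by positivity
  filter_upwards [Metric.ball_mem_nhds x hpos] with z hz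
  refine lt_of_not_ge fun h => hn ?_
  rw [localEssSup_le_iff, ae_iff,
    Measure.restrict_apply' (Metric.isOpen_ball.measurableSet.inter hΩ)] at h
  refine measure_mono_null (inter_subset_inter_right _ (inter_subset_inter_left _ ?_)) h
  refine Metric.ball_subset_ball' ?_
  rw [dist_comm]
  have := Metric.mem_ball.1 hz
  linarith

theorem measurable_localEssSup (hΩ : MeasurableSet Ω) : Measurable (localEssSup Ω ε u) :=
  (lowerSemicontinuous_localEssSup hΩ).measurable

/-- Almost every value of `u` is dominated by the local essential supremum over each ball whose
closure contains the point. -/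
theorem ae_le_localEssSup (hΩ : IsOpen Ω) (hε : 0 < ε) (u : Pt N → ℝ) :
    ∀ᵐ y ∂(volume.restrict Ω), ∀ x, dist y x ≤ ε → (u y : EReal) ≤ localEssSup Ω ε u x := by
  -- Rational thresholds leave countably many null sets, none depending on `x`. This uniformity in
  -- `x` is what allows `x` to be a transported copy of `y` later on.
  have key : ∀ q : ℚ, ∀ᵐ y ∂(volume : Measure (Pt N)), y ∈ Ω ∩ {y | (q : ℝ) < u y} →
      Tendsto (fun r => volume ((Ω ∩ {y | (q : ℝ) < u y}) ∩ Metric.closedBall y r) /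
        volume (Metric.closedBall y r)) (𝓝[>] 0) (𝓝 1) := fun q =>
    ae_imp_of_ae_restrict (Besicovitch.ae_tendsto_measure_inter_div volume _)
  rw [ae_restrict_iff' hΩ.measurableSet]
  filter_upwards [ae_all_iff.2 key] with y hy hyΩ x hxy
  by_contra! hlt
  obtain ⟨q, hq1, hq2⟩ := EReal.lt_iff_exists_rat_btwn.1 hlt
  have hq2' : (q : ℝ) < u y := by exact_mod_cast hq2
  have hnull : volume ({y | (q : ℝ) < u y} ∩ (Metric.ball x ε ∩ Ω)) = 0 := by
    have h := localEssSup_le_iff.1 hq1.le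
    rw [ae_iff, Measure.restrict_apply' (Metric.isOpen_ball.measurableSet.inter
      hΩ.measurableSet)] at h
    refine measure_mono_null (inter_subset_inter_left _ fun z hz => ?_) h
    simp only [mem_ofPred_eq, not_le] at hz ⊢
    exact_mod_cast hz
  have ht := hy q ⟨hyΩ, hq2'⟩
  -- The volume ratio of a ball of radius `r / 2` to one of radius `r`: such a fraction of every
  -- small ball around `y` lies in `B(x, ε)`, even when `y` is on the sphere, so `y` cannot be a
  -- density point of `{u > q}`.
  set κ : ℝ≥0∞ := ENNReal.ofReal ((1 / 2) ^ Module.finrank ℝ (Pt N)) with hκ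
  have hκ0 : 0 < κ := by rw [hκ, ENNReal.ofReal_pos]; positivity
  have hκ1 : κ ≠ ∞ := ENNReal.ofReal_ne_top
  have hev : ∀ᶠ r in 𝓝[>] (0 : ℝ), volume ((Ω ∩ {y | (q : ℝ) < u y}) ∩ Metric.closedBall y r) /
        volume (Metric.closedBall y r) ≤ 1 - κ := by
    filter_upwards [Ioo_mem_nhdsGT hε] with r hr
    obtain ⟨hr0, hr1⟩ := hr
    -- Moving from `y` towards `x` makes room for a ball of radius `r / 2` inside both `B(x, ε)` and
    -- the closed `r`-ball around `y`.
    set z : Pt N := y + (r / (2 * ε)) • (x - y) with hz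
    have hzy : dist z y ≤ r / 2 := by
      rw [hz, dist_eq_norm, add_sub_cancel_left, norm_smul, Real.norm_of_nonneg (by positivity),
        ← dist_eq_norm, dist_comm]
      calc r / (2 * ε) * dist y x ≤ r / (2 * ε) * ε := by gcongr
        _ = r / 2 := by field_simp
    have hzx : dist z x ≤ ε - r / 2 := by
      have h1 : z - x = (1 - r / (2 * ε)) • (y - x) := by rw [hz]; module
      have h2 : 0 ≤ 1 - r / (2 * ε) := by
        rw [sub_nonneg, div_le_one (by positivity)]; linarith
      rw [dist_eq_norm, h1, norm_smul, Real.norm_of_nonneg h2, ← dist_eq_norm]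
      calc (1 - r / (2 * ε)) * dist y x ≤ (1 - r / (2 * ε)) * ε := by gcongr
        _ = ε - r / 2 := by field_simp
    have hs1 : Metric.ball z (r / 2) ⊆ Metric.ball x ε := Metric.ball_subset_ball' (by linarith)
    have hs2 : Metric.ball z (r / 2) ⊆ Metric.closedBall y r :=
      Metric.ball_subset_closedBall.trans (Metric.closedBall_subset_closedBall' (by linarith))
    have hvol : volume (Metric.ball z (r / 2)) = κ * volume (Metric.closedBall y r) := by
      rw [Measure.addHaar_ball_of_pos volume z (by positivity),
        Measure.addHaar_closedBall volume y hr0.le, hκ, ← mul_assoc,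
        ← ENNReal.ofReal_mul (by positivity), ← mul_pow]
      congr 3
      ring
    have hfin : volume (Metric.closedBall y r) ≠ ∞ := measure_closedBall_lt_top.ne
    have hpos : volume (Metric.closedBall y r) ≠ 0 := (Metric.measure_closedBall_pos _ _ hr0).ne'
    rw [ENNReal.div_le_iff hpos hfin]
    calc volume ((Ω ∩ {y | (q : ℝ) < u y}) ∩ Metric.closedBall y r)
        ≤ volume ((Metric.closedBall y r \ Metric.ball z (r / 2)) ∪
            ({y | (q : ℝ) < u y} ∩ (Metric.ball x ε ∩ Ω))) := by
          refine measure_mono ?_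
          rintro p ⟨⟨hp1, hp2⟩, hp3⟩
          by_cases hp : p ∈ Metric.ball z (r / 2)
          · exact Or.inr ⟨hp2, hs1 hp, hp1⟩
          · exact Or.inl ⟨hp3, hp⟩
      _ ≤ volume (Metric.closedBall y r \ Metric.ball z (r / 2)) + 0 := by
          rw [← hnull]; exact measure_union_le _ _
      _ = (1 - κ) * volume (Metric.closedBall y r) := by
          rw [add_zero, measure_sdiff hs2 Metric.isOpen_ball.measurableSet.nullMeasurableSet
            measure_ball_lt_top.ne, hvol, ENNReal.sub_mul (fun _ _ => hfin), one_mul]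
  have hle : (1 : ℝ≥0∞) ≤ 1 - κ := le_of_tendsto ht hev
  have : (1 : ℝ≥0∞) - κ < 1 := ENNReal.sub_lt_self ENNReal.one_ne_top one_ne_zero hκ0.ne'
  exact absurd hle (not_le.2 this)

theorem ae_localEssInf_le (hΩ : IsOpen Ω) (hε : 0 < ε) (u : Pt N → ℝ) :
    ∀ᵐ y ∂(volume.restrict Ω), ∀ x, dist y x ≤ ε → localEssInf Ω ε u x ≤ (u y : EReal) := by
  filter_upwards [ae_le_localEssSup hΩ hε (fun y => -u y)] with y hy x hx
  have := hy x hx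
  rw [localEssSup_neg, EReal.coe_neg] at this
  exact EReal.neg_le_neg_iff.1 this

theorem TV_congr {ρ₀ ρ₁ : Pt N → ℝ} (h : u =ᵐ[volume.restrict Ω] v) :
    TV Ω ρ₀ ρ₁ ε u = TV Ω ρ₀ ρ₁ ε v := by
  unfold TV
  congr 2
  · refine lintegral_congr_ae ?_
    filter_upwards [h] with x hx
    rw [localEssSup_congr h, hx]
  · refine lintegral_congr_ae ?_
    filter_upwards [h] with x hx
    rw [localEssInf_congr h, hx]

theorem energy_congr {ρ₀ ρ₁ f : Pt N → ℝ} (h : u =ᵐ[volume.restrict Ω] v) :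
    energy Ω ρ₀ ρ₁ ε f u = energy Ω ρ₀ ρ₁ ε f v := by
  unfold energy
  rw [TV_congr h]
  congr 2
  refine lintegral_congr_ae ?_
  filter_upwards [h] with x hx
  rw [hx]

theorem IsMinimizer.congr {ρ₀ ρ₁ f : Pt N → ℝ}
    (hu : IsMinimizer Ω ρ₀ ρ₁ ε f u) (h : u =ᵐ[volume.restrict Ω] v) :
    IsMinimizer Ω ρ₀ ρ₁ ε f v :=
  ⟨hu.1.ae_eq h, fun z hz => by rw [← energy_congr h]; exact hu.2 z hz⟩

/-- A sign change swaps the upper and lower oscillations, hence the two weights; this is what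
reduces superflows to subflows. -/
theorem energy_neg (ρ₀ ρ₁ f u : Pt N → ℝ) :
    energy Ω ρ₁ ρ₀ ε (fun x => -f x) (fun x => -u x) = energy Ω ρ₀ ρ₁ ε f u := by
  have h1 : ∀ x, |-u x - -f x| = |u x - f x| := fun x => by rw [← abs_neg]; ring_nf
  have h2 : ∀ x, localEssSup Ω ε (fun y => -u y) x - ((-u x : ℝ) : EReal) =
      (u x : EReal) - localEssInf Ω ε u x := fun x => by
    rw [localEssSup_neg, EReal.coe_neg, sub_eq_add_neg, neg_neg, add_comm, sub_eq_add_neg]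
  have h3 : ∀ x, ((-u x : ℝ) : EReal) - localEssInf Ω ε (fun y => -u y) x =
      localEssSup Ω ε u x - (u x : EReal) := fun x => by
    rw [localEssInf_neg, EReal.coe_neg, sub_eq_add_neg, neg_neg, add_comm, sub_eq_add_neg]
  simp only [energy, TV, h1, h2, h3, add_comm (ρ₁ _) (ρ₀ _)]
  rw [add_comm (∫⁻ x in Ω, _ * ENNReal.ofReal (ρ₁ x))]

theorem IsMinimizer.neg {ρ₀ ρ₁ f : Pt N → ℝ} (hu : IsMinimizer Ω ρ₀ ρ₁ ε f u) :
    IsMinimizer Ω ρ₁ ρ₀ ε (fun x => -f x) (fun x => -u x) := by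
  refine ⟨hu.1.neg, fun z hz => ?_⟩
  have h := hu.2 _ hz.neg
  rw [energy_neg]
  refine h.trans_eq ?_
  rw [← energy_neg]
  simp

theorem localEssSup_add_const (s : ℝ) :
    localEssSup Ω ε (fun y => u y + s) x = localEssSup Ω ε u x + s := by
  refine eq_of_forall_ge_iff fun a => ?_
  have h : ∀ b : EReal, b + s ≤ a ↔ b ≤ a - s := fun b =>
    (EReal.le_sub_iff_add_le (Or.inl (EReal.coe_ne_bot s)) (Or.inl (EReal.coe_ne_top s))).symm
  rw [localEssSup_le_iff, h, localEssSup_le_iff]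
  simp only [EReal.coe_add, h]

theorem localEssInf_add_const (s : ℝ) :
    localEssInf Ω ε (fun y => u y + s) x = localEssInf Ω ε u x + s := by
  refine eq_of_forall_le_iff fun a => ?_
  have h : ∀ b : EReal, a ≤ b + s ↔ a - s ≤ b := fun b =>
    (EReal.sub_le_iff_le_add (Or.inl (EReal.coe_ne_bot s)) (Or.inl (EReal.coe_ne_top s))).symm
  rw [le_localEssInf_iff, h, le_localEssInf_iff]
  simp only [EReal.coe_add, h]

/-- Oscillations do not see constants. Shifting the data creates the strict margin in the final
inclusions. -/
theorem energy_add_const (ρ₀ ρ₁ f u : Pt N → ℝ) (s : ℝ) :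
    energy Ω ρ₀ ρ₁ ε (fun x => f x + s) (fun x => u x + s) = energy Ω ρ₀ ρ₁ ε f u := by
  have h2 : ∀ (a : EReal) (b : ℝ), a + s - ((b + s : ℝ) : EReal) = a - b := fun a b => by
    induction a with
    | bot => simp
    | top => rw [EReal.top_add_coe, EReal.top_sub_coe, EReal.top_sub_coe]
    | coe a => norm_cast; ring
  have h3 : ∀ (a : EReal) (b : ℝ), ((b + s : ℝ) : EReal) - (a + s) = b - a := fun a b => by
    induction a with
    | bot => simp
    | top => simp
    | coe a => norm_cast; ring
  simp only [energy, TV, localEssSup_add_const, localEssInf_add_const, h2, h3,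
    add_sub_add_right_eq_sub]

theorem IsMinimizer.add_const {ρ₀ ρ₁ f : Pt N → ℝ} [IsFiniteMeasure (volume.restrict Ω)]
    (hu : IsMinimizer Ω ρ₀ ρ₁ ε f u) (s : ℝ) :
    IsMinimizer Ω ρ₀ ρ₁ ε (fun x => f x + s) (fun x => u x + s) := by
  refine ⟨hu.1.add (memLp_const s), fun z hz => ?_⟩
  have h := hu.2 _ (hz.sub (memLp_const s))
  rw [energy_add_const]
  refine h.trans_eq ?_
  rw [← energy_add_const _ _ _ _ s]
  simp

end LocalEss

/-! ### Existence of minimizers -/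

section Existence

theorem ennreal_add_liminf_le (a b : ℕ → ℝ≥0∞) :
    liminf a atTop + liminf b atTop ≤ liminf (fun n => a n + b n) atTop := by
  simp only [liminf_eq_iSup_iInf_of_nat]
  rw [ENNReal.iSup_add_iSup_of_monotone]
  · exact iSup_mono fun n => le_iInf₂ fun i hi => add_le_add (iInf₂_le i hi) (iInf₂_le i hi)
  · exact fun m n hmn => le_iInf₂ fun i hi => iInf₂_le i (hmn.trans hi)
  · exact fun m n hmn => le_iInf₂ fun i hi => iInf₂_le i (hmn.trans hi)

variable {N : ℕ} {Ω : Set (Pt N)} {ε : ℝ} {u v : Pt N → ℝ} {x : Pt N}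

/-- The upper oscillation `ess sup_{B(x,ε) ∩ Ω} u - u(x)`. -/
def upOsc (Ω : Set (Pt N)) (ε : ℝ) (u : Pt N → ℝ) (x : Pt N) : ℝ≥0∞ :=
  (localEssSup Ω ε u x - (u x : EReal)).toENNReal

theorem upOsc_neg : upOsc Ω ε (fun y => -u y) x =
    ((u x : EReal) - localEssInf Ω ε u x).toENNReal := by
  rw [upOsc, localEssSup_neg, EReal.coe_neg, sub_eq_add_neg, neg_neg, add_comm, sub_eq_add_neg]

theorem upOsc_eq_top (h : localEssSup Ω ε u x = ⊤) : upOsc Ω ε u x = ⊤ := by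
  rw [upOsc, h, EReal.top_sub_coe, EReal.toENNReal_top]

theorem upOsc_eq_ofReal {s : ℝ} (h : localEssSup Ω ε u x = s) :
    upOsc Ω ε u x = ENNReal.ofReal (s - u x) := by
  rw [upOsc, h, ← EReal.coe_sub, EReal.toENNReal_of_ne_top (EReal.coe_ne_top _), EReal.toReal_coe]

theorem aemeasurable_upOsc {μ : Measure (Pt N)} (hΩ : MeasurableSet Ω) (hu : AEMeasurable u μ) :
    AEMeasurable (upOsc Ω ε u) μ := by
  have h : upOsc Ω ε u = fun x => (localEssSup Ω ε u x + ((-u x : ℝ) : EReal)).toENNReal := by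
    funext x
    rw [upOsc, EReal.coe_neg, sub_eq_add_neg]
  rw [h]
  exact ((measurable_localEssSup hΩ).aemeasurable.add hu.neg.coe_real_ereal).ereal_toENNReal

/-- Convexity of the essential supremum. The three hypotheses hold almost everywhere; they exclude
the value `⊥` and ensure that `toENNReal` truncates nothing. -/
theorem upOsc_midpoint_le (hu : (u x : EReal) ≤ localEssSup Ω ε u x)
    (hv : (v x : EReal) ≤ localEssSup Ω ε v x) (hm : (((u x + v x) / 2 : ℝ) : EReal) ≤
      localEssSup Ω ε (fun y => (u y + v y) / 2) x) :
    2 * upOsc Ω ε (fun y => (u y + v y) / 2) x ≤ upOsc Ω ε u x + upOsc Ω ε v x := by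
  by_cases h1 : localEssSup Ω ε u x = ⊤
  · simp [upOsc_eq_top h1]
  by_cases h2 : localEssSup Ω ε v x = ⊤
  · simp [upOsc_eq_top h2]
  have h1' : localEssSup Ω ε u x ≠ ⊥ := fun h => by simp [h] at hu
  have h2' : localEssSup Ω ε v x ≠ ⊥ := fun h => by simp [h] at hv
  lift localEssSup Ω ε u x to ℝ using ⟨h1, h1'⟩ with a ha
  lift localEssSup Ω ε v x to ℝ using ⟨h2, h2'⟩ with b hb
  have h3 : localEssSup Ω ε (fun y => (u y + v y) / 2) x ≤ (((a + b) / 2 : ℝ) : EReal) := by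
    rw [localEssSup_le_iff]
    filter_upwards [localEssSup_le_iff.1 ha.symm.le, localEssSup_le_iff.1 hb.symm.le] with y h h'
    rw [EReal.coe_le_coe_iff] at *
    linarith
  have h4 : localEssSup Ω ε (fun y => (u y + v y) / 2) x ≠ ⊤ := fun h => by simp [h] at h3
  have h4' : localEssSup Ω ε (fun y => (u y + v y) / 2) x ≠ ⊥ := fun h => by simp [h] at hm
  lift localEssSup Ω ε (fun y => (u y + v y) / 2) x to ℝ using ⟨h4, h4'⟩ with m hm'
  rw [upOsc_eq_ofReal ha.symm, upOsc_eq_ofReal hb.symm, upOsc_eq_ofReal hm'.symm]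
  rw [EReal.coe_le_coe_iff] at *
  rw [← ENNReal.ofReal_add (by linarith) (by linarith), ← ENNReal.ofReal_ofNat,
    ← ENNReal.ofReal_mul (by norm_num)]
  exact ENNReal.ofReal_le_ofReal (by linarith)

/-- For almost every `y` in the ball `f n y` is at most the local supremum of `f n`, and this bound
survives the limit inferior. -/
theorem upOsc_le_liminf {f : ℕ → Pt N → ℝ} (hx : Tendsto (fun n => f n x) atTop (𝓝 (u x)))
    (h : ∀ᵐ y ∂(volume.restrict Ω), Tendsto (fun n => f n y) atTop (𝓝 (u y))) :
    upOsc Ω ε u x ≤ liminf (fun n => upOsc Ω ε (f n) x) atTop := by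
  have h1 : localEssSup Ω ε u x ≤ liminf (fun n => localEssSup Ω ε (f n) x) atTop := by
    rw [localEssSup_le_iff]
    have h2 : ∀ᵐ y ∂(volume.restrict (Metric.ball x ε ∩ Ω)), ∀ n,
        (f n y : EReal) ≤ localEssSup Ω ε (f n) x :=
      ae_all_iff.2 fun n => localEssSup_le_iff.1 le_rfl
    filter_upwards [h2, ae_ball_inter_of_ae h] with y hy1 hy2
    have h3 : Tendsto (fun n => (f n y : EReal)) atTop (𝓝 (u y)) :=
      (continuous_coe_real_ereal.tendsto _).comp hy2
    rw [← h3.liminf_eq]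
    exact liminf_le_liminf (Eventually.of_forall hy1)
  have h2 : localEssSup Ω ε u x - (u x : EReal) ≤
      liminf (fun n => localEssSup Ω ε (f n) x - (f n x : EReal)) atTop := by
    have h3 : Tendsto (fun n => ((-f n x : ℝ) : EReal)) atTop (𝓝 ((-u x : ℝ) : EReal)) :=
      (continuous_coe_real_ereal.tendsto _).comp hx.neg
    have h4 := EReal.le_liminf_add (u := fun n => localEssSup Ω ε (f n) x)
      (v := fun n => ((-f n x : ℝ) : EReal)) (f := atTop)
    rw [h3.liminf_eq] at h4
    have h5 : ((fun n => localEssSup Ω ε (f n) x) + fun n => ((-f n x : ℝ) : EReal)) =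
        fun n => localEssSup Ω ε (f n) x - (f n x : EReal) := by
      funext n
      rw [Pi.add_apply, EReal.coe_neg, sub_eq_add_neg]
    rw [h5] at h4
    refine le_trans ?_ h4
    rw [sub_eq_add_neg, ← EReal.coe_neg]
    exact add_le_add_left h1 _
  have h6 := Monotone.map_liminf_of_continuousAt (F := atTop) (f := EReal.toENNReal)
    (fun a b hab => EReal.toENNReal_le_toENNReal hab)
    (fun n => localEssSup Ω ε (f n) x - (f n x : EReal)) EReal.continuous_toENNReal.continuousAt
  calc upOsc Ω ε u x ≤ _ := EReal.toENNReal_le_toENNReal h2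
    _ = _ := h6

variable {ρ₀ ρ₁ f : Pt N → ℝ}

/-- The integrand of the energy. -/
def energyDensity (Ω : Set (Pt N)) (ρ₀ ρ₁ : Pt N → ℝ) (ε : ℝ) (f u : Pt N → ℝ) (x : Pt N) : ℝ≥0∞ :=
  ENNReal.ofReal (1 / (2 * ε)) *
      (ENNReal.ofReal (|u x - f x| ^ 2) * ENNReal.ofReal (ρ₀ x + ρ₁ x)) +
    ENNReal.ofReal (1 / ε) * (upOsc Ω ε u x * ENNReal.ofReal (ρ₀ x) +
      upOsc Ω ε (fun y => -u y) x * ENNReal.ofReal (ρ₁ x))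

section

variable (hΩ : MeasurableSet Ω) (hρ₀ : AEMeasurable ρ₀ (volume.restrict Ω))
  (hρ₁ : AEMeasurable ρ₁ (volume.restrict Ω)) (hf : AEMeasurable f (volume.restrict Ω))

include hΩ hρ₀ hρ₁ hf

theorem aemeasurable_energyDensity (hu : AEMeasurable u (volume.restrict Ω)) :
    AEMeasurable (energyDensity Ω ρ₀ ρ₁ ε f u) (volume.restrict Ω) := by
  have h1 := aemeasurable_upOsc (ε := ε) hΩ hu
  have h2 := aemeasurable_upOsc (ε := ε) hΩ hu.neg
  have h3 : AEMeasurable (fun x => |u x - f x| ^ 2) (volume.restrict Ω) :=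
    ((continuous_abs.measurable.comp_aemeasurable (hu.sub hf)).pow_const 2)
  exact ((h3.ennreal_ofReal.mul (hρ₀.add hρ₁).ennreal_ofReal).const_mul _).add
    (((h1.mul hρ₀.ennreal_ofReal).add (h2.mul hρ₁.ennreal_ofReal)).const_mul _)

theorem energy_eq_lintegral (hu : AEMeasurable u (volume.restrict Ω)) :
    energy Ω ρ₀ ρ₁ ε f u = ∫⁻ x in Ω, energyDensity Ω ρ₀ ρ₁ ε f u x := by
  have h1 := aemeasurable_upOsc (ε := ε) hΩ hu
  have h3 : AEMeasurable (fun x => |u x - f x| ^ 2) (volume.restrict Ω) :=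
    ((continuous_abs.measurable.comp_aemeasurable (hu.sub hf)).pow_const 2)
  have h4 := h3.ennreal_ofReal.mul (hρ₀.add hρ₁).ennreal_ofReal
  unfold energyDensity
  simp_rw [upOsc_neg]
  rw [lintegral_add_left' (by exact h4.const_mul _), lintegral_const_mul' _ _ ENNReal.ofReal_ne_top,
    lintegral_const_mul' _ _ ENNReal.ofReal_ne_top,
    lintegral_add_left' (by exact h1.mul hρ₀.ennreal_ofReal)]
  rfl

end

/-- The parallelogram identity gives the quadratic gain `|u - v|² / 2`, which `ρ > c` turns into
uniform convexity in `L²`; the oscillation terms are merely convex. -/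
theorem energyDensity_midpoint_le {c : ℝ} (hε : 0 < ε) (hc : 0 < c) (hρ : c < ρ₀ x + ρ₁ x)
    (h1 : 2 * upOsc Ω ε (fun y => (u y + v y) / 2) x ≤ upOsc Ω ε u x + upOsc Ω ε v x)
    (h2 : 2 * upOsc Ω ε (fun y => -((u y + v y) / 2)) x ≤
      upOsc Ω ε (fun y => -u y) x + upOsc Ω ε (fun y => -v y) x) :
    2 * energyDensity Ω ρ₀ ρ₁ ε f (fun y => (u y + v y) / 2) x +
      ENNReal.ofReal (c / (4 * ε)) * ENNReal.ofReal (|u x - v x| ^ 2) ≤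
      energyDensity Ω ρ₀ ρ₁ ε f u x + energyDensity Ω ρ₀ ρ₁ ε f v x := by
  have h3 : ENNReal.ofReal (c / (4 * ε)) * ENNReal.ofReal (|u x - v x| ^ 2) ≤
      ENNReal.ofReal (1 / (2 * ε)) * (ENNReal.ofReal (|u x - v x| ^ 2 / 2) *
        ENNReal.ofReal (ρ₀ x + ρ₁ x)) := by
    rw [← ENNReal.ofReal_mul (by positivity), ← ENNReal.ofReal_mul (by positivity),
      ← ENNReal.ofReal_mul (by positivity)]
    refine ENNReal.ofReal_le_ofReal ?_
    have : c / (4 * ε) * |u x - v x| ^ 2 = 1 / (2 * ε) * (|u x - v x| ^ 2 / 2 * c) := by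
      field_simp; ring
    rw [this]
    gcongr
  have h4 : 2 * ENNReal.ofReal (|(u x + v x) / 2 - f x| ^ 2) + ENNReal.ofReal (|u x - v x| ^ 2 / 2)
      = ENNReal.ofReal (|u x - f x| ^ 2) + ENNReal.ofReal (|v x - f x| ^ 2) := by
    rw [← ENNReal.ofReal_ofNat, ← ENNReal.ofReal_mul (by norm_num),
      ← ENNReal.ofReal_add (by positivity) (by positivity),
      ← ENNReal.ofReal_add (by positivity) (by positivity)]
    congr 1
    simp only [sq_abs]
    ring
  refine (add_le_add_right h3 _).trans ?_
  unfold energyDensity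
  set a := ENNReal.ofReal (1 / (2 * ε))
  set b := ENNReal.ofReal (1 / ε)
  set r := ENNReal.ofReal (ρ₀ x + ρ₁ x)
  set r₀ := ENNReal.ofReal (ρ₀ x)
  set r₁ := ENNReal.ofReal (ρ₁ x)
  calc _ = a * ((2 * ENNReal.ofReal (|(u x + v x) / 2 - f x| ^ 2) +
          ENNReal.ofReal (|u x - v x| ^ 2 / 2)) * r) +
        b * ((2 * upOsc Ω ε (fun y => (u y + v y) / 2) x) * r₀ +
          (2 * upOsc Ω ε (fun y => -((u y + v y) / 2)) x) * r₁) := by ring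
    _ ≤ a * ((ENNReal.ofReal (|u x - f x| ^ 2) + ENNReal.ofReal (|v x - f x| ^ 2)) * r) +
        b * ((upOsc Ω ε u x + upOsc Ω ε v x) * r₀ +
          (upOsc Ω ε (fun y => -u y) x + upOsc Ω ε (fun y => -v y) x) * r₁) := by
        rw [h4]; gcongr
    _ = _ := by ring

theorem energyDensity_le_liminf {g : ℕ → Pt N → ℝ}
    (hx : Tendsto (fun n => g n x) atTop (𝓝 (u x)))
    (h : ∀ᵐ y ∂(volume.restrict Ω), Tendsto (fun n => g n y) atTop (𝓝 (u y))) :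
    energyDensity Ω ρ₀ ρ₁ ε f u x ≤ liminf (fun n => energyDensity Ω ρ₀ ρ₁ ε f (g n) x) atTop := by
  have h1 := upOsc_le_liminf (ε := ε) hx h
  have h2 : upOsc Ω ε (fun y => -u y) x ≤
      liminf (fun n => upOsc Ω ε (fun y => -g n y) x) atTop :=
    upOsc_le_liminf hx.neg (by filter_upwards [h] with y hy using hy.neg)
  have h3 : Tendsto (fun n => ENNReal.ofReal (1 / (2 * ε)) *
      (ENNReal.ofReal (|g n x - f x| ^ 2) * ENNReal.ofReal (ρ₀ x + ρ₁ x))) atTop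
      (𝓝 (ENNReal.ofReal (1 / (2 * ε)) *
      (ENNReal.ofReal (|u x - f x| ^ 2) * ENNReal.ofReal (ρ₀ x + ρ₁ x)))) := by
    refine ENNReal.Tendsto.const_mul (ENNReal.Tendsto.mul_const ?_ (Or.inr ENNReal.ofReal_ne_top))
      (Or.inr ENNReal.ofReal_ne_top)
    exact ENNReal.tendsto_ofReal (((hx.sub_const _).abs).pow 2)
  set a := ENNReal.ofReal (1 / ε) with ha
  set r₀ := ENNReal.ofReal (ρ₀ x) with hr₀
  set r₁ := ENNReal.ofReal (ρ₁ x) with hr₁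
  have h4 : upOsc Ω ε u x * r₀ ≤ liminf (fun n => upOsc Ω ε (g n) x * r₀) atTop := by
    rw [ENNReal.liminf_mul_const_of_ne_top ENNReal.ofReal_ne_top]
    rw [mul_comm]
    exact mul_le_mul_right h1 _
  have h5 : upOsc Ω ε (fun y => -u y) x * r₁ ≤
      liminf (fun n => upOsc Ω ε (fun y => -g n y) x * r₁) atTop := by
    rw [ENNReal.liminf_mul_const_of_ne_top ENNReal.ofReal_ne_top]
    rw [mul_comm]
    exact mul_le_mul_right h2 _
  have h6 : a * (upOsc Ω ε u x * r₀ + upOsc Ω ε (fun y => -u y) x * r₁) ≤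
      liminf (fun n => a * (upOsc Ω ε (g n) x * r₀ + upOsc Ω ε (fun y => -g n y) x * r₁))
        atTop := by
    rw [ENNReal.liminf_const_mul_of_ne_top ENNReal.ofReal_ne_top]
    exact mul_le_mul_right ((add_le_add h4 h5).trans (ennreal_add_liminf_le _ _)) _
  calc _ ≤ _ := add_le_add h3.liminf_eq.ge h6
    _ ≤ _ := ennreal_add_liminf_le _ _

theorem TV_zero (hΩ : IsOpen Ω) (hε : 0 < ε) (ρ₀ ρ₁ : Pt N → ℝ) :
    TV Ω ρ₀ ρ₁ ε (fun _ => 0) = 0 := by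
  -- Needed because the essential supremum of a constant for the zero measure is `⊥`.
  have h0 : ∀ x ∈ Ω, volume.restrict (Metric.ball x ε ∩ Ω) ≠ 0 := fun x hx h => by
    rw [Measure.restrict_eq_zero] at h
    exact ((Metric.isOpen_ball.inter hΩ).measure_pos volume
      ⟨x, Metric.mem_ball_self hε, hx⟩).ne' h
  unfold TV
  rw [setLIntegral_congr_fun (g := fun _ => 0) hΩ.measurableSet,
    setLIntegral_congr_fun (f := fun x => _ * ENNReal.ofReal (ρ₁ x)) (g := fun _ => 0)
      hΩ.measurableSet]
  · simp
  · intro x hx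
    simp only [localEssInf, essInf_const _ (h0 x hx)]
    simp
  · intro x hx
    simp only [localEssSup, essSup_const _ (h0 x hx)]
    simp

theorem energy_zero_ne_top (hΩ : IsOpen Ω) (hΩb : Bornology.IsBounded Ω) (hε : 0 < ε)
    {c : ℝ} (hρ : ∀ x ∈ Ω, ρ₀ x + ρ₁ x < c⁻¹) {M : ℝ} (hf : ∀ x ∈ Ω, |f x| ≤ M) :
    energy Ω ρ₀ ρ₁ ε f (fun _ => 0) ≠ ∞ := by
  unfold energy
  rw [TV_zero hΩ hε, add_zero]
  refine ENNReal.mul_ne_top ENNReal.ofReal_ne_top ?_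
  refine ((setLIntegral_mono' (g := fun _ => ENNReal.ofReal (M ^ 2) * ENNReal.ofReal c⁻¹)
    hΩ.measurableSet fun x hx => ?_).trans_lt ?_).ne
  · gcongr
    · simpa using hf x hx
    · exact (hρ x hx).le
  · rw [setLIntegral_const]
    exact ENNReal.mul_lt_top (ENNReal.mul_lt_top ENNReal.ofReal_lt_top ENNReal.ofReal_lt_top)
      hΩb.measure_lt_top

theorem energy_midpoint_le (hΩ : IsOpen Ω) (hε : 0 < ε) {c : ℝ} (hc : 0 < c)
    (hρ : ∀ x ∈ Ω, c < ρ₀ x + ρ₁ x)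
    (hρ₀ : AEMeasurable ρ₀ (volume.restrict Ω)) (hρ₁ : AEMeasurable ρ₁ (volume.restrict Ω))
    (hf : AEMeasurable f (volume.restrict Ω)) (hu : AEMeasurable u (volume.restrict Ω))
    (hv : AEMeasurable v (volume.restrict Ω)) :
    2 * energy Ω ρ₀ ρ₁ ε f (fun y => (u y + v y) / 2) +
      ENNReal.ofReal (c / (4 * ε)) * (∫⁻ x in Ω, ENNReal.ofReal (|u x - v x| ^ 2)) ≤
      energy Ω ρ₀ ρ₁ ε f u + energy Ω ρ₀ ρ₁ ε f v := by
  have hm : AEMeasurable (fun y => (u y + v y) / 2) (volume.restrict Ω) :=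
    (hu.add hv).div_const 2
  have hΩm := hΩ.measurableSet
  rw [energy_eq_lintegral hΩm hρ₀ hρ₁ hf hm, energy_eq_lintegral hΩm hρ₀ hρ₁ hf hu,
    energy_eq_lintegral hΩm hρ₀ hρ₁ hf hv, ← lintegral_const_mul' _ _ ENNReal.ofReal_ne_top,
    ← lintegral_const_mul' _ _ (by norm_num),
    ← lintegral_add_left' ((aemeasurable_energyDensity hΩm hρ₀ hρ₁ hf hm).const_mul _),
    ← lintegral_add_left' (aemeasurable_energyDensity hΩm hρ₀ hρ₁ hf hu)]
  refine lintegral_mono_ae ?_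
  have hself : ∀ w : Pt N → ℝ, ∀ᵐ x ∂(volume.restrict Ω),
      (w x : EReal) ≤ localEssSup Ω ε w x := fun w => by
    filter_upwards [ae_le_localEssSup hΩ hε w] with x hx
    exact hx x (by simpa using hε.le)
  filter_upwards [ae_restrict_mem hΩm, hself u, hself v, hself (fun y => (u y + v y) / 2),
    hself (fun y => -u y), hself (fun y => -v y), hself (fun y => (-u y + -v y) / 2)]
    with x hx h1 h2 h3 h4 h5 h6
  have h7 : (fun y => -((u y + v y) / 2)) = fun y => (-u y + -v y) / 2 := by funext y; ring
  refine energyDensity_midpoint_le hε hc (hρ x hx) (upOsc_midpoint_le h1 h2 h3) ?_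
  rw [h7]
  exact upOsc_midpoint_le h4 h5 h6

theorem energy_le_liminf (hΩ : IsOpen Ω)
    (hρ₀ : AEMeasurable ρ₀ (volume.restrict Ω)) (hρ₁ : AEMeasurable ρ₁ (volume.restrict Ω))
    (hf : AEMeasurable f (volume.restrict Ω)) (hu : AEMeasurable u (volume.restrict Ω))
    {g : ℕ → Pt N → ℝ} (hg : ∀ n, AEMeasurable (g n) (volume.restrict Ω))
    (h : ∀ᵐ y ∂(volume.restrict Ω), Tendsto (fun n => g n y) atTop (𝓝 (u y))) :
    energy Ω ρ₀ ρ₁ ε f u ≤ liminf (fun n => energy Ω ρ₀ ρ₁ ε f (g n)) atTop := by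
  have hΩm := hΩ.measurableSet
  rw [energy_eq_lintegral hΩm hρ₀ hρ₁ hf hu]
  simp_rw [fun n => energy_eq_lintegral (ε := ε) hΩm hρ₀ hρ₁ hf (hg n)]
  refine le_trans ?_ (lintegral_liminf_le' fun n =>
    aemeasurable_energyDensity hΩm hρ₀ hρ₁ hf (hg n))
  refine lintegral_mono_ae ?_
  filter_upwards [h] with x hx using energyDensity_le_liminf hx h

/-- Uniform convexity makes a minimizing sequence Cauchy in `L²`, so no weak compactness is needed.
A subsequence converges almost everywhere, and lower semicontinuity follows from Fatou's lemma. -/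
theorem exists_isMinimizer (hΩ : IsOpen Ω) (hΩb : Bornology.IsBounded Ω) (hε : 0 < ε)
    {c : ℝ} (hc : 0 < c) (hρ : ∀ x ∈ Ω, c < ρ₀ x + ρ₁ x ∧ ρ₀ x + ρ₁ x < c⁻¹)
    (hρ₀ : AEMeasurable ρ₀ (volume.restrict Ω)) (hρ₁ : AEMeasurable ρ₁ (volume.restrict Ω))
    (hf : AEMeasurable f (volume.restrict Ω)) {M : ℝ} (hM : ∀ x ∈ Ω, |f x| ≤ M) :
    ∃ w, IsMinimizer Ω ρ₀ ρ₁ ε f w := by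
  set I : ℝ≥0∞ := ⨅ u : {u : Pt N → ℝ // MemLp u 2 (volume.restrict Ω)},
    energy Ω ρ₀ ρ₁ ε f u.1 with hI
  have hIle : ∀ u, MemLp u 2 (volume.restrict Ω) → I ≤ energy Ω ρ₀ ρ₁ ε f u := fun u hu =>
    iInf_le (fun u : {u : Pt N → ℝ // MemLp u 2 (volume.restrict Ω)} =>
      energy Ω ρ₀ ρ₁ ε f u.1) ⟨u, hu⟩
  have hItop : I ≠ ∞ := by
    refine ne_top_of_le_ne_top (energy_zero_ne_top hΩ hΩb hε (fun x hx => (hρ x hx).2) hM)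
      (hIle _ ?_)
    exact MemLp.zero
  set κ : ℝ≥0∞ := ENNReal.ofReal (c / (4 * ε)) with hκ
  have hκ0 : κ ≠ 0 := (ENNReal.ofReal_pos.2 (by positivity)).ne'
  have hκt : κ ≠ ∞ := ENNReal.ofReal_ne_top
  -- Summable Cauchy radii. Two functions whose energies are within `κ B² / 2` of the infimum differ
  -- by less than `B` in `L²`, by the midpoint inequality.
  set B : ℕ → ℝ≥0∞ := fun n => (2⁻¹ : ℝ≥0∞) ^ n with hB
  have hBpos : ∀ n, B n ≠ 0 := fun n => pow_ne_zero _ (by simp)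
  have hBtop : ∀ n, B n ≠ ∞ := fun n => ENNReal.pow_ne_top (by simp)
  have hBanti : Antitone B := fun m n hmn => pow_le_pow_right_of_le_one' (by simp) hmn
  have hη : ∀ n, κ * B n ^ 2 / 2 ≠ 0 := fun n => by
    rw [Ne, ENNReal.div_eq_zero_iff, not_or]
    exact ⟨mul_ne_zero hκ0 (pow_ne_zero _ (hBpos n)), by norm_num⟩
  have hex : ∀ n : ℕ, ∃ u, MemLp u 2 (volume.restrict Ω) ∧
      energy Ω ρ₀ ρ₁ ε f u < I + κ * B n ^ 2 / 2 := fun n => by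
    obtain ⟨⟨u, hu⟩, h⟩ := iInf_lt_iff.1 (ENNReal.lt_add_right hItop (hη n))
    exact ⟨u, hu, h⟩
  choose g hg hgE using hex
  have hcau : ∀ k n m : ℕ, k ≤ n → k ≤ m → eLpNorm (g n - g m) 2 (volume.restrict Ω) < B k := by
    intro k n m hkn hkm
    have h1 := energy_midpoint_le hΩ hε hc (fun x hx => (hρ x hx).1) hρ₀ hρ₁ hf
      (hg n).aemeasurable (hg m).aemeasurable
    have h2 : MemLp (fun y => (g n y + g m y) / 2) 2 (volume.restrict Ω) := by
      have := ((hg n).add (hg m)).const_mul (1 / 2)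
      refine this.congr_norm ?_ ?_
      · exact (((hg n).aemeasurable.add (hg m).aemeasurable).div_const 2).aestronglyMeasurable
      · refine Eventually.of_forall fun x => ?_
        simp only [Pi.add_apply]
        congr 1
        ring
    have h3 := hIle _ h2
    have h4 : eLpNorm (g n - g m) 2 (volume.restrict Ω) ^ (2 : ℕ) =
        ∫⁻ x in Ω, ENNReal.ofReal (|g n x - g m x| ^ 2) := by
      have := eLpNorm_nnreal_pow_eq_lintegral (μ := volume.restrict Ω) (f := g n - g m)
        (p := 2) two_ne_zero
      have h5 : ((2 : NNReal) : ℝ) = ((2 : ℕ) : ℝ) := by norm_num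
      rw [h5] at this
      simp only [ENNReal.rpow_natCast] at this
      refine Eq.trans this ?_
      refine lintegral_congr fun x => ?_
      rw [Real.enorm_eq_ofReal_abs, ← ENNReal.ofReal_pow (abs_nonneg _)]
      rfl
    rw [← h4] at h1
    have hhalf : ∀ j, k ≤ j → κ * B j ^ 2 / 2 ≤ κ * B k ^ 2 / 2 := fun j hj => by
      have := hBanti hj
      gcongr
    have h5 : 2 * I + κ * eLpNorm (g n - g m) 2 (volume.restrict Ω) ^ (2 : ℕ) <
        2 * I + κ * B k ^ 2 := by
      calc _ ≤ _ := by gcongr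
        _ ≤ _ := h1
        _ < (I + κ * B n ^ 2 / 2) + (I + κ * B m ^ 2 / 2) := ENNReal.add_lt_add (hgE n) (hgE m)
        _ ≤ (I + κ * B k ^ 2 / 2) + (I + κ * B k ^ 2 / 2) := by
          gcongr
          exacts [hBanti hkn, hBanti hkm]
        _ = 2 * I + (κ * B k ^ 2 / 2 + κ * B k ^ 2 / 2) := by ring
        _ = _ := by rw [ENNReal.add_halves]
    have h6 := lt_of_add_lt_add_left h5
    have h7 : eLpNorm (g n - g m) 2 (volume.restrict Ω) ^ (2 : ℕ) < B k ^ 2 :=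
      lt_of_not_ge fun h => absurd h6 (not_lt.2 (by gcongr))
    exact lt_of_not_ge fun h => absurd h7 (not_lt.2 (by gcongr))
  have hBsum : ∑' i, B i ≠ ∞ := by
    simp only [hB]
    rw [ENNReal.tsum_geometric]
    simp
  obtain ⟨w, hw, hlim⟩ := Lp.cauchy_complete_eLpNorm one_le_two hg hBsum hcau
  obtain ⟨ns, hns, hae⟩ := (tendstoInMeasure_of_tendsto_eLpNorm two_ne_zero (fun n => (hg n).1)
    hw.1 hlim).exists_seq_tendsto_ae
  refine ⟨w, hw, fun u hu => le_trans ?_ (hIle u hu)⟩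
  have hE : Tendsto (fun n => energy Ω ρ₀ ρ₁ ε f (g (ns n))) atTop (𝓝 I) := by
    have hB0 : Tendsto B atTop (𝓝 0) :=
      ENNReal.tendsto_pow_atTop_nhds_zero_of_lt_one (by simp)
    have h1 : Tendsto (fun n => I + κ * B n ^ 2 / 2) atTop (𝓝 I) := by
      have h2 : Tendsto (fun n => I + κ * B n ^ 2 / 2) atTop (𝓝 (I + κ * 0 ^ 2 / 2)) := by
        refine tendsto_const_nhds.add ?_
        refine ENNReal.Tendsto.div_const ?_ (Or.inr (by norm_num))
        exact ENNReal.Tendsto.const_mul (ENNReal.Tendsto.pow hB0) (Or.inr hκt)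
      simpa using h2
    exact tendsto_of_tendsto_of_tendsto_of_le_of_le tendsto_const_nhds
      (h1.comp hns.tendsto_atTop) (fun n => hIle _ (hg _)) (fun n => (hgE _).le)
  rw [← hE.liminf_eq]
  exact energy_le_liminf hΩ hρ₀ hρ₁ hf hw.aemeasurable (fun n => (hg _).aemeasurable) hae

end Existence

/-! ### Scalar inequalities behind the comparison -/

/-- Read `su`, `sw` as the local suprema of `w - g` and `w`, and `h` as the transported excess. In
the main case `su ≤ min sw 0 = sw - max sw 0`, and `l * h + (1 - l) * g ≤ max sw 0`. -/
theorem toENNReal_sub_add_le_of_sup {su sw : EReal} {a g h l : ℝ} (hh : 0 ≤ h)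
    (hl0 : 0 ≤ l) (hl1 : l ≤ 1) (h1 : (a : EReal) ≤ su) (h2 : su ≤ sw)
    (h3 : (l = 1 ∧ h = 0) ∨
      (su ≤ 0 ∧ (g : EReal) ≤ max sw 0 ∧ (h : EReal) ≤ max sw 0)) :
    (su - a).toENNReal + ENNReal.ofReal (l * h) ≤
      (sw - ((a + g : ℝ) : EReal)).toENNReal + ENNReal.ofReal (l * g) := by
  by_cases htop : sw = ⊤
  · rw [htop, EReal.top_sub_coe, EReal.toENNReal_top, top_add]
    exact le_top
  have hbot : su ≠ ⊥ := fun h => by simp [h] at h1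
  have htop' : su ≠ ⊤ := fun h => htop (top_le_iff.1 (h ▸ h2))
  have hbot' : sw ≠ ⊥ := fun h => hbot (le_bot_iff.1 (h ▸ h2))
  lift su to ℝ using ⟨htop', hbot⟩
  lift sw to ℝ using ⟨htop, hbot'⟩
  rw [EReal.coe_le_coe_iff] at h1 h2
  rw [← EReal.coe_sub, ← EReal.coe_sub, EReal.toENNReal_of_ne_top (EReal.coe_ne_top _),
    EReal.toENNReal_of_ne_top (EReal.coe_ne_top _), EReal.toReal_coe, EReal.toReal_coe,
    ← ENNReal.ofReal_add (by linarith) (by positivity)]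
  refine le_trans (ENNReal.ofReal_le_ofReal ?_) ENNReal.ofReal_add_le
  rcases h3 with ⟨rfl, rfl⟩ | ⟨h3, h4, h5⟩
  · linarith
  · have h3' : su ≤ 0 := by exact_mod_cast h3
    have h4' : g ≤ max sw 0 := by
      rcases le_max_iff.1 h4 with h | h
      · exact le_max_of_le_left (by exact_mod_cast h)
      · exact le_max_of_le_right (by exact_mod_cast h)
    have h5' : h ≤ max sw 0 := by
      rcases le_max_iff.1 h5 with h | h
      · exact le_max_of_le_left (by exact_mod_cast h)
      · exact le_max_of_le_right (by exact_mod_cast h)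
    have h6 : su ≤ sw - max sw 0 := by
      rcases max_cases sw 0 with ⟨h, _⟩ | ⟨h, _⟩ <;> rw [h] <;> linarith
    have h7 : l * h ≤ l * max sw 0 := by gcongr
    have h8 : (1 - l) * g ≤ (1 - l) * max sw 0 :=
      mul_le_mul_of_nonneg_left h4' (by linarith)
    linarith

/-- The counterpart for infima. If the infimum does not fall, `l * g ≤ g` suffices; otherwise its
fall is at most `iw`, which the convex combination of `g` and `h` controls. -/
theorem toENNReal_sub_add_le_of_inf {iu iw : EReal} {a g h l : ℝ} (hg : 0 ≤ g) (hh : 0 ≤ h)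
    (hl0 : 0 ≤ l) (hl1 : l ≤ 1) (h1 : iu ≤ (a : EReal)) (h2 : iw ≤ ((a + g : ℝ) : EReal))
    (h3 : iw ≤ iu ∨ (0 ≤ iu ∧ iw ≤ (((1 - l) * g + l * h : ℝ) : EReal))) :
    ((a : EReal) - iu).toENNReal + ENNReal.ofReal (l * g) ≤
      (((a + g : ℝ) : EReal) - iw).toENNReal + ENNReal.ofReal (l * h) := by
  by_cases hbot : iw = ⊥
  · rw [hbot, EReal.coe_sub_bot, EReal.toENNReal_top, top_add]
    exact le_top
  have htop : iw ≠ ⊤ := fun h => EReal.coe_ne_top _ (top_le_iff.1 (h ▸ h2))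
  have htop' : iu ≠ ⊤ := fun h => by simp [h] at h1
  have hbot' : iu ≠ ⊥ := fun h => by
    rcases h3 with h3 | ⟨h3, -⟩
    · exact hbot (le_bot_iff.1 (h ▸ h3))
    · simp [h] at h3
  lift iu to ℝ using ⟨htop', hbot'⟩
  lift iw to ℝ using ⟨htop, hbot⟩
  rw [EReal.coe_le_coe_iff] at h1 h2
  rw [← EReal.coe_sub, ← EReal.coe_sub, EReal.toENNReal_of_ne_top (EReal.coe_ne_top _),
    EReal.toENNReal_of_ne_top (EReal.coe_ne_top _), EReal.toReal_coe, EReal.toReal_coe,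
    ← ENNReal.ofReal_add (by linarith) (by positivity)]
  refine le_trans (ENNReal.ofReal_le_ofReal ?_) ENNReal.ofReal_add_le
  rcases h3 with h3 | ⟨h3, h4⟩
  · rw [EReal.coe_le_coe_iff] at h3
    have h8 : l * g ≤ 1 * g := by gcongr
    have h9 : 0 ≤ l * h := by positivity
    linarith
  · rw [EReal.coe_le_coe_iff] at h4
    have h3' : 0 ≤ iu := by exact_mod_cast h3
    linarith

/-! ### Fronts, the truncated competitor and its oscillations -/

section Barrier

variable {N : ℕ}

/-- A time step of an evolving front, described by a distance-like function `D` with gradient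
field `V`, which is regular in the zone `|D| < 4b` of `Ω`. -/
structure IsFront (Ω : Set (Pt N)) (ε b : ℝ) (D : Pt N → ℝ) (V : Pt N → Pt N)
    (H : Pt N → Pt N →L[ℝ] Pt N) : Prop where
  measurable : Measurable D
  measurable_grad : Measurable V
  lip : ∀ x ∈ Ω, ∀ y ∈ Ω, D y ≤ D x + dist y x
  deriv : ∀ y ∈ Ω, |D y| < 4 * b → HasFDerivAt V (H y) y
  norm_le : ∀ y ∈ Ω, |D y| < 4 * b → ‖V y‖ ≤ 1
  char_mem : ∀ y ∈ Ω, |D y| < 4 * b → ∀ s, |s| ≤ ε → y + s • V y ∈ Ω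
  char_dist : ∀ y ∈ Ω, |D y| < 4 * b → ∀ s, |s| ≤ ε → D (y + s • V y) = D y + s
  char_grad : ∀ y ∈ Ω, |D y| < 4 * b → ∀ s, |s| ≤ ε → V (y + s • V y) = V y

/-- The outer part of the regular zone. -/
def outerZone (Ω : Set (Pt N)) (b : ℝ) (D : Pt N → ℝ) : Set (Pt N) :=
  {y | y ∈ Ω ∧ -(4 * b) < D y ∧ D y < 0}

theorem abs_lt_of_mem_outerZone {Ω : Set (Pt N)} {b : ℝ} {D : Pt N → ℝ}
    (hb : 0 < b) {y : Pt N} (hy : y ∈ outerZone Ω b D) : |D y| < 4 * b :=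
  abs_lt.2 ⟨hy.2.1, hy.2.2.trans (by linarith)⟩

section Excess

variable {Ω : Set (Pt N)} {D : Pt N → ℝ} (w : Pt N → ℝ)

/-- The part of `w` above zero outside the front. -/
def excess (Ω : Set (Pt N)) (D w : Pt N → ℝ) (x : Pt N) : ℝ :=
  open Classical in if x ∈ Ω ∧ D x < 0 then max (w x) 0 else 0

theorem excess_nonneg (x : Pt N) : 0 ≤ excess Ω D w x := by
  unfold excess
  split_ifs
  exacts [le_max_right _ _, le_rfl]

theorem excess_of_mem {x : Pt N} (hx : x ∈ Ω) (hD : D x < 0) : excess Ω D w x = max (w x) 0 :=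
  if_pos ⟨hx, hD⟩

theorem excess_of_nonneg {x : Pt N} (hD : 0 ≤ D x) : excess Ω D w x = 0 :=
  if_neg fun h => absurd h.2 (not_lt.2 hD)

theorem sub_excess_le (x : Pt N) : w x - excess Ω D w x ≤ w x := by
  linarith [excess_nonneg (Ω := Ω) (D := D) w x]

theorem min_le_sub_excess (x : Pt N) : min (w x) 0 ≤ w x - excess Ω D w x := by
  unfold excess
  split_ifs
  · rcases le_total (w x) 0 with h | h <;> simp [h]
  · simp

end Excess

namespace IsFront

variable {Ω : Set (Pt N)} {ε b s : ℝ} {D : Pt N → ℝ} {V : Pt N → Pt N}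
  {H : Pt N → Pt N →L[ℝ] Pt N} (hF : IsFront Ω ε b D V H)
include hF

theorem measurableSet_outerZone (hΩ : MeasurableSet Ω) : MeasurableSet (outerZone Ω b D) :=
  hΩ.inter ((measurableSet_lt measurable_const hF.measurable).inter
    (measurableSet_lt hF.measurable measurable_const))

theorem hasFDerivWithinAt (hb : 0 < b) (s : ℝ) {y : Pt N} (hy : y ∈ outerZone Ω b D) :
    HasFDerivWithinAt (fun y => y + s • V y) (ContinuousLinearMap.id ℝ _ + s • H y)
      (outerZone Ω b D) y :=
  ((hasFDerivAt_id y).add ((hF.deriv y hy.1 (abs_lt_of_mem_outerZone hb hy)).const_smul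
    s)).hasFDerivWithinAt

/-- `V` is constant along the characteristic, so the foot point is recovered by walking back.
Injectivity, and with it the area formula without multiplicity, follows. -/
theorem back (hb : 0 < b) (hs : |s| ≤ ε) {y : Pt N} (hy : y ∈ outerZone Ω b D) :
    (y + s • V y) - s • V (y + s • V y) = y := by
  rw [hF.char_grad y hy.1 (abs_lt_of_mem_outerZone hb hy) s hs, add_sub_cancel_right]

theorem injOn (hb : 0 < b) (hs : |s| ≤ ε) :
    InjOn (fun y => y + s • V y) (outerZone Ω b D) := fun x hx y hy hxy => by
  have h1 := hF.back hb hs hx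
  have h2 := hF.back hb hs hy
  simp only at hxy
  rw [← h1, ← h2, hxy]

theorem image_subset (hb : 0 < b) (hs : |s| ≤ ε) :
    (fun y => y + s • V y) '' outerZone Ω b D ⊆ Ω := by
  rintro _ ⟨y, hy, rfl⟩
  exact hF.char_mem y hy.1 (abs_lt_of_mem_outerZone hb hy) s hs

theorem measurableSet_image (hΩ : MeasurableSet Ω) (hb : 0 < b) (hs : |s| ≤ ε) :
    MeasurableSet ((fun y => y + s • V y) '' outerZone Ω b D) :=
  measurable_image_of_fderivWithin (hF.measurableSet_outerZone hΩ)
    (fun _ hy => hF.hasFDerivWithinAt hb s hy) (hF.injOn hb hs)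

/-- Almost every property of `Ω` transported along the normals. -/
theorem ae_transport (hΩ : MeasurableSet Ω) (hb : 0 < b) (s : ℝ) {P : Pt N → Prop}
    (hP : ∀ᵐ y ∂(volume.restrict Ω), P y) :
    ∀ᵐ x ∂(volume : Measure (Pt N)), x ∈ (fun y => y + s • V y) '' outerZone Ω b D →
      ∃ y ∈ outerZone Ω b D, P y ∧ x = y + s • V y := by
  rw [ae_restrict_iff' hΩ, ae_iff] at hP
  -- A differentiable map sends null sets to null sets.
  have h0 : volume ((fun y => y + s • V y) '' (outerZone Ω b D ∩ {y | ¬ (y ∈ Ω → P y)})) = 0 := by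
    refine addHaar_image_eq_zero_of_differentiableOn_of_addHaar_eq_zero volume ?_
      (measure_mono_null inter_subset_right hP)
    intro y hy
    exact ((hF.hasFDerivWithinAt hb s hy.1).mono inter_subset_left).differentiableWithinAt
  rw [ae_iff]
  refine measure_mono_null (fun x hx => ?_) h0
  simp only [mem_ofPred_eq, Classical.not_imp, not_exists, not_and] at hx
  obtain ⟨⟨y, hy, rfl⟩, hx⟩ := hx
  exact ⟨y, ⟨hy, fun h => hx y hy (h hy.1) rfl⟩, rfl⟩

theorem setLIntegral_image (hΩ : MeasurableSet Ω) (hb : 0 < b) (hs : |s| ≤ ε) (k : Pt N → ℝ≥0∞) :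
    ∫⁻ x in Ω, ((fun y => y + s • V y) '' outerZone Ω b D).indicator k x =
      ∫⁻ y in outerZone Ω b D,
        ENNReal.ofReal |(ContinuousLinearMap.id ℝ (Pt N) + s • H y).det| * k (y + s • V y) := by
  rw [lintegral_indicator (hF.measurableSet_image hΩ hb hs),
    Measure.restrict_restrict (hF.measurableSet_image hΩ hb hs),
    inter_eq_left.2 (hF.image_subset hb hs)]
  exact lintegral_image_eq_lintegral_abs_det_fderiv_mul volume (hF.measurableSet_outerZone hΩ)
    (fun _ hy => hF.hasFDerivWithinAt hb s hy) (hF.injOn hb hs) k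

section Comparison

variable (w : Pt N → ℝ)

theorem measurable_excess (hΩ : MeasurableSet Ω) (hw : Measurable w) :
    Measurable (excess Ω D w) :=
  Measurable.ite (hΩ.inter (measurableSet_lt hF.measurable measurable_const))
    (hw.max measurable_const) measurable_const

variable {lam : ℝ → ℝ} (hΩ : IsOpen Ω) (hε : 0 < ε) (hεb : ε ≤ b)
  (hl0 : ∀ s, 0 ≤ lam s) (hl1 : ∀ s, lam s ≤ 1) (hl_one : ∀ s, -(2 * b) ≤ s → lam s = 1)
  (hl_zero : ∀ s, s ≤ -(3 * b) → lam s = 0)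

include hΩ hε hεb hl0 hl1 hl_one

open Classical in
-- At depth more than `ε` the whole ball lies in `{D < 0}`, where the competitor is nonpositive,
-- while the supremum of `w` dominates both `w x` and the transported value. Within `ε` of the front
-- `x` is outside the image of the outer zone, so the transported excess is zero and `lam = 1`.
theorem ae_upOsc_competitor_le : ∀ᵐ x ∂(volume.restrict Ω),
    upOsc Ω ε (fun y => w y - excess Ω D w y) x +
      ENNReal.ofReal (lam (D x) * (((fun y => y + (-ε) • V y) '' outerZone Ω b D).indicator
        (fun x => excess Ω D w (x + ε • V x)) x)) ≤
    upOsc Ω ε w x + ENNReal.ofReal (lam (D x) * excess Ω D w x) := by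
  have hb : 0 < b := hε.trans_le hεb
  have hs : |(-ε)| ≤ ε := by rw [abs_neg, abs_of_pos hε]
  filter_upwards [ae_le_localEssSup hΩ hε (fun y => w y - excess Ω D w y),
    ae_le_localEssSup hΩ hε w, ae_restrict_mem hΩ.measurableSet,
    ae_restrict_of_ae (hF.ae_transport hΩ.measurableSet hb (-ε) (ae_le_localEssSup hΩ hε w))]
    with x h1 h2 hxΩ h3
  have hself : dist x x ≤ ε := by simpa using hε.le
  set g := excess Ω D w with hg
  set S := (fun y => y + (-ε) • V y) '' outerZone Ω b D with hS
  have hw : w x = (w x - g x) + g x := by ring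
  have hh : 0 ≤ S.indicator (fun x => g (x + ε • V x)) x :=
    indicator_nonneg (fun _ _ => excess_nonneg w _) _
  have key := toENNReal_sub_add_le_of_sup (su := localEssSup Ω ε (fun y => w y - g y) x)
    (sw := localEssSup Ω ε w x) (a := w x - g x) (g := g x)
    (h := S.indicator (fun x => g (x + ε • V x)) x) (l := lam (D x))
    hh (hl0 _) (hl1 _) (h1 x hself)
    (localEssSup_mono (Eventually.of_forall fun y => sub_excess_le w y)) ?_
  · rw [sub_add_cancel] at key
    exact key
  have hmax : ∀ y, dist y x ≤ ε → (w y : EReal) ≤ localEssSup Ω ε w x →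
      ((max (w y) 0 : ℝ) : EReal) ≤ max (localEssSup Ω ε w x) 0 := fun y _ h => by
    rcases le_total (w y) 0 with h' | h'
    · rw [max_eq_right h']; exact le_max_right _ _
    · rw [max_eq_left h']; exact h.trans (le_max_left _ _)
  by_cases hD : D x < -ε
  · right
    refine ⟨?_, ?_, ?_⟩
    · rw [localEssSup_le_iff, ae_restrict_iff' (Metric.isOpen_ball.inter hΩ).measurableSet]
      refine Eventually.of_forall fun y hy => ?_
      have hDy : D y < 0 := by
        have := hF.lip x hxΩ y hy.2
        have h' := Metric.mem_ball.1 hy.1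
        linarith
      rw [hg, excess_of_mem w hy.2 hDy]
      norm_cast
      rcases le_total (w y) 0 with h' | h' <;> simp [h']
    · rw [hg, excess_of_mem w hxΩ (by linarith)]
      exact hmax x hself (h2 x hself)
    · by_cases hxS : x ∈ S
      · obtain ⟨y, hy, hPy, hxy⟩ := h3 hxS
        rw [indicator_of_mem hxS]
        have hback := hF.back hb hs hy
        rw [← hxy, neg_smul, sub_neg_eq_add] at hback
        rw [hback, hg, excess_of_mem w hy.1 hy.2.2]
        have hdist : dist y x ≤ ε := by
          rw [hxy, dist_eq_norm, sub_add_cancel_left, norm_neg, norm_smul, norm_neg,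
            Real.norm_of_nonneg hε.le]
          have := hF.norm_le y hy.1 (abs_lt_of_mem_outerZone hb hy)
          nlinarith
        exact hmax y hdist (hPy x hdist)
      · rw [indicator_of_notMem hxS]
        exact le_max_right _ _
  · left
    push Not at hD
    refine ⟨hl_one _ (by linarith), indicator_of_notMem (fun hxS => ?_) _⟩
    obtain ⟨y, hy, hPy, hxy⟩ := h3 hxS
    have := hF.char_dist y hy.1 (abs_lt_of_mem_outerZone hb hy) (-ε) hs
    rw [← hxy] at this
    linarith [hy.2.2]

include hl_zero

open Classical in
-- Truncation lowers the local infimum only if `w` has a positive infimum `i` over a ball that may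
-- meet `{D < 0}`. Then `i` is bounded by the excess at `x` wherever `lam < 1`, and by the excess at
-- `x - ε • V x` wherever `lam > 0`.
theorem ae_upOsc_neg_competitor_le : ∀ᵐ x ∂(volume.restrict Ω),
    upOsc Ω ε (fun y => -(w y - excess Ω D w y)) x + ENNReal.ofReal (lam (D x) * excess Ω D w x) ≤
    upOsc Ω ε (fun y => -w y) x +
      ENNReal.ofReal (lam (D x) * (((fun y => y + ε • V y) '' outerZone Ω b D).indicator
        (fun x => excess Ω D w (x - ε • V x)) x)) := by
  have hb : 0 < b := hε.trans_le hεb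
  have hs : |ε| ≤ ε := by rw [abs_of_pos hε]
  have hs' : |(-ε)| ≤ ε := by rw [abs_neg, abs_of_pos hε]
  filter_upwards [ae_localEssInf_le hΩ hε (fun y => w y - excess Ω D w y),
    ae_localEssInf_le hΩ hε w, ae_restrict_mem hΩ.measurableSet,
    ae_restrict_of_ae (hF.ae_transport hΩ.measurableSet hb ε (ae_localEssInf_le hΩ hε w))]
    with x h1 h2 hxΩ h3
  have hself : dist x x ≤ ε := by simpa using hε.le
  set g := excess Ω D w with hg
  set S := (fun y => y + ε • V y) '' outerZone Ω b D with hS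
  have hh : 0 ≤ S.indicator (fun x => g (x - ε • V x)) x :=
    indicator_nonneg (fun _ _ => excess_nonneg w _) _
  have hwx : (((w x - g x) + g x : ℝ) : EReal) = (w x : EReal) := by rw [sub_add_cancel]
  have key := toENNReal_sub_add_le_of_inf (iu := localEssInf Ω ε (fun y => w y - g y) x)
    (iw := localEssInf Ω ε w x) (a := w x - g x) (g := g x)
    (h := S.indicator (fun x => g (x - ε • V x)) x) (l := lam (D x))
    (excess_nonneg w x) hh (hl0 _) (hl1 _) (h1 x hself) (hwx ▸ h2 x hself) ?_
  · rw [sub_add_cancel] at key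
    rw [upOsc_neg, upOsc_neg]
    exact key
  by_cases hD : ε ≤ D x
  · left
    refine localEssInf_mono ?_
    rw [ae_restrict_iff' (Metric.isOpen_ball.inter hΩ).measurableSet]
    refine Eventually.of_forall fun y hy => ?_
    have hDy : 0 ≤ D y := by
      have := hF.lip y hy.2 x hxΩ
      have h' := Metric.mem_ball.1 hy.1
      rw [dist_comm] at h'
      linarith
    rw [hg, excess_of_nonneg w hDy, sub_zero]
  push Not at hD
  by_cases hI : localEssInf Ω ε w x ≤ 0
  · left
    rw [le_localEssInf_iff]
    filter_upwards [le_localEssInf_iff.1 (le_refl (localEssInf Ω ε w x))] with y hy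
    refine le_trans (le_min hy hI) ?_
    rw [← EReal.coe_zero]
    have := min_le_sub_excess (Ω := Ω) (D := D) w y
    rcases min_choice (w y) 0 with h | h
    · rw [h] at this
      exact min_le_of_left_le (by exact_mod_cast this)
    · rw [h] at this
      exact min_le_of_right_le (by exact_mod_cast this)
  push Not at hI
  right
  constructor
  · rw [le_localEssInf_iff]
    filter_upwards [le_localEssInf_iff.1 (le_refl (localEssInf Ω ε w x))] with y hy
    have hwy : 0 < w y := by exact_mod_cast hI.trans_le hy
    have := min_le_sub_excess (Ω := Ω) (D := D) w y
    rw [min_eq_right hwy.le] at this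
    exact_mod_cast this
  have hIw := h2 x hself
  have htop : localEssInf Ω ε w x ≠ ⊤ := fun h => EReal.coe_ne_top _ (top_le_iff.1 (h ▸ hIw))
  have hbot : localEssInf Ω ε w x ≠ ⊥ := (bot_lt_of_lt hI).ne'
  lift localEssInf Ω ε w x to ℝ using ⟨htop, hbot⟩ with i hi
  have hi0 : 0 < i := by exact_mod_cast hI
  have hiw : i ≤ w x := by exact_mod_cast hIw
  rw [EReal.coe_le_coe_iff]
  have hA : (1 - lam (D x)) * i ≤ (1 - lam (D x)) * g x := by
    by_cases h : -(2 * b) ≤ D x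
    · rw [hl_one _ h]; simp
    · refine mul_le_mul_of_nonneg_left ?_ (by linarith [hl1 (D x)])
      rw [hg, excess_of_mem w hxΩ (by linarith)]
      exact hiw.trans (le_max_left _ _)
  have hB : lam (D x) * i ≤ lam (D x) * S.indicator (fun x => g (x - ε • V x)) x := by
    by_cases h : D x ≤ -(3 * b)
    · rw [hl_zero _ h]; simp
    · refine mul_le_mul_of_nonneg_left ?_ (hl0 _)
      push Not at h
      have hzone : |D x| < 4 * b := abs_lt.2 ⟨by linarith, by linarith⟩
      have e1 := hF.char_mem x hxΩ hzone (-ε) hs'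
      have e2 := hF.char_dist x hxΩ hzone (-ε) hs'
      have e3 := hF.char_grad x hxΩ hzone (-ε) hs'
      -- Here `-(3 * b) < D x < ε ≤ b`, so moving outwards by `ε` ends strictly between the levels
      -- `-(4 * b)` and `0`.
      have hxS : x ∈ S := by
        refine ⟨x + (-ε) • V x, ⟨e1, by rw [e2]; linarith, by rw [e2]; linarith⟩, ?_⟩
        simp only
        rw [e3, neg_smul, neg_add_cancel_right]
      obtain ⟨y, hy, hPy, hxy⟩ := h3 hxS
      rw [indicator_of_mem hxS]
      have hback := hF.back hb hs hy
      rw [← hxy] at hback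
      rw [hback, hg, excess_of_mem w hy.1 hy.2.2]
      have hdist : dist y x ≤ ε := by
        rw [hxy, dist_eq_norm, sub_add_cancel_left, norm_neg, norm_smul,
          Real.norm_of_nonneg hε.le]
        have := hF.norm_le y hy.1 (abs_lt_of_mem_outerZone hb hy)
        nlinarith
      have hyi := hPy x hdist
      rw [← hi] at hyi
      exact le_max_of_le_left (by exact_mod_cast hyi)
  linarith

end Comparison

end IsFront

end Barrier

/-! ### Comparison principle for minimizers -/

section Barrier

variable {N : ℕ} {Ω : Set (Pt N)} {ε b : ℝ} {D : Pt N → ℝ} {V : Pt N → Pt N}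
  {H : Pt N → Pt N →L[ℝ] Pt N} {ρ₀ ρ₁ f w : Pt N → ℝ} {lam : ℝ → ℝ}

theorem excess_mul_sub (w : Pt N → ℝ) (x : Pt N) :
    excess Ω D w x * (w x - excess Ω D w x) = 0 := by
  unfold excess
  split_ifs
  · rcases le_total (w x) 0 with h | h <;> simp [h]
  · simp

theorem excess_le_abs (w : Pt N → ℝ) (x : Pt N) : excess Ω D w x ≤ |w x| := by
  unfold excess
  split_ifs
  · exact max_le (le_abs_self _) (abs_nonneg _)
  · exact abs_nonneg _

/-- Expand the square and use `g * (w - g) = 0` for the excess `g`. Splitting `f` into positive and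
negative parts keeps every term nonnegative, so the identity makes sense in `ℝ≥0∞`. -/
theorem sq_competitor_add (f w : Pt N → ℝ) (x : Pt N) :
    ENNReal.ofReal (|(w x - excess Ω D w x) - f x| ^ 2) + ENNReal.ofReal (excess Ω D w x ^ 2) +
      2 * ENNReal.ofReal (excess Ω D w x * max (-f x) 0) =
    ENNReal.ofReal (|w x - f x| ^ 2) + 2 * ENNReal.ofReal (excess Ω D w x * max (f x) 0) := by
  have h0 := excess_mul_sub (Ω := Ω) (D := D) w x
  have hg := excess_nonneg (Ω := Ω) (D := D) w x
  set g := excess Ω D w x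
  have hm : max (f x) 0 - max (-f x) 0 = f x := by
    rcases le_total (f x) 0 with h | h
    · rw [max_eq_right h, max_eq_left (by linarith)]; ring
    · rw [max_eq_left h, max_eq_right (by linarith)]; ring
  have h1 : 0 ≤ max (f x) 0 := le_max_right _ _
  have h2 : 0 ≤ max (-f x) 0 := le_max_right _ _
  rw [← ENNReal.ofReal_ofNat, ← ENNReal.ofReal_mul (by norm_num),
    ← ENNReal.ofReal_mul (by norm_num),
    ← ENNReal.ofReal_add (by positivity) (by positivity),
    ← ENNReal.ofReal_add (by positivity) (by positivity),
    ← ENNReal.ofReal_add (by positivity) (by positivity)]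
  congr 1
  simp only [sq_abs]
  nlinarith

/-- Each gain is written on the left and each loss on the right, so the inequality can be integrated
without integrability assumptions. -/
theorem energyDensity_competitor_le {x : Pt N} {l h h' : ℝ} (hε : 0 < ε)
    (hS : upOsc Ω ε (fun y => w y - excess Ω D w y) x + ENNReal.ofReal (l * h) ≤
      upOsc Ω ε w x + ENNReal.ofReal (l * excess Ω D w x))
    (hI : upOsc Ω ε (fun y => -(w y - excess Ω D w y)) x + ENNReal.ofReal (l * excess Ω D w x) ≤
      upOsc Ω ε (fun y => -w y) x + ENNReal.ofReal (l * h')) :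
    energyDensity Ω ρ₀ ρ₁ ε f (fun y => w y - excess Ω D w y) x +
      ENNReal.ofReal (1 / (2 * ε)) *
        (ENNReal.ofReal (excess Ω D w x ^ 2) * ENNReal.ofReal (ρ₀ x + ρ₁ x)) +
      ENNReal.ofReal (1 / ε) *
        (ENNReal.ofReal (excess Ω D w x * max (-f x) 0) * ENNReal.ofReal (ρ₀ x + ρ₁ x) +
          ENNReal.ofReal (l * h) * ENNReal.ofReal (ρ₀ x) +
          ENNReal.ofReal (l * excess Ω D w x) * ENNReal.ofReal (ρ₁ x)) ≤
    energyDensity Ω ρ₀ ρ₁ ε f w x +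
      ENNReal.ofReal (1 / ε) *
        (ENNReal.ofReal (excess Ω D w x * max (f x) 0) * ENNReal.ofReal (ρ₀ x + ρ₁ x) +
          ENNReal.ofReal (l * h') * ENNReal.ofReal (ρ₁ x) +
          ENNReal.ofReal (l * excess Ω D w x) * ENNReal.ofReal (ρ₀ x)) := by
  have hsq := sq_competitor_add (Ω := Ω) (D := D) f w x
  have hA : ENNReal.ofReal (1 / ε) = ENNReal.ofReal (1 / (2 * ε)) * 2 := by
    rw [← ENNReal.ofReal_ofNat, ← ENNReal.ofReal_mul (by positivity)]
    congr 1
    field_simp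
  unfold energyDensity
  rw [hA]
  set A := ENNReal.ofReal (1 / (2 * ε))
  set r := ENNReal.ofReal (ρ₀ x + ρ₁ x)
  set r₀ := ENNReal.ofReal (ρ₀ x)
  set r₁ := ENNReal.ofReal (ρ₁ x)
  set g := excess Ω D w x
  calc _ = A * ((ENNReal.ofReal (|(w x - g) - f x| ^ 2) + ENNReal.ofReal (g ^ 2) +
            2 * ENNReal.ofReal (g * max (-f x) 0)) * r) +
          A * 2 * ((upOsc Ω ε (fun y => w y - excess Ω D w y) x + ENNReal.ofReal (l * h)) * r₀ +
            (upOsc Ω ε (fun y => -(w y - excess Ω D w y)) x + ENNReal.ofReal (l * g)) * r₁) := by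
        ring
    _ ≤ A * ((ENNReal.ofReal (|w x - f x| ^ 2) + 2 * ENNReal.ofReal (g * max (f x) 0)) * r) +
          A * 2 * ((upOsc Ω ε w x + ENNReal.ofReal (l * g)) * r₀ +
            (upOsc Ω ε (fun y => -w y) x + ENNReal.ofReal (l * h')) * r₁) := by
        rw [hsq]; gcongr
    _ = _ := by ring

theorem lintegral_excess_ne_top [IsFiniteMeasure (volume.restrict Ω)]
    (hw : MemLp w 2 (volume.restrict Ω)) :
    ∫⁻ x in Ω, ENNReal.ofReal (excess Ω D w x) ≠ ∞ := by
  have h1 : Integrable w (volume.restrict Ω) := hw.integrable one_le_two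
  refine ne_top_of_le_ne_top h1.2.ne (lintegral_mono fun x => ?_)
  rw [Real.enorm_eq_ofReal_abs]
  exact ENNReal.ofReal_le_ofReal (excess_le_abs w x)

/-- The comparison principle: a minimizer is nonpositive outside a front which moves inwards
sufficiently slowly. -/
theorem IsMinimizer.nonpos_of_front {c M : ℝ} (hΩ : IsOpen Ω) (hΩb : Bornology.IsBounded Ω)
    (hF : IsFront Ω ε b D V H) (hε : 0 < ε) (hεb : ε ≤ b)
    (hlm : Measurable lam) (hl0 : ∀ s, 0 ≤ lam s) (hl1 : ∀ s, lam s ≤ 1)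
    (hl_one : ∀ s, -(2 * b) ≤ s → lam s = 1) (hl_zero : ∀ s, s ≤ -(3 * b) → lam s = 0)
    (hρ₀ : AEMeasurable ρ₀ (volume.restrict Ω)) (hρ₁ : AEMeasurable ρ₁ (volume.restrict Ω))
    (hρ₀n : ∀ x ∈ Ω, 0 ≤ ρ₀ x) (hρ₁n : ∀ x ∈ Ω, 0 ≤ ρ₁ x) (hc : 0 < c)
    (hρ : ∀ x ∈ Ω, c < ρ₀ x + ρ₁ x ∧ ρ₀ x + ρ₁ x < c⁻¹)
    (hf : Measurable f) (hM : ∀ x ∈ Ω, |f x| ≤ M)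
    (hdet : ∀ y ∈ outerZone Ω b D, |(ContinuousLinearMap.id ℝ (Pt N) + ε • H y).det| ≤ 2)
    (hnear : ∀ y ∈ outerZone Ω b D, 0 ≤ -f y * (ρ₀ y + ρ₁ y) +
      (lam (D y - ε) * (ρ₀ (y + (-ε) • V y) *
        |(ContinuousLinearMap.id ℝ (Pt N) + (-ε) • H y).det|) - lam (D y) * ρ₀ y) -
      (lam (D y + ε) * (ρ₁ (y + ε • V y) *
        |(ContinuousLinearMap.id ℝ (Pt N) + ε • H y).det|) - lam (D y) * ρ₁ y))
    (hfar : ∀ y ∈ Ω, D y ≤ -(4 * b) → f y ≤ 0)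
    (hw : IsMinimizer Ω ρ₀ ρ₁ ε f w) :
    ∀ᵐ x ∂(volume.restrict Ω), D x < 0 → w x ≤ 0 := by
  classical
  -- Neither minimality nor the conclusion depends on the representative.
  wlog hwm : Measurable w generalizing w
  · have h1 := hw.1.aemeasurable.ae_eq_mk
    filter_upwards [h1, this (hw.congr h1) hw.1.aemeasurable.measurable_mk] with x hx hx' hD
    rw [hx]
    exact hx' hD
  have hb : 0 < b := hε.trans_le hεb
  have hs : |ε| ≤ ε := by rw [abs_of_pos hε]
  have hs' : |(-ε)| ≤ ε := by rw [abs_neg, abs_of_pos hε]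
  have hΩm := hΩ.measurableSet
  have : IsFiniteMeasure (volume.restrict Ω) :=
    ⟨by rw [Measure.restrict_apply_univ]; exact hΩb.measure_lt_top⟩
  have hLm := hF.measurableSet_outerZone hΩm
  have hLΩ : outerZone Ω b D ⊆ Ω := fun y hy => hy.1
  set L := outerZone Ω b D with hL
  set g := excess Ω D w with hg
  have hgm : Measurable g := hF.measurable_excess w hΩm hwm
  have hg0 : ∀ x, 0 ≤ g x := excess_nonneg w
  have hgL2 : MemLp g 2 (volume.restrict Ω) := by
    refine hw.1.mono hgm.aestronglyMeasurable (Eventually.of_forall fun x => ?_)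
    rw [Real.norm_of_nonneg (hg0 x), Real.norm_eq_abs]
    exact excess_le_abs w x
  have hgI : ∫⁻ x in Ω, ENNReal.ofReal (g x) ≠ ∞ := lintegral_excess_ne_top hw.1
  set Jm : Pt N → ℝ := fun y => |(ContinuousLinearMap.id ℝ (Pt N) + (-ε) • H y).det|
  set Jp : Pt N → ℝ := fun y => |(ContinuousLinearMap.id ℝ (Pt N) + ε • H y).det|
  -- the integrands
  set r : Pt N → ℝ≥0∞ := fun x => ENNReal.ofReal (ρ₀ x + ρ₁ x)
  set r₀ : Pt N → ℝ≥0∞ := fun x => ENNReal.ofReal (ρ₀ x)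
  set r₁ : Pt N → ℝ≥0∞ := fun x => ENNReal.ofReal (ρ₁ x)
  have hrm : AEMeasurable r (volume.restrict Ω) := (hρ₀.add hρ₁).ennreal_ofReal
  have hr₀m : AEMeasurable r₀ (volume.restrict Ω) := hρ₀.ennreal_ofReal
  have hr₁m : AEMeasurable r₁ (volume.restrict Ω) := hρ₁.ennreal_ofReal
  set Sm := (fun y => y + (-ε) • V y) '' L with hSm
  set Sp := (fun y => y + ε • V y) '' L with hSp
  set k₁ : Pt N → ℝ≥0∞ := fun x => ENNReal.ofReal (g x * max (-f x) 0) * r x with hk₁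
  set k₂ : Pt N → ℝ≥0∞ := fun x =>
    ENNReal.ofReal (lam (D x) * Sm.indicator (fun x => g (x + ε • V x)) x) * r₀ x with hk₂
  set k₃ : Pt N → ℝ≥0∞ := fun x => ENNReal.ofReal (lam (D x) * g x) * r₁ x with hk₃
  set q₁ : Pt N → ℝ≥0∞ := fun x => ENNReal.ofReal (g x * max (f x) 0) * r x with hq₁
  set q₂ : Pt N → ℝ≥0∞ := fun x =>
    ENNReal.ofReal (lam (D x) * Sp.indicator (fun x => g (x - ε • V x)) x) * r₁ x with hq₂
  set q₃ : Pt N → ℝ≥0∞ := fun x => ENNReal.ofReal (lam (D x) * g x) * r₀ x with hq₃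
  have hlD : Measurable fun x => lam (D x) := hlm.comp hF.measurable
  have hk₁m : AEMeasurable k₁ (volume.restrict Ω) :=
    (hgm.mul (hf.neg.max measurable_const)).ennreal_ofReal.aemeasurable.mul hrm
  have hk₂m : AEMeasurable k₂ (volume.restrict Ω) :=
    ((hlD.mul ((hgm.comp (measurable_id.add (hF.measurable_grad.const_smul ε))).indicator
      (hF.measurableSet_image hΩm hb hs'))).ennreal_ofReal.aemeasurable).mul hr₀m
  have hk₃m : AEMeasurable k₃ (volume.restrict Ω) :=
    (hlD.mul hgm).ennreal_ofReal.aemeasurable.mul hr₁m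
  have hq₁m : AEMeasurable q₁ (volume.restrict Ω) :=
    (hgm.mul (hf.max measurable_const)).ennreal_ofReal.aemeasurable.mul hrm
  have hq₂m : AEMeasurable q₂ (volume.restrict Ω) :=
    ((hlD.mul ((hgm.comp (measurable_id.sub (hF.measurable_grad.const_smul ε))).indicator
      (hF.measurableSet_image hΩm hb hs))).ennreal_ofReal.aemeasurable).mul hr₁m
  have hq₃m : AEMeasurable q₃ (volume.restrict Ω) :=
    (hlD.mul hgm).ennreal_ofReal.aemeasurable.mul hr₀m
  have hcm : AEMeasurable (fun x => w x - g x) (volume.restrict Ω) := (hwm.sub hgm).aemeasurable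
  have hgr : AEMeasurable (fun x => ENNReal.ofReal (g x ^ 2) * r x) (volume.restrict Ω) :=
    (hgm.pow_const 2).ennreal_ofReal.aemeasurable.mul hrm
  -- the integrated comparison
  have hE : energy Ω ρ₀ ρ₁ ε f (fun x => w x - g x) +
      ENNReal.ofReal (1 / (2 * ε)) * (∫⁻ x in Ω, ENNReal.ofReal (g x ^ 2) * r x) +
      ENNReal.ofReal (1 / ε) * ((∫⁻ x in Ω, k₁ x) + (∫⁻ x in Ω, k₂ x) + ∫⁻ x in Ω, k₃ x) ≤
      energy Ω ρ₀ ρ₁ ε f w +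
      ENNReal.ofReal (1 / ε) * ((∫⁻ x in Ω, q₁ x) + (∫⁻ x in Ω, q₂ x) + ∫⁻ x in Ω, q₃ x) := by
    have hed := aemeasurable_energyDensity (ε := ε) hΩm hρ₀ hρ₁ hf.aemeasurable hcm
    have hk₁₂m : AEMeasurable (fun x => k₁ x + k₂ x) (volume.restrict Ω) := hk₁m.add hk₂m
    have hq₁₂m : AEMeasurable (fun x => q₁ x + q₂ x) (volume.restrict Ω) := hq₁m.add hq₂m
    have hedg : AEMeasurable (fun x => energyDensity Ω ρ₀ ρ₁ ε f (fun x => w x - g x) x +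
        ENNReal.ofReal (1 / (2 * ε)) * (ENNReal.ofReal (g x ^ 2) * r x)) (volume.restrict Ω) :=
      hed.add (hgr.const_mul _)
    rw [energy_eq_lintegral hΩm hρ₀ hρ₁ hf.aemeasurable hcm,
      energy_eq_lintegral hΩm hρ₀ hρ₁ hf.aemeasurable hwm.aemeasurable,
      ← lintegral_add_left' hk₁m, ← lintegral_add_left' hk₁₂m,
      ← lintegral_add_left' hq₁m, ← lintegral_add_left' hq₁₂m,
      ← lintegral_const_mul' _ _ ENNReal.ofReal_ne_top,
      ← lintegral_const_mul' _ _ ENNReal.ofReal_ne_top,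
      ← lintegral_const_mul' _ _ ENNReal.ofReal_ne_top,
      ← lintegral_add_left' hed, ← lintegral_add_left' hedg,
      ← lintegral_add_left' (aemeasurable_energyDensity hΩm hρ₀ hρ₁ hf.aemeasurable
        hwm.aemeasurable)]
    refine lintegral_mono_ae ?_
    filter_upwards [hF.ae_upOsc_competitor_le w hΩ hε hεb hl0 hl1 hl_one,
      hF.ae_upOsc_neg_competitor_le w hΩ hε hεb hl0 hl1 hl_one hl_zero]
      with x h1 h2
    exact energyDensity_competitor_le hε h1 h2
  -- change of variables
  set k₂' : Pt N → ℝ≥0∞ := L.indicator fun y =>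
    ENNReal.ofReal (Jm y) * (ENNReal.ofReal (lam (D y - ε) * g y) * r₀ (y + (-ε) • V y)) with hk₂'
  set q₂' : Pt N → ℝ≥0∞ := L.indicator fun y =>
    ENNReal.ofReal (Jp y) * (ENNReal.ofReal (lam (D y + ε) * g y) * r₁ (y + ε • V y)) with hq₂'
  have hk₂I : ∫⁻ x in Ω, k₂ x = ∫⁻ y in Ω, k₂' y := by
    have h1 : k₂ = Sm.indicator fun x => ENNReal.ofReal (lam (D x) * g (x + ε • V x)) * r₀ x := by
      funext x
      by_cases hx : x ∈ Sm <;> simp [hk₂, hx]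
    rw [h1, hSm, hF.setLIntegral_image hΩm hb hs', lintegral_indicator hLm,
      Measure.restrict_restrict hLm, inter_eq_left.2 hLΩ]
    refine setLIntegral_congr_fun hLm fun y hy => ?_
    have hz := abs_lt_of_mem_outerZone hb hy
    have e1 := hF.char_dist y hy.1 hz (-ε) hs'
    have e2 : (y + (-ε) • V y) + ε • V (y + (-ε) • V y) = y := by
      have := hF.back hb hs' hy
      rwa [neg_smul ε (V (y + (-ε) • V y)), sub_neg_eq_add] at this
    simp only [Jm]
    rw [e1, e2, sub_eq_add_neg]
  have hq₂I : ∫⁻ x in Ω, q₂ x = ∫⁻ y in Ω, q₂' y := by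
    have h1 : q₂ = Sp.indicator fun x => ENNReal.ofReal (lam (D x) * g (x - ε • V x)) * r₁ x := by
      funext x
      by_cases hx : x ∈ Sp <;> simp [hq₂, hx]
    rw [h1, hSp, hF.setLIntegral_image hΩm hb hs, lintegral_indicator hLm,
      Measure.restrict_restrict hLm, inter_eq_left.2 hLΩ]
    refine setLIntegral_congr_fun hLm fun y hy => ?_
    have hz := abs_lt_of_mem_outerZone hb hy
    have e1 := hF.char_dist y hy.1 hz ε hs
    have e2 := hF.back hb hs hy
    simp only [Jp]
    rw [e1, e2]
  rw [hk₂I, hq₂I] at hE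
  -- After the change of variables all integrands carry the factor `g y`, so the losses are absorbed
  -- pointwise: `hnear` does it in the outer zone, and beyond it `lam` vanishes and `f ≤ 0`.
  have hqk : (∫⁻ x in Ω, q₁ x) + (∫⁻ x in Ω, q₂' x) + (∫⁻ x in Ω, q₃ x) ≤
      (∫⁻ x in Ω, k₁ x) + (∫⁻ x in Ω, k₂' x) + ∫⁻ x in Ω, k₃ x := by
    -- On the smaller side superadditivity of the lower integral suffices, so the measurability of
    -- the Jacobian terms never matters.
    rw [← lintegral_add_left' hk₁m, ← lintegral_add_right' _ hk₃m]
    refine (add_le_add_left (le_lintegral_add _ _) _).trans ((le_lintegral_add _ _).trans ?_)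
    refine setLIntegral_mono' hΩm fun y hy => ?_
    have hf1 : max (f y) 0 - max (-f y) 0 = f y := by
      rcases le_total (f y) 0 with h | h
      · rw [max_eq_right h, max_eq_left (by linarith)]; ring
      · rw [max_eq_left h, max_eq_right (by linarith)]; ring
    have hf2 : 0 ≤ max (f y) 0 := le_max_right _ _
    have hf3 : 0 ≤ max (-f y) 0 := le_max_right _ _
    by_cases hD : 0 ≤ D y
    · have hgy : g y = 0 := excess_of_nonneg w hD
      have hyL : y ∉ L := fun h => absurd h.2.2 (not_lt.2 hD)
      simp [hq₁, hq₂', hq₃, hgy, hyL]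
    push Not at hD
    have p₀ := hρ₀n y hy
    have p₁ := hρ₁n y hy
    have pl := hl0 (D y)
    have pg := hg0 y
    by_cases hyL : y ∈ L
    · have hz := abs_lt_of_mem_outerZone hb hyL
      have p₂ := hρ₀n _ (hF.char_mem y hy hz (-ε) hs')
      have p₃ := hρ₁n _ (hF.char_mem y hy hz ε hs)
      have pm := hl0 (D y - ε)
      have pp := hl0 (D y + ε)
      have pJm : 0 ≤ Jm y := abs_nonneg _
      have pJp : 0 ≤ Jp y := abs_nonneg _
      have hn := hnear y hyL
      simp only [hq₁, hq₂', hq₃, hk₁, hk₂', hk₃, indicator_of_mem hyL, r, r₀, r₁]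
      rw [← ENNReal.ofReal_mul (by positivity), ← ENNReal.ofReal_mul (by positivity),
        ← ENNReal.ofReal_mul (by positivity), ← ENNReal.ofReal_mul (by positivity),
        ← ENNReal.ofReal_mul (by positivity), ← ENNReal.ofReal_mul (by positivity),
        ← ENNReal.ofReal_mul (by positivity), ← ENNReal.ofReal_mul (by positivity),
        ← ENNReal.ofReal_add (by positivity) (by positivity),
        ← ENNReal.ofReal_add (by positivity) (by positivity),
        ← ENNReal.ofReal_add (by positivity) (by positivity),
        ← ENNReal.ofReal_add (by positivity) (by positivity)]
      refine ENNReal.ofReal_le_ofReal ?_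
      have h2 := mul_nonneg pg hn
      have h3 : f y = max (f y) 0 - max (-f y) 0 := hf1.symm
      rw [h3] at h2
      simp only [Jm, Jp]
      linarith
    · have hD4 : D y ≤ -(4 * b) := by
        by_contra h
        exact hyL ⟨hy, not_le.1 h, hD⟩
      have e1 : lam (D y) = 0 := hl_zero _ (by linarith)
      have e2 : max (f y) 0 = 0 := max_eq_right (hfar y hy hD4)
      simp [hq₁, hq₂', hq₃, hyL, e1, e2]
  have hC : ∀ x ∈ Ω, ρ₀ x ≤ c⁻¹ ∧ ρ₁ x ≤ c⁻¹ := fun x hx => by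
    have := hρ x hx
    constructor <;> linarith [hρ₀n x hx, hρ₁n x hx]
  -- Finiteness permits cancelling this sum, together with the energy of `w`, in `ℝ≥0∞`.
  have hfin : (∫⁻ x in Ω, q₁ x) + (∫⁻ x in Ω, q₂' x) + (∫⁻ x in Ω, q₃ x) ≠ ∞ := by
    have key : ∀ (q : Pt N → ℝ≥0∞) (K : ℝ), (∀ x ∈ Ω, q x ≤ ENNReal.ofReal K *
        ENNReal.ofReal (g x)) → ∫⁻ x in Ω, q x ≠ ∞ := fun q K h => by
      refine ne_top_of_le_ne_top ?_ (setLIntegral_mono' hΩm h)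
      rw [lintegral_const_mul' _ _ ENNReal.ofReal_ne_top]
      exact ENNReal.mul_ne_top ENNReal.ofReal_ne_top hgI
    refine ENNReal.add_ne_top.2 ⟨ENNReal.add_ne_top.2 ⟨key q₁ (M * c⁻¹) fun x hx => ?_,
      key q₂' (2 * c⁻¹) fun x hx => ?_⟩, key q₃ c⁻¹ fun x hx => ?_⟩
    · have hMx := hM x hx
      have hM0 : 0 ≤ M := (abs_nonneg _).trans hMx
      have h1 : max (f x) 0 ≤ M := max_le ((le_abs_self _).trans hMx) hM0
      have h2 : 0 ≤ max (f x) 0 := le_max_right _ _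
      have h3 := (hρ x hx).2.le
      have h4 : 0 ≤ ρ₀ x + ρ₁ x := hc.le.trans (hρ x hx).1.le
      have pg := hg0 x
      simp only [hq₁, r]
      rw [← ENNReal.ofReal_mul (by positivity), ← ENNReal.ofReal_mul (by positivity)]
      refine ENNReal.ofReal_le_ofReal ?_
      calc g x * max (f x) 0 * (ρ₀ x + ρ₁ x) ≤ g x * M * c⁻¹ := by
            gcongr
        _ = M * c⁻¹ * g x := by ring
    · by_cases hxL : x ∈ L
      · have hz := abs_lt_of_mem_outerZone hb hxL
        have pg := hg0 x
        simp only [hq₂', indicator_of_mem hxL, r₁]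
        have h1 : lam (D x + ε) * g x ≤ 1 * g x := by gcongr; exact hl1 _
        have h2 := (hC _ (hF.char_mem x hx hz ε hs)).2
        have h3 : Jp x ≤ 2 := hdet x hxL
        calc _ ≤ ENNReal.ofReal 2 * (ENNReal.ofReal (1 * g x) * ENNReal.ofReal c⁻¹) := by
              gcongr
          _ = _ := by
              rw [one_mul, ENNReal.ofReal_mul (by norm_num)]; ring
      · simp [hq₂', hxL]
    · have pg := hg0 x
      have h1 : lam (D x) * g x ≤ 1 * g x := by gcongr; exact hl1 _
      have h2 := (hC x hx).1
      calc q₃ x ≤ ENNReal.ofReal (1 * g x) * ENNReal.ofReal c⁻¹ := by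
            simp only [hq₃, r₀]; gcongr
        _ = _ := by rw [one_mul, mul_comm]
  have hEw : energy Ω ρ₀ ρ₁ ε f w ≠ ∞ :=
    ne_top_of_le_ne_top (energy_zero_ne_top hΩ hΩb hε (fun x hx => (hρ x hx).2) hM)
      (hw.2 _ MemLp.zero)
  have hmin := hw.2 _ (hw.1.sub hgL2)
  have hBX : ENNReal.ofReal (1 / ε) * ((∫⁻ x in Ω, q₁ x) + (∫⁻ x in Ω, q₂' x) +
      ∫⁻ x in Ω, q₃ x) ≠ ∞ := ENNReal.mul_ne_top ENNReal.ofReal_ne_top hfin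
  have hzero : ENNReal.ofReal (1 / (2 * ε)) *
      (∫⁻ x in Ω, ENNReal.ofReal (g x ^ 2) * r x) = 0 := by
    set X := (∫⁻ x in Ω, q₁ x) + (∫⁻ x in Ω, q₂' x) + ∫⁻ x in Ω, q₃ x
    set Y := (∫⁻ x in Ω, k₁ x) + (∫⁻ x in Ω, k₂' x) + ∫⁻ x in Ω, k₃ x
    set Z := ENNReal.ofReal (1 / (2 * ε)) * (∫⁻ x in Ω, ENNReal.ofReal (g x ^ 2) * r x)
    have h1 : Z + (energy Ω ρ₀ ρ₁ ε f w + ENNReal.ofReal (1 / ε) * X) ≤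
        0 + (energy Ω ρ₀ ρ₁ ε f w + ENNReal.ofReal (1 / ε) * X) := by
      calc _ = energy Ω ρ₀ ρ₁ ε f w + Z + ENNReal.ofReal (1 / ε) * X := by ring
        _ ≤ energy Ω ρ₀ ρ₁ ε f (fun x => w x - g x) + Z + ENNReal.ofReal (1 / ε) * Y := by
          gcongr
          exact hmin
        _ ≤ _ := hE
        _ = _ := by ring
    have h2 := (ENNReal.add_le_add_iff_right (ENNReal.add_ne_top.2 ⟨hEw, hBX⟩)).1 h1
    exact le_antisymm h2 (by simp)
  have hA0 : ENNReal.ofReal (1 / (2 * ε)) ≠ 0 := (ENNReal.ofReal_pos.2 (by positivity)).ne'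
  have hI0 := (mul_eq_zero.1 hzero).resolve_left hA0
  rw [lintegral_eq_zero_iff' hgr] at hI0
  filter_upwards [hI0, ae_restrict_mem hΩm] with x hx hxΩ hD
  have hrx : r x ≠ 0 := (ENNReal.ofReal_pos.2 (hc.trans (hρ x hxΩ).1)).ne'
  have h1 : ENNReal.ofReal (g x ^ 2) = 0 := (mul_eq_zero.1 hx).resolve_right hrx
  have h2 : g x ^ 2 = 0 := le_antisymm (ENNReal.ofReal_eq_zero.1 h1) (sq_nonneg _)
  have h3 : g x = 0 := by simpa using h2
  rw [hg, excess_of_mem w hxΩ hD] at h3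
  exact max_eq_right_iff.1 h3

end Barrier

/-! ### Points of density one -/

section Density

variable {N : ℕ} {S : Set (Pt N)} {x : Pt N}

theorem mem_densityOne_of_ae_ball {r : ℝ} (hr : 0 < r)
    (h : ∀ᵐ y ∂(volume.restrict (Metric.ball x r)), y ∈ S) : x ∈ densityOne S := by
  refine tendsto_const_nhds.congr' ?_
  filter_upwards [Ioo_mem_nhdsGT hr] with s hs
  have h1 : volume (S ∩ Metric.ball x s) = volume (Metric.ball x s) := by
    refine measure_congr ?_
    have h2 := ae_restrict_iff' (μ := volume) (Metric.isOpen_ball (x := x) (ε := r)).measurableSet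
      |>.1 h
    filter_upwards [h2] with y hy
    refine propext ⟨fun h => h.2, fun h => ⟨hy (Metric.ball_subset_ball hs.2.le h), h⟩⟩
  rw [h1, ENNReal.div_self (Metric.measure_ball_pos volume x hs.1).ne' measure_ball_lt_top.ne]

theorem notMem_densityOne_of_ae_ball {r : ℝ} (hr : 0 < r)
    (h : ∀ᵐ y ∂(volume.restrict (Metric.ball x r)), y ∉ S) : x ∉ densityOne S := by
  intro hx
  have h0 : Tendsto (fun s : ℝ => volume (S ∩ Metric.ball x s) / volume (Metric.ball x s))
      (𝓝[>] 0) (𝓝 0) := by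
    refine tendsto_const_nhds.congr' ?_
    filter_upwards [Ioo_mem_nhdsGT hr] with s hs
    have h2 := ae_restrict_iff' (μ := volume) (Metric.isOpen_ball (x := x) (ε := r)).measurableSet
      |>.1 h
    have h1 : volume (S ∩ Metric.ball x s) = 0 := by
      rw [ae_iff] at h2
      refine measure_mono_null (fun y hy => ?_) h2
      simp only [mem_ofPred_eq, Classical.not_imp, not_not]
      exact ⟨Metric.ball_subset_ball hs.2.le hy.2, hy.1⟩
    rw [h1, ENNReal.zero_div]
  exact one_ne_zero (tendsto_nhds_unique hx h0)

theorem interior_subset_densityOne : interior S ⊆ densityOne S := by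
  intro x hx
  obtain ⟨r, hr, h⟩ := Metric.isOpen_iff.1 isOpen_interior x hx
  refine mem_densityOne_of_ae_ball hr ?_
  filter_upwards [ae_restrict_mem Metric.isOpen_ball.measurableSet] with y hy
  exact interior_subset (h hy)

theorem densityOne_subset_closure : densityOne S ⊆ closure S := by
  intro x hx
  by_contra h
  obtain ⟨r, hr, h'⟩ := Metric.isOpen_iff.1 isClosed_closure.isOpen_compl x h
  refine notMem_densityOne_of_ae_ball hr ?_ hx
  filter_upwards [ae_restrict_mem Metric.isOpen_ball.measurableSet] with y hy hyS
  exact h' hy (subset_closure hyS)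

end Density

/-! ### Distance functions and boundary crossings -/

section SignedDistance

variable {E : Type*} [NormedAddCommGroup E] [NormedSpace ℝ E]

/-- Otherwise the interior of `A` and the complement of its closure would disconnect the segment. -/
theorem exists_mem_frontier_segment {A : Set E} {x y : E} (hx : x ∈ A) (hy : y ∉ A) :
    ∃ z ∈ frontier A, dist x z + dist z y = dist x y := by
  have hpre : IsPreconnected (segment ℝ x y) := (convex_segment x y).isPreconnected
  by_contra! h
  have hfr : ∀ z ∈ segment ℝ x y, z ∉ frontier A := fun z hz hzA =>
    h z hzA (dist_add_dist_of_mem_segment hz)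
  have hsub : segment ℝ x y ⊆ interior A ∪ (closure A)ᶜ := fun z hz => by
    by_cases hzc : z ∈ closure A
    · left
      by_contra hzi
      exact hfr z hz ⟨hzc, hzi⟩
    · exact Or.inr hzc
  have hxi : x ∈ interior A := by
    rcases hsub (left_mem_segment ℝ x y) with h | h
    · exact h
    · exact absurd (subset_closure hx) h
  have hyi : y ∈ (closure A)ᶜ := by
    rcases hsub (right_mem_segment ℝ x y) with h | h
    · exact absurd (interior_subset h) hy
    · exact h
  obtain ⟨z, -, hz1, hz2⟩ := hpre _ _ isOpen_interior isClosed_closure.isOpen_compl hsub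
    ⟨x, left_mem_segment ℝ x y, hxi⟩ ⟨y, right_mem_segment ℝ x y, hyi⟩
  exact hz2 (subset_closure (interior_subset hz1))

/-- Walking towards a nearest point decreases the distance at unit rate. -/
theorem one_le_norm_fderiv_infDist [ProperSpace E] {S : Set E} (hS : S.Nonempty) {x : E}
    (hx : x ∉ closure S) {L : E →L[ℝ] ℝ} (hL : HasFDerivAt (fun y => Metric.infDist y S) L x) :
    1 ≤ ‖L‖ := by
  obtain ⟨z, hz, hzd⟩ := isClosed_closure.exists_infDist_eq_dist hS.closure x
  rw [Metric.infDist_closure] at hzd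
  have hne : x ≠ z := fun h => hx (h ▸ hz)
  have hr : 0 < dist x z := dist_pos.2 hne
  set r := dist x z with hrdef
  set v : E := r⁻¹ • (z - x) with hv
  have hvn : ‖v‖ = 1 := by
    rw [hv, norm_smul, norm_inv, Real.norm_of_nonneg hr.le, ← dist_eq_norm, dist_comm]
    exact inv_mul_cancel₀ hr.ne'
  have hline : HasDerivAt (fun s : ℝ => Metric.infDist (x + s • v) S) (L v) 0 := by
    have h1 : HasDerivAt (fun s : ℝ => x + s • v) v 0 := by
      simpa using ((hasDerivAt_id (0 : ℝ)).smul_const v).const_add x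
    have h2 : HasFDerivAt (fun y => Metric.infDist y S) L (x + (0 : ℝ) • v) := by simpa using hL
    exact h2.comp_hasDerivAt (0 : ℝ) h1
  have hle : ∀ s : ℝ, 0 ≤ s → s ≤ r → Metric.infDist (x + s • v) S ≤ r - s := by
    intro s hs0 hsr
    rw [← Metric.infDist_closure]
    refine (Metric.infDist_le_dist_of_mem hz).trans ?_
    have h1 : x + s • v - z = (1 - s * r⁻¹) • (x - z) := by rw [hv]; module
    have h2 : 0 ≤ 1 - s * r⁻¹ := by
      rw [sub_nonneg, ← div_eq_mul_inv, div_le_one hr]; exact hsr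
    rw [dist_eq_norm, h1, norm_smul, Real.norm_of_nonneg h2, ← dist_eq_norm, ← hrdef, sub_mul,
      mul_assoc, inv_mul_cancel₀ hr.ne']
    simp
  have hslope : L v ≤ -1 := by
    have h1 := hline.tendsto_slope.mono_left (nhdsWithin_mono 0 (fun s (hs : s ∈ Ioi (0 : ℝ)) =>
      (ne_of_gt hs : s ∈ ({0} : Set ℝ)ᶜ)))
    refine le_of_tendsto h1 ?_
    filter_upwards [Ioo_mem_nhdsGT hr] with s hs
    rw [slope_def_field, sub_zero, div_le_iff₀ hs.1, zero_smul, add_zero, hzd]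
    linarith [hle s hs.1.le hs.2.le]
  have h3 := L.le_opNorm v
  rw [hvn, mul_one, Real.norm_eq_abs] at h3
  linarith [neg_le_abs (L v)]

end SignedDistance

/-! ### Signed distance of a one-sided set -/

section RegularSet

variable {N : ℕ} {Ω A : Set (Pt N)} {x y : Pt N}

/-- A set compactly contained in `Ω` which lies on one side of its boundary. -/
structure IsOneSided (Ω A : Set (Pt N)) : Prop where
  closure_subset : closure A ⊆ Ω
  interior_closure_subset : interior (closure A) ⊆ A
  subset_closure_interior : A ⊆ closure (interior A)

namespace IsOneSided

variable (hA : IsOneSided Ω A) (hΩ : IsOpen Ω)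
include hA hΩ

theorem closure_diff_closure : closure (Ω \ closure A) = closure (Ω \ A) := by
  refine Subset.antisymm (closure_mono (sdiff_subset_sdiff_right subset_closure))
    (closure_minimal (fun y hy => ?_) isClosed_closure)
  have h1 : y ∈ closure (closure A)ᶜ := by
    rw [closure_compl]
    exact fun h => hy.2 (hA.interior_closure_subset h)
  exact hΩ.inter_closure ⟨hy.1, h1⟩

theorem frontier_subset_closure_diff : frontier A ⊆ closure (Ω \ A) := by
  intro z hz
  have h1 : z ∈ closure Aᶜ := by
    rw [closure_compl]
    exact hz.2
  exact hΩ.inter_closure ⟨hA.closure_subset hz.1, h1⟩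

/-- Distances see only closures, and density-one points lie between the interior and the closure.
For a one-sided set these have the same closure, for `A` and for `Ω \ A` alike, so the density-one
normalization disappears. -/
theorem sdistCompl_eq (x : Pt N) :
    sdistCompl Ω A x = Metric.infDist x (Ω \ A) - Metric.infDist x A := by
  have hopen : IsOpen (Ω \ closure A) := hΩ.sdiff isClosed_closure
  have h1 : Ω \ closure A ⊆ densityOne (Ω \ A) :=
    (interior_maximal (sdiff_subset_sdiff_right subset_closure) hopen).trans
      interior_subset_densityOne
  have h2 : closure (densityOne (Ω \ A)) = closure (Ω \ A) := by
    refine Subset.antisymm (closure_minimal densityOne_subset_closure isClosed_closure) ?_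
    rw [← hA.closure_diff_closure hΩ]
    exact closure_mono h1
  have h3 : closure (Ω \ densityOne (Ω \ A)) = closure A := by
    refine Subset.antisymm (closure_minimal (fun y hy => ?_) isClosed_closure) ?_
    · by_contra h
      exact hy.2 (h1 ⟨hy.1, h⟩)
    · refine (closure_minimal hA.subset_closure_interior isClosed_closure).trans (closure_mono ?_)
      intro y hy
      refine ⟨hA.closure_subset (subset_closure (interior_subset hy)), fun h => ?_⟩
      have h4 := densityOne_subset_closure h
      have h5 : y ∈ closure Aᶜ := closure_mono (fun z hz => hz.2) h4
      rw [closure_compl] at h5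
      exact h5 hy
  unfold sdistCompl sdist
  rw [← Metric.infDist_closure, h2, Metric.infDist_closure,
    ← Metric.infDist_closure (s := Ω \ densityOne (Ω \ A)), h3, Metric.infDist_closure]

theorem sdistCompl_of_mem (hx : x ∈ A) : sdistCompl Ω A x = Metric.infDist x (Ω \ A) := by
  rw [hA.sdistCompl_eq hΩ, Metric.infDist_zero_of_mem hx, sub_zero]

theorem sdistCompl_of_notMem (hx : x ∈ Ω) (hxA : x ∉ A) :
    sdistCompl Ω A x = -Metric.infDist x A := by
  rw [hA.sdistCompl_eq hΩ, Metric.infDist_zero_of_mem (s := Ω \ A) ⟨hx, hxA⟩, zero_sub]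

theorem sdistCompl_nonneg (hx : x ∈ A) : 0 ≤ sdistCompl Ω A x := by
  rw [hA.sdistCompl_of_mem hΩ hx]
  exact Metric.infDist_nonneg

theorem sdistCompl_nonpos (hx : x ∈ Ω) (hxA : x ∉ A) : sdistCompl Ω A x ≤ 0 := by
  rw [hA.sdistCompl_of_notMem hΩ hx hxA, neg_nonpos]
  exact Metric.infDist_nonneg

/-- The point `x` may lie outside `Ω`: the segment crosses `frontier A`, which is in the closure of
`Ω \ A`. -/
theorem infDist_diff_le (hx : x ∉ A) (hy : y ∈ A) : Metric.infDist y (Ω \ A) ≤ dist y x := by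
  obtain ⟨z, hz, hd⟩ := exists_mem_frontier_segment hy hx
  have h1 : Metric.infDist y (Ω \ A) ≤ dist y z := by
    rw [← Metric.infDist_closure]
    exact Metric.infDist_le_dist_of_mem (hA.frontier_subset_closure_diff hΩ hz)
  linarith [dist_nonneg (x := z) (y := x)]

theorem sdistCompl_le_add_dist (hx : x ∈ Ω) (hy : y ∈ Ω) :
    sdistCompl Ω A y ≤ sdistCompl Ω A x + dist y x := by
  by_cases hxA : x ∈ A <;> by_cases hyA : y ∈ A
  · rw [hA.sdistCompl_of_mem hΩ hxA, hA.sdistCompl_of_mem hΩ hyA]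
    exact Metric.infDist_le_infDist_add_dist
  · linarith [hA.sdistCompl_nonneg hΩ hxA, hA.sdistCompl_nonpos hΩ hy hyA,
      dist_nonneg (x := y) (y := x)]
  · obtain ⟨z, hz, hd⟩ := exists_mem_frontier_segment hyA hxA
    rw [hA.sdistCompl_of_notMem hΩ hx hxA, hA.sdistCompl_of_mem hΩ hyA]
    have h1 : Metric.infDist y (Ω \ A) ≤ dist y z := by
      rw [← Metric.infDist_closure]
      exact Metric.infDist_le_dist_of_mem (hA.frontier_subset_closure_diff hΩ hz)
    have h2 : Metric.infDist x A ≤ dist x z := by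
      rw [← Metric.infDist_closure]
      exact Metric.infDist_le_dist_of_mem hz.1
    rw [dist_comm x z] at h2
    linarith
  · rw [hA.sdistCompl_of_notMem hΩ hx hxA, hA.sdistCompl_of_notMem hΩ hy hyA]
    have := Metric.infDist_le_infDist_add_dist (x := x) (y := y) (s := A)
    rw [dist_comm] at this
    linarith

theorem abs_sdistCompl_sub_le (hx : x ∈ Ω) (hy : y ∈ Ω) :
    |sdistCompl Ω A y - sdistCompl Ω A x| ≤ dist y x := by
  rw [abs_le]
  have h1 := hA.sdistCompl_le_add_dist hΩ hx hy
  have h2 := hA.sdistCompl_le_add_dist hΩ hy hx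
  rw [dist_comm] at h2
  constructor <;> linarith

theorem sdistCompl_frontier (hx : x ∈ frontier A) : sdistCompl Ω A x = 0 := by
  have h1 : Metric.infDist x (Ω \ A) = 0 :=
    Metric.infDist_zero_of_mem_closure (hA.frontier_subset_closure_diff hΩ hx)
  have h2 : Metric.infDist x A = 0 := Metric.infDist_zero_of_mem_closure hx.1
  rw [hA.sdistCompl_eq hΩ, h1, h2, sub_zero]

omit hΩ in
-- If `Ω ⊆ A`, then `Ω = closure A` is open and closed, hence the whole space, which is unbounded in
-- positive dimension.
theorem diff_nonempty (hN : 0 < N) (hΩb : Bornology.IsBounded Ω) (hΩ : IsOpen Ω)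
    (hne : Ω.Nonempty) : (Ω \ A).Nonempty := by
  by_contra h
  rw [not_nonempty_iff_eq_empty, sdiff_eq_empty] at h
  have hcl : IsClosed Ω := by
    have : closure A = Ω := Subset.antisymm hA.closure_subset (h.trans subset_closure)
    rw [← this]
    exact isClosed_closure
  have : Nonempty (Fin N) := ⟨⟨0, hN⟩⟩
  have huniv : Ω = univ := (isClopen_iff.1 ⟨hcl, hΩ⟩).resolve_left hne.ne_empty
  rw [huniv] at hΩb
  exact NormedSpace.unbounded_univ ℝ (Pt N) hΩb

theorem exists_mem_frontier_of_abs_lt (hne : A.Nonempty) (hne' : (Ω \ A).Nonempty) (hx : x ∈ Ω)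
    {s : ℝ} (hs : |sdistCompl Ω A x| < s) : ∃ z ∈ frontier A, dist x z < s := by
  by_cases hxA : x ∈ A
  · rw [hA.sdistCompl_of_mem hΩ hxA, abs_of_nonneg Metric.infDist_nonneg,
      Metric.infDist_lt_iff hne'] at hs
    obtain ⟨y, hy, hys⟩ := hs
    obtain ⟨z, hz, hd⟩ := exists_mem_frontier_segment hxA hy.2
    exact ⟨z, hz, by linarith [dist_nonneg (x := z) (y := y)]⟩
  · rw [hA.sdistCompl_of_notMem hΩ hx hxA, abs_neg, abs_of_nonneg Metric.infDist_nonneg,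
      Metric.infDist_lt_iff hne] at hs
    obtain ⟨y, hy, hys⟩ := hs
    obtain ⟨z, hz, hd⟩ := exists_mem_frontier_segment hy hxA
    rw [dist_comm] at hys
    refine ⟨z, hz, ?_⟩
    rw [dist_comm]
    linarith [dist_nonneg (x := y) (y := z)]

theorem norm_fderiv_le_one (hx : x ∈ Ω) : ‖fderiv ℝ (sdistCompl Ω A) x‖ ≤ 1 := by
  have h : LipschitzOnWith 1 (sdistCompl Ω A) Ω :=
    LipschitzOnWith.of_dist_le_mul fun y hy z hz => by
    rw [Real.dist_eq, NNReal.coe_one, one_mul]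
    exact hA.abs_sdistCompl_sub_le hΩ hz hy
  simpa using norm_fderiv_le_of_lipschitzOn ℝ (hΩ.mem_nhds hx) h

theorem norm_fderiv_eq_one_of_notMem_frontier (hne : A.Nonempty) (hne' : (Ω \ A).Nonempty)
    (hx : x ∈ Ω) (hxA : x ∉ frontier A) (hd : DifferentiableAt ℝ (sdistCompl Ω A) x) :
    ‖fderiv ℝ (sdistCompl Ω A) x‖ = 1 := by
  refine le_antisymm (hA.norm_fderiv_le_one hΩ hx) ?_
  by_cases hxi : x ∈ interior A
  · refine one_le_norm_fderiv_infDist hne' (fun h => ?_)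
      (hd.hasFDerivAt.congr_of_eventuallyEq ?_)
    · have h5 : x ∈ closure Aᶜ := closure_mono (fun z hz => hz.2) h
      rw [closure_compl] at h5
      exact h5 hxi
    · filter_upwards [isOpen_interior.mem_nhds hxi] with y hy
      exact (hA.sdistCompl_of_mem hΩ (interior_subset hy)).symm
  · have hxc : x ∉ closure A := fun h => hxA ⟨h, hxi⟩
    rw [← norm_neg]
    refine one_le_norm_fderiv_infDist hne hxc (hd.hasFDerivAt.neg.congr_of_eventuallyEq ?_)
    filter_upwards [(hΩ.sdiff isClosed_closure).mem_nhds ⟨hx, hxc⟩] with y hy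
    rw [Pi.neg_apply, hA.sdistCompl_of_notMem hΩ hy.1 (fun h => hy.2 (subset_closure h)), neg_neg]

/-- Away from the frontier this is the eikonal equation for a distance to a set. One-sidedness makes
each frontier point a limit of interior points, and continuity of the derivative does the rest. -/
theorem norm_fderiv_eq_one (hne : A.Nonempty) (hne' : (Ω \ A).Nonempty)
    (hx : x ∈ Ω) (hd : ContDiffAt ℝ 1 (sdistCompl Ω A) x) :
    ‖fderiv ℝ (sdistCompl Ω A) x‖ = 1 := by
  by_cases hxA : x ∈ frontier A
  · have hcl : x ∈ closure (interior A) := by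
      have := closure_mono hA.subset_closure_interior hxA.1
      rwa [closure_closure] at this
    have hcont : ContinuousAt (fderiv ℝ (sdistCompl Ω A)) x :=
      (hd.fderiv_right (m := 0) (by norm_num)).continuousAt
    have hdiff : ∀ᶠ y in 𝓝 x, DifferentiableAt ℝ (sdistCompl Ω A) y := by
      filter_upwards [hd.eventually (by simp)] with y hy
      exact hy.differentiableAt one_ne_zero
    have : NeBot (𝓝[interior A] x) := mem_closure_iff_nhdsWithin_neBot.1 hcl
    have h1 : Tendsto (fun y => ‖fderiv ℝ (sdistCompl Ω A) y‖) (𝓝[interior A] x)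
        (𝓝 ‖fderiv ℝ (sdistCompl Ω A) x‖) := (hcont.norm.tendsto).mono_left nhdsWithin_le_nhds
    refine tendsto_nhds_unique h1 (tendsto_const_nhds.congr' ?_)
    filter_upwards [self_mem_nhdsWithin, mem_nhdsWithin_of_mem_nhds hdiff] with y hy hy'
    exact (hA.norm_fderiv_eq_one_of_notMem_frontier hΩ hne hne'
      (hA.closure_subset (subset_closure (interior_subset hy))) (fun h => h.2 hy) hy').symm
  · exact hA.norm_fderiv_eq_one_of_notMem_frontier hΩ hne hne' hx hxA
      (hd.differentiableAt one_ne_zero)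

end IsOneSided

theorem continuous_sdistCompl : Continuous (sdistCompl Ω A) :=
  (Metric.continuous_infDist_pt _).sub (Metric.continuous_infDist_pt _)

end RegularSet

/-! ### First order expansion of the Jacobian -/

section Determinant

variable {N : ℕ}

/-- The trace of an endomorphism in the standard coordinates. -/
def coordTrace (T : Pt N →L[ℝ] Pt N) : ℝ := ∑ i : Fin N, T (EuclideanSpace.single i 1) i

/-- The matrix of an endomorphism in the standard coordinates. -/
def coordMatrix (T : Pt N →L[ℝ] Pt N) : Matrix (Fin N) (Fin N) ℝ :=
  Matrix.of fun i j => T (EuclideanSpace.single j 1) i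

theorem det_eq_det_coordMatrix (T : Pt N →L[ℝ] Pt N) : T.det = (coordMatrix T).det := by
  rw [ContinuousLinearMap.det,
    ← LinearMap.det_toMatrix (EuclideanSpace.basisFun (Fin N) ℝ).toBasis]
  congr 1

theorem coordTrace_smul (s : ℝ) (T : Pt N →L[ℝ] Pt N) : coordTrace (s • T) = s * coordTrace T := by
  simp [coordTrace, Finset.mul_sum]

theorem abs_coordTrace_le (T : Pt N →L[ℝ] Pt N) : |coordTrace T| ≤ N * ‖T‖ := by
  calc |coordTrace T| ≤ ∑ i : Fin N, |T (EuclideanSpace.single i 1) i| :=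
        Finset.abs_sum_le_sum_abs _ _
    _ ≤ ∑ _i : Fin N, ‖T‖ := by
        refine Finset.sum_le_sum fun i _ => ?_
        have h1 : ‖(T (EuclideanSpace.single i 1)) i‖ ≤ ‖T (EuclideanSpace.single i 1)‖ :=
          PiLp.norm_apply_le _ _
        have h2 := T.le_opNorm (EuclideanSpace.single i (1 : ℝ))
        rw [PiLp.norm_single, norm_one, mul_one] at h2
        exact h1.trans h2
    _ = N * ‖T‖ := by simp

theorem differentiable_det_id_add :
    Differentiable ℝ fun T : Pt N →L[ℝ] Pt N => (ContinuousLinearMap.id ℝ (Pt N) + T).det := by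
  have h : (fun T : Pt N →L[ℝ] Pt N => (ContinuousLinearMap.id ℝ (Pt N) + T).det) = fun T =>
      ∑ σ : Equiv.Perm (Fin N), ((Equiv.Perm.sign σ : ℤ) : ℝ) *
        ∏ i, ((ContinuousLinearMap.id ℝ (Pt N) + T) (EuclideanSpace.single i 1)) (σ i) := by
    funext T
    rw [det_eq_det_coordMatrix, Matrix.det_apply']
    rfl
  rw [h]
  have h1 : ∀ (i j : Fin N), Differentiable ℝ fun T : Pt N →L[ℝ] Pt N =>
      ((ContinuousLinearMap.id ℝ (Pt N) + T) (EuclideanSpace.single i 1)) j := fun i j => by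
    have h2 : Differentiable ℝ fun T : Pt N →L[ℝ] Pt N =>
        (ContinuousLinearMap.id ℝ (Pt N) + T) (EuclideanSpace.single i 1) :=
      ((differentiable_const _).add differentiable_id).clm_apply (differentiable_const _)
    exact (EuclideanSpace.proj j : Pt N →L[ℝ] ℝ).differentiable.comp h2
  fun_prop

theorem hasDerivAt_det_id_add_smul (T : Pt N →L[ℝ] Pt N) :
    HasDerivAt (fun s : ℝ => (ContinuousLinearMap.id ℝ (Pt N) + s • T).det) (coordTrace T) 0 := by
  have h : (fun s : ℝ => (ContinuousLinearMap.id ℝ (Pt N) + s • T).det) = fun s =>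
      1 + Matrix.trace (coordMatrix T) * s + (Matrix.det (1 + (Polynomial.X : Polynomial ℝ) •
        (coordMatrix T).map Polynomial.C)).divX.divX.eval s * s ^ 2 := by
    funext s
    rw [← Matrix.det_one_add_smul, det_eq_det_coordMatrix]
    congr 1
    ext i j
    simp [coordMatrix, Matrix.one_apply]
  rw [h]
  set P := (Matrix.det (1 + (Polynomial.X : Polynomial ℝ) •
        (coordMatrix T).map Polynomial.C)).divX.divX
  have h1 := ((((hasDerivAt_id (0 : ℝ)).const_mul (Matrix.trace (coordMatrix T))).const_add 1).add
    ((P.hasDerivAt 0).mul (hasDerivAt_pow 2 (0 : ℝ))))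
  convert! h1 using 1
  simp [coordTrace, coordMatrix, Matrix.trace]

theorem hasFDerivAt_det_apply (T : Pt N →L[ℝ] Pt N) :
    fderiv ℝ (fun T : Pt N →L[ℝ] Pt N => (ContinuousLinearMap.id ℝ (Pt N) + T).det) 0 T =
      coordTrace T := by
  have h0 : HasFDerivAt (fun T : Pt N →L[ℝ] Pt N => (ContinuousLinearMap.id ℝ (Pt N) + T).det)
      (fderiv ℝ (fun T : Pt N →L[ℝ] Pt N => (ContinuousLinearMap.id ℝ (Pt N) + T).det) 0)
      ((0 : ℝ) • T) := by
    have h : (0 : ℝ) • T = 0 := zero_smul ℝ T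
    rw [h]
    exact (differentiable_det_id_add 0).hasFDerivAt
  have h1 := h0.comp_hasDerivAt (0 : ℝ) ((hasDerivAt_id (0 : ℝ)).smul_const T)
  have h2 := h1.unique (hasDerivAt_det_id_add_smul T)
  simpa using h2

/-- Fréchet differentiability of the determinant at the identity makes the remainder uniform over
bounded `T`. -/
theorem exists_det_expansion (C : ℝ) {η : ℝ} (hη : 0 < η) :
    ∃ s₀ > 0, ∀ T : Pt N →L[ℝ] Pt N, ‖T‖ ≤ C → ∀ s : ℝ, |s| ≤ s₀ →
      |(ContinuousLinearMap.id ℝ (Pt N) + s • T).det - 1 - s * coordTrace T| ≤ η * |s| := by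
  have h0 := (differentiable_det_id_add (N := N) 0).hasFDerivAt
  have hC : 0 < |C| + 1 := by positivity
  have h1 := (hasFDerivAt_iff_isLittleO_nhds_zero.1 h0).def (c := η / (|C| + 1)) (by positivity)
  obtain ⟨r, hr, h2⟩ := Metric.eventually_nhds_iff.1 h1
  refine ⟨r / (2 * (|C| + 1)), by positivity, fun T hT s hs => ?_⟩
  have hT' : ‖T‖ ≤ |C| + 1 := hT.trans ((le_abs_self C).trans (by linarith))
  have h3 : ‖s • T‖ ≤ |s| * (|C| + 1) := by
    rw [norm_smul, Real.norm_eq_abs]; gcongr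
  have h4 : ‖s • T‖ < r := by
    refine h3.trans_lt ?_
    calc |s| * (|C| + 1) ≤ r / (2 * (|C| + 1)) * (|C| + 1) := by gcongr
      _ = r / 2 := by field_simp
      _ < r := by linarith
  have h5 := h2 (y := s • T) (by rwa [dist_zero_right])
  rw [zero_add, hasFDerivAt_det_apply, coordTrace_smul, Real.norm_eq_abs] at h5
  have h6 : (ContinuousLinearMap.id ℝ (Pt N) + (0 : Pt N →L[ℝ] Pt N)).det = 1 := by
    rw [add_zero, ContinuousLinearMap.det, ContinuousLinearMap.coe_id, LinearMap.det_id]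
  rw [h6] at h5
  refine h5.trans ?_
  calc η / (|C| + 1) * ‖s • T‖ ≤ η / (|C| + 1) * (|s| * (|C| + 1)) := by gcongr
    _ = η * |s| := by field_simp

end Determinant

/-! ### Expansion of transported densities -/

section Expansion

variable {N : ℕ} {Ω K : Set (Pt N)} {g : Pt N → ℝ}

/-- Uniform continuity of the derivative on a compact thickening of `K` feeds the mean value
inequality on small balls. -/
theorem exists_taylor_expansion (hΩ : IsOpen Ω) (hg : ContDiffOn ℝ 1 g Ω) (hK : IsCompact K)
    (hKΩ : K ⊆ Ω) {η : ℝ} (hη : 0 < η) :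
    ∃ s₀ > 0, ∀ y ∈ K, ∀ v : Pt N, ‖v‖ ≤ 1 → ∀ s : ℝ, |s| ≤ s₀ →
      |g (y + s • v) - g y - s * fderiv ℝ g y v| ≤ η * |s| := by
  obtain ⟨r, hr, hrΩ⟩ := hK.exists_cthickening_subset_open hΩ hKΩ
  have hK' : IsCompact (Metric.cthickening r K) := hK.cthickening
  have hcont : ContinuousOn (fderiv ℝ g) (Metric.cthickening r K) :=
    (hg.continuousOn_fderiv_of_isOpen hΩ le_rfl).mono hrΩ
  obtain ⟨δ, hδ, huc⟩ := Metric.uniformContinuousOn_iff.1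
    (hK'.uniformContinuousOn_of_continuous hcont) η hη
  refine ⟨min r (δ / 2), by positivity, fun y hy v hv s hs => ?_⟩
  have hball : Metric.closedBall y (min r (δ / 2)) ⊆ Metric.cthickening r K := fun z hz =>
    Metric.mem_cthickening_of_dist_le z y r K hy
      ((Metric.mem_closedBall.1 hz).trans (min_le_left _ _))
  have hyK := hball (Metric.mem_closedBall_self (by positivity))
  have hmem : y + s • v ∈ Metric.closedBall y (min r (δ / 2)) := by
    rw [Metric.mem_closedBall, dist_eq_norm, add_sub_cancel_left, norm_smul, Real.norm_eq_abs]
    calc |s| * ‖v‖ ≤ |s| * 1 := by gcongr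
      _ ≤ _ := by rwa [mul_one]
  have h1 := (convex_closedBall y (min r (δ / 2))).norm_image_sub_le_of_norm_fderiv_le'
    (f := g) (φ := fderiv ℝ g y) (C := η) (𝕜 := ℝ) (fun z hz =>
      ((hg.differentiableOn one_ne_zero) z (hrΩ (hball hz))).differentiableAt
        (hΩ.mem_nhds (hrΩ (hball hz)))) (fun z hz => by
      rw [← dist_eq_norm]
      refine (huc z (hball hz) y hyK ?_).le
      have := (Metric.mem_closedBall.1 hz).trans (min_le_right _ _)
      linarith) (Metric.mem_closedBall_self (by positivity)) hmem
  rw [add_sub_cancel_left, map_smul, smul_eq_mul, Real.norm_eq_abs, norm_smul,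
    Real.norm_eq_abs] at h1
  refine h1.trans ?_
  calc η * (|s| * ‖v‖) ≤ η * (|s| * 1) := by gcongr
    _ = η * |s| := by rw [mul_one]

/-- First order expansion of a density transported along a displacement field. -/
theorem exists_density_expansion (hΩ : IsOpen Ω) (hg : ContDiffOn ℝ 1 g Ω) (hK : IsCompact K)
    (hKΩ : K ⊆ Ω) (C : ℝ) :
    ∃ G > 0, ∀ η > 0, ∃ s₀ > 0, ∀ y ∈ K, ∀ v : Pt N, ‖v‖ ≤ 1 → ∀ T : Pt N →L[ℝ] Pt N, ‖T‖ ≤ C →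
      ∀ s : ℝ, |s| ≤ s₀ →
      |g (y + s • v) * |(ContinuousLinearMap.id ℝ (Pt N) + s • T).det| - g y -
        s * (g y * coordTrace T + fderiv ℝ g y v)| ≤ η * |s| ∧
      |g y * coordTrace T + fderiv ℝ g y v| ≤ G ∧
      |(ContinuousLinearMap.id ℝ (Pt N) + s • T).det| ≤ 2 := by
  obtain ⟨G₀, hG₀⟩ := hK.exists_bound_of_continuousOn (hg.continuousOn.mono hKΩ)
  obtain ⟨G₁, hG₁⟩ := hK.exists_bound_of_continuousOn
    ((hg.continuousOn_fderiv_of_isOpen hΩ le_rfl).mono hKΩ)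
  set G : ℝ := |G₀| + |G₁| + N * |C| + 1 with hG
  have hG1 : 1 ≤ G := by
    have : 0 ≤ |G₀| + |G₁| + N * |C| := by positivity
    linarith
  refine ⟨G * G + G, by positivity, fun η hη => ?_⟩
  set η' := min 1 (η / (8 * G)) with hη'
  have hη'0 : 0 < η' := by positivity
  obtain ⟨s₁, hs₁, h₁⟩ := exists_taylor_expansion hΩ hg hK hKΩ hη'0
  obtain ⟨s₂, hs₂, h₂⟩ := exists_det_expansion (N := N) C hη'0
  -- The bound `1 / (4 * G)` keeps the determinant within `1 / 2` of `1`, so its absolute value can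
  -- be dropped; `η / (8 * G * G)` makes the second order cross term at most `η / 4 * |s|`.
  refine ⟨min (min s₁ s₂) (min (1 / (4 * G)) (η / (8 * G * G))), by positivity,
    fun y hy v hv T hT s hs => ?_⟩
  have e1 := h₁ y hy v hv s (hs.trans ((min_le_left _ _).trans (min_le_left _ _)))
  have e2 := h₂ T hT s (hs.trans ((min_le_left _ _).trans (min_le_right _ _)))
  have e3 : |s| ≤ 1 / (4 * G) := hs.trans ((min_le_right _ _).trans (min_le_left _ _))
  have e4 : |s| ≤ η / (8 * G * G) := hs.trans ((min_le_right _ _).trans (min_le_right _ _))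
  have hs0 := abs_nonneg s
  have b0 : |g y| ≤ G := by
    have h := (hG₀ y hy).trans (le_abs_self G₀)
    rw [Real.norm_eq_abs] at h
    have : 0 ≤ |G₁| + N * |C| := by positivity
    linarith
  have b1 : |fderiv ℝ g y v| ≤ G := by
    have h := (fderiv ℝ g y).le_opNorm v
    rw [Real.norm_eq_abs] at h
    have h' := (hG₁ y hy).trans (le_abs_self G₁)
    have h'' : ‖fderiv ℝ g y‖ * ‖v‖ ≤ |G₁| * 1 := by gcongr
    have : 0 ≤ |G₀| + N * |C| := by positivity
    linarith
  have b2 : |coordTrace T| ≤ G := by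
    have h := abs_coordTrace_le T
    have h' : (N : ℝ) * ‖T‖ ≤ N * |C| := by
      have := hT.trans (le_abs_self C)
      gcongr
    have : 0 ≤ |G₀| + |G₁| := by positivity
    linarith
  set J := (ContinuousLinearMap.id ℝ (Pt N) + s • T).det with hJ
  set τ := coordTrace T with hτ
  set m := fderiv ℝ g y v with hm
  have hη1 : η' ≤ 1 := min_le_left _ _
  have hη2 : η' ≤ η / (8 * G) := min_le_right _ _
  have j1 : |J - 1| ≤ 1 / 2 := by
    have h1 : |J - 1| ≤ |J - 1 - s * τ| + |s * τ| := by
      have := abs_add_le (J - 1 - s * τ) (s * τ)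
      rwa [sub_add_cancel] at this
    have h2 : |s * τ| ≤ 1 / (4 * G) * G := by rw [abs_mul]; gcongr
    have h3 : 1 / (4 * G) * G = 1 / 4 := by field_simp
    have h4 : η' * |s| ≤ 1 * (1 / (4 * G)) := by gcongr
    have h5 : 1 / (4 * G) ≤ 1 / 4 := by gcongr; linarith
    linarith
  have j2 := abs_le.1 j1
  have jabs : |J| = J := abs_of_pos (by linarith)
  refine ⟨?_, ?_, ?_⟩
  · rw [jabs]
    have hid : g (y + s • v) * J - g y - s * (g y * τ + m) =
        (g (y + s • v) - g y - s * m) * J + g y * (J - 1 - s * τ) + s * m * (J - 1) := by ring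
    rw [hid]
    have j3 : |J| ≤ 2 := by rw [jabs]; linarith
    have j4 : |J - 1| ≤ 2 * G * |s| := by
      have h1 : |J - 1| ≤ |J - 1 - s * τ| + |s * τ| := by
        have := abs_add_le (J - 1 - s * τ) (s * τ)
        rwa [sub_add_cancel] at this
      have h2 : |s * τ| ≤ |s| * G := by rw [abs_mul]; gcongr
      have h3 : η' * |s| ≤ G * |s| := by
        have := hη1.trans hG1
        gcongr
      linarith
    have t1 : |(g (y + s • v) - g y - s * m) * J| ≤ (η' * |s|) * 2 := by
      rw [abs_mul]; gcongr
    have t2 : |g y * (J - 1 - s * τ)| ≤ G * (η' * |s|) := by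
      rw [abs_mul]; gcongr
    have t3 : |s * m * (J - 1)| ≤ |s| * G * (2 * G * |s|) := by
      rw [abs_mul, abs_mul]; gcongr
    have t4 : |s| * G * (2 * G * |s|) ≤ η / 4 * |s| := by
      have : |s| * G * (2 * G * |s|) = (2 * G * G * |s|) * |s| := by ring
      rw [this]
      have h2 : 2 * G * G * |s| ≤ 2 * G * G * (η / (8 * G * G)) := by gcongr
      have h3 : 2 * G * G * (η / (8 * G * G)) = η / 4 := by field_simp; ring
      gcongr
      linarith
    have t5 : G * (η' * |s|) ≤ η / 8 * |s| := by
      have h2 : G * η' ≤ G * (η / (8 * G)) := by gcongr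
      have h3 : G * (η / (8 * G)) = η / 8 := by field_simp
      calc G * (η' * |s|) = (G * η') * |s| := by ring
        _ ≤ _ := by gcongr; linarith
    have t6 : η' * |s| ≤ G * (η' * |s|) := le_mul_of_one_le_left (by positivity) hG1
    have := abs_add_three ((g (y + s • v) - g y - s * m) * J) (g y * (J - 1 - s * τ))
      (s * m * (J - 1))
    have hpos : 0 ≤ η * |s| := by positivity
    linarith
  · have h1 : |g y * τ| ≤ G * G := by rw [abs_mul]; gcongr
    have := abs_add_le (g y * τ) m
    linarith
  · rw [jabs]; linarith

end Expansion

/-! ### Gradients, Hessians and characteristics of the eikonal equation -/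

section Gradient

variable {N : ℕ} {f g ρ : Pt N → ℝ} {x : Pt N}

theorem inner_gradient_left (f : Pt N → ℝ) (x a : Pt N) :
    inner ℝ (gradient f x) a = fderiv ℝ f x a := by
  simp [gradient]

theorem norm_gradient (f : Pt N → ℝ) (x : Pt N) : ‖gradient f x‖ = ‖fderiv ℝ f x‖ := by
  simp [gradient]

theorem gradient_const_smul (σ : ℝ) (f : Pt N → ℝ) (x : Pt N) :
    gradient (fun y => σ * f y) x = σ • gradient f x := by
  have h : fderiv ℝ (fun y => σ * f y) x = σ • fderiv ℝ f x := by
    have := congrFun (fderiv_const_smul_field (𝕜 := ℝ) (f := f) σ) x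
    exact this
  simp [gradient, h]

theorem measurable_gradient (f : Pt N → ℝ) : Measurable (gradient f) := by
  exact (InnerProductSpace.toDual ℝ (Pt N)).symm.continuous.measurable.comp (measurable_fderiv ℝ f)

/-- The Riesz isomorphism as a real linear map. -/
def ofDual : (Pt N →L[ℝ] ℝ) →L[ℝ] Pt N where
  toFun L := (InnerProductSpace.toDual ℝ (Pt N)).symm L
  map_add' := by simp
  map_smul' := by simp
  cont := (InnerProductSpace.toDual ℝ (Pt N)).symm.continuous

theorem ofDual_apply (L : Pt N →L[ℝ] ℝ) :
    ofDual L = (InnerProductSpace.toDual ℝ (Pt N)).symm L := rfl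

theorem hasFDerivAt_gradient (hf : ContDiffAt ℝ 2 f x) :
    HasFDerivAt (gradient f) (ofDual ∘L fderiv ℝ (fderiv ℝ f) x) x := by
  have h1 : DifferentiableAt ℝ (fderiv ℝ f) x :=
    (hf.fderiv_right (m := 1) (by norm_num)).differentiableAt one_ne_zero
  exact ofDual.hasFDerivAt.comp x h1.hasFDerivAt

theorem inner_fderiv_gradient (hf : ContDiffAt ℝ 2 f x) (a b : Pt N) :
    inner ℝ (fderiv ℝ (gradient f) x a) b = fderiv ℝ (fderiv ℝ f) x a b := by
  rw [(hasFDerivAt_gradient hf).fderiv]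
  simp [ofDual_apply]

theorem norm_fderiv_gradient_le (hf : ContDiffAt ℝ 2 f x) :
    ‖fderiv ℝ (gradient f) x‖ ≤ ‖fderiv ℝ (fderiv ℝ f) x‖ := by
  refine ContinuousLinearMap.opNorm_le_bound _
    (norm_nonneg (fderiv ℝ (fderiv ℝ f) x)) fun a => ?_
  rw [(hasFDerivAt_gradient hf).fderiv]
  simpa [ofDual_apply] using (fderiv ℝ (fderiv ℝ f) x).le_opNorm a

/-- The product rule, arranged so that the bracket is the first order coefficient in
`exists_density_expansion`. -/
theorem weightedLaplacian_eq (hρ : DifferentiableAt ℝ ρ x) (hg : ContDiffAt ℝ 2 g x) :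
    weightedLaplacian ρ g x =
      1 / ρ x * (ρ x * coordTrace (fderiv ℝ (gradient g) x) + fderiv ℝ ρ x (gradient g x)) := by
  have hG := (hasFDerivAt_gradient hg).differentiableAt
  have h1 : divergence (fun y => ρ y • gradient g y) x =
      ρ x * coordTrace (fderiv ℝ (gradient g) x) + fderiv ℝ ρ x (gradient g x) := by
    unfold divergence coordTrace
    rw [fderiv_fun_smul hρ hG]
    have h2 : fderiv ℝ ρ x (gradient g x) =
        ∑ i : Fin N, gradient g x i * fderiv ℝ ρ x (EuclideanSpace.single i 1) := by
      conv_lhs => rw [← (EuclideanSpace.basisFun (Fin N) ℝ).sum_repr (gradient g x)]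
      simp
    rw [h2, Finset.mul_sum, ← Finset.sum_add_distrib]
    refine Finset.sum_congr rfl fun i _ => ?_
    simp [mul_comm]
  rw [weightedLaplacian, h1]

/-- The Hessian of a function with unit gradient annihilates the gradient. -/
theorem fderiv_gradient_apply_gradient (hf : ContDiffAt ℝ 2 f x)
    (h1 : ∀ᶠ y in 𝓝 x, ‖fderiv ℝ f y‖ = 1) :
    fderiv ℝ (gradient f) x (gradient f x) = 0 := by
  have hsymm : IsSymmSndFDerivAt ℝ f x := hf.isSymmSndFDerivAt (by simp)
  have hG := (hasFDerivAt_gradient hf).differentiableAt.hasFDerivAt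
  have hone : (fun y => inner ℝ (gradient f y) (gradient f y)) =ᶠ[𝓝 x] fun _ => (1 : ℝ) := by
    filter_upwards [h1] with y hy
    rw [real_inner_self_eq_norm_sq, norm_gradient, hy, one_pow]
  -- Differentiating `|∇f|² = 1` shows that every Hessian image is orthogonal to `∇f`; symmetry of
  -- the Hessian then gives the claim.
  have hz := (hG.inner ℝ hG).unique ((hasFDerivAt_const (1 : ℝ) x).congr_of_eventuallyEq hone)
  refine ext_inner_right ℝ fun a => ?_
  rw [inner_fderiv_gradient hf, hsymm, ← inner_fderiv_gradient hf, inner_zero_left]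
  have h2 := congrArg (fun L : Pt N →L[ℝ] ℝ => L a) hz
  have h3 : inner ℝ (gradient f x) (fderiv ℝ (gradient f) x a) +
      inner ℝ (fderiv ℝ (gradient f) x a) (gradient f x) = 0 := h2
  rw [real_inner_comm] at h3
  linarith

/-- Straight lines in the direction of the gradient are characteristics of the eikonal equation. -/
theorem gradient_eq_along_ray {W : Set (Pt N)} (hW : IsOpen W)
    (hf : ∀ y ∈ W, ContDiffAt ℝ 2 f y) (h1 : ∀ y ∈ W, ‖fderiv ℝ f y‖ = 1) {C a : ℝ}
    (hC : ∀ y ∈ W, ‖fderiv ℝ (fderiv ℝ f) y‖ ≤ C)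
    (hseg : ∀ s ∈ Icc 0 a, x + s • gradient f x ∈ W) :
    ∀ s ∈ Icc 0 a, gradient f (x + s • gradient f x) = gradient f x ∧
      f (x + s • gradient f x) = f x + s := by
  set v := gradient f x with hv
  have hline : ∀ s : ℝ, HasDerivAt (fun s : ℝ => x + s • v) v s := fun s => by
    simpa using ((hasDerivAt_id s).smul_const v).const_add x
  have hGd : ∀ s ∈ Icc 0 a, HasDerivAt (fun s : ℝ => gradient f (x + s • v) - v)
      (fderiv ℝ (gradient f) (x + s • v) v) s := fun s hs => by
    exact (((hasFDerivAt_gradient (hf _ (hseg s hs))).differentiableAt.hasFDerivAt.comp_hasDerivAt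
      s (hline s)).sub_const v)
  -- Grönwall for `φ(s) = ∇f(x + s v) - v`: the Hessian kills `∇f`, so `φ' = -Hess φ`, while `φ(0) =
  -- 0`.
  have hG : ∀ s ∈ Icc 0 a, gradient f (x + s • v) = v := by
    intro s hs
    refine sub_eq_zero.1 (eq_zero_of_abs_deriv_le_mul_abs_self_of_eq_zero_right
      (f := fun s : ℝ => gradient f (x + s • v) - v)
      (f' := fun s => fderiv ℝ (gradient f) (x + s • v) v) (K := C)
      (fun s hs => (hGd s hs).continuousAt.continuousWithinAt)
      (fun s hs => (hGd s (Ico_subset_Icc_self hs)).hasDerivWithinAt)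
      (by simp [hv]) (fun s hs => ?_) s hs)
    have hsW := hseg s (Ico_subset_Icc_self hs)
    have h2 := fderiv_gradient_apply_gradient (hf _ hsW)
      (by filter_upwards [hW.mem_nhds hsW] with y hy using h1 y hy)
    have h3 : fderiv ℝ (gradient f) (x + s • v) v =
        fderiv ℝ (gradient f) (x + s • v) (v - gradient f (x + s • v)) := by
      rw [map_sub, h2, sub_zero]
    rw [h3, norm_sub_rev (gradient f (x + s • v)) v]
    refine (ContinuousLinearMap.le_opNorm _ _).trans ?_
    gcongr
    exact (norm_fderiv_gradient_le (hf _ hsW)).trans (hC _ hsW)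
  refine fun s hs => ⟨hG s hs, ?_⟩
  have h0 : (0 : ℝ) ∈ Icc 0 a := ⟨le_rfl, hs.1.trans hs.2⟩
  have hvn : inner ℝ v v = (1 : ℝ) := by
    have := h1 _ (hseg 0 h0)
    rw [zero_smul, add_zero] at this
    rw [real_inner_self_eq_norm_sq, hv, norm_gradient, this, one_pow]
  have hfd : ∀ s ∈ Icc 0 a, HasDerivAt (fun s : ℝ => f (x + s • v) - s) 0 s := fun s hs => by
    have h2 := ((hf _ (hseg s hs)).differentiableAt two_ne_zero).hasFDerivAt.comp_hasDerivAt
      s (hline s)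
    rw [← inner_gradient_left, hG s hs, hvn] at h2
    rw [← sub_self (1 : ℝ)]
    exact h2.sub (hasDerivAt_id s)
  have h3 := constant_of_has_deriv_right_zero
    (fun s hs => (hfd s hs).continuousAt.continuousWithinAt)
    (fun s hs => (hfd s (Ico_subset_Icc_self hs)).hasDerivWithinAt) s hs
  simp only [zero_smul, add_zero, sub_zero] at h3
  linarith

end Gradient

/-! ### Uniform regularity near the space-time boundary -/

section Tube

theorem sdistCompl_empty {N : ℕ} {Ω : Set (Pt N)} (hΩ : IsOpen Ω) {x : Pt N} (hx : x ∈ Ω) :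
    sdistCompl Ω ∅ x = 0 := by
  have h : IsOneSided Ω (∅ : Set (Pt N)) := ⟨by simp, by simp, by simp⟩
  rw [h.sdistCompl_of_notMem hΩ hx (notMem_empty x), Metric.infDist_empty, neg_zero]

/-- A compact uniform neighbourhood of the space-time boundary in which the signed distance is
regular. -/
structure IsTube {N : ℕ} (Ω : Set (Pt N)) (t₀ t₁ : ℝ) (A : ℝ → Set (Pt N)) (K : Set (Pt N × ℝ))
    (r : ℝ) : Prop where
  pos : 0 < r
  isCompact : IsCompact K
  subset : K ⊆ Ω ×ˢ Icc t₀ t₁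
  mem : ∀ t ∈ Icc t₀ t₁, ∀ z ∈ frontier (A t), ∀ s ∈ Icc t₀ t₁, ∀ y, dist y z ≤ r → |s - t| ≤ r →
    (y, s) ∈ K
  isOneSided : ∀ t ∈ Icc t₀ t₁, IsOneSided Ω (A t)
  diff_nonempty : ∀ t ∈ Icc t₀ t₁, (A t).Nonempty → (Ω \ A t).Nonempty
  regularity : IsC21On t₀ t₁ (fun x t => sdistCompl Ω (A t) x) K

theorem IsC21On.mono {N : ℕ} {t₀ t₁ : ℝ} {d : Pt N → ℝ → ℝ} {B K : Set (Pt N × ℝ)}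
    (h : IsC21On t₀ t₁ d B) (hK : K ⊆ B) : IsC21On t₀ t₁ d K :=
  ⟨fun p hp => h.space p (hK hp), fun p hp => h.time p (hK hp), h.continuousOn.mono hK,
    h.continuousOn_fderiv.mono hK, h.continuousOn_fderiv_fderiv.mono hK,
    h.continuousOn_timeDeriv.mono hK⟩

variable {N : ℕ} {Ω : Set (Pt N)} {t₀ t₁ : ℝ} {A : ℝ → Set (Pt N)} {B K : Set (Pt N × ℝ)} {r : ℝ}

/-- The space-time boundary is closed and bounded, hence compact, so a closed thickening of it fits
into the regularity neighbourhood. -/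
theorem IsSmoothEvolution.exists_isTube (h : IsSmoothEvolution Ω t₀ t₁ A B) (hN : 0 < N)
    (hΩ : IsOpen Ω) (hΩb : Bornology.IsBounded Ω) : ∃ K r, K ⊆ B ∧ IsTube Ω t₀ t₁ A K r := by
  obtain ⟨U, hU, hBU⟩ := h.relatively_open
  have hone : ∀ t ∈ Icc t₀ t₁, IsOneSided Ω (A t) := fun t ht =>
    ⟨h.compactly_contained t ht, h.interior_closure_subset t ht, h.subset_closure_interior t ht⟩
  have hbdd : Bornology.IsBounded (Ω ×ˢ Icc t₀ t₁) := hΩb.prod (Metric.isBounded_Icc t₀ t₁)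
  have hBsub : B ⊆ Ω ×ˢ Icc t₀ t₁ := by rw [hBU]; exact inter_subset_right
  have hS : IsCompact (spaceTimeBoundary t₀ t₁ A) :=
    Metric.isCompact_of_isClosed_isBounded h.isClosed_boundary
      (hbdd.subset (h.boundary_subset.trans hBsub))
  have hopen : IsOpen (U ∩ (Ω ×ˢ univ)) := hU.inter (hΩ.prod isOpen_univ)
  have hSsub : spaceTimeBoundary t₀ t₁ A ⊆ U ∩ (Ω ×ˢ univ) := fun p hp => by
    have hpB := h.boundary_subset hp
    rw [hBU] at hpB
    exact ⟨hpB.1, hpB.2.1, mem_univ _⟩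
  obtain ⟨r, hr, hrsub⟩ := hS.exists_cthickening_subset_open hopen hSsub
  have hKB : Metric.cthickening r (spaceTimeBoundary t₀ t₁ A) ∩ (univ ×ˢ Icc t₀ t₁) ⊆ B := by
    rintro p ⟨hp, -, hpt⟩
    have := hrsub hp
    rw [hBU]
    exact ⟨this.1, this.2.1, hpt⟩
  refine ⟨Metric.cthickening r (spaceTimeBoundary t₀ t₁ A) ∩ (univ ×ˢ Icc t₀ t₁), r, hKB,
    hr, ?_, hKB.trans hBsub, ?_, hone, ?_, h.regularity.mono hKB⟩
  · exact Metric.isCompact_of_isClosed_isBounded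
      (Metric.isClosed_cthickening.inter (isClosed_univ.prod isClosed_Icc))
      (hbdd.subset (hKB.trans hBsub))
  · intro t ht z hz s hs y hyz hst
    refine ⟨Metric.mem_cthickening_of_dist_le (y, s) (z, t) r _ ⟨ht, hz⟩ ?_, mem_univ _, hs⟩
    rw [Prod.dist_eq]
    exact max_le hyz hst
  · intro t ht hne
    exact (hone t ht).diff_nonempty hN hΩb hΩ
      (hne.mono (subset_closure.trans (h.compactly_contained t ht)))

namespace IsTube

variable (hT : IsTube Ω t₀ t₁ A K r)
include hT

theorem frontier_nonempty {t : ℝ} (ht : t ∈ Icc t₀ t₁) (hne : (A t).Nonempty) :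
    (frontier (A t)).Nonempty := by
  obtain ⟨x, hx⟩ := hne
  obtain ⟨y, hy⟩ := hT.diff_nonempty t ht ⟨x, hx⟩
  obtain ⟨z, hz, -⟩ := exists_mem_frontier_segment hx hy.2
  exact ⟨z, hz⟩

theorem mem_of_abs_lt (hΩ : IsOpen Ω) {t s : ℝ} (ht : t ∈ Icc t₀ t₁) (hne : (A t).Nonempty)
    {x : Pt N} (hx : x ∈ Ω) (hxr : |sdistCompl Ω (A t) x| < r) (hs : s ∈ Icc t₀ t₁)
    (hst : |s - t| ≤ r) : (x, s) ∈ K := by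
  obtain ⟨z, hz, hd⟩ := (hT.isOneSided t ht).exists_mem_frontier_of_abs_lt hΩ hne
    (hT.diff_nonempty t ht hne) hx hxr
  exact hT.mem t ht z hz s hs x hd.le hst

/-- The spatial gradient at a boundary point has norm one while the set is nonempty, but vanishes
once it is empty. Uniform continuity of the gradient forbids this jump within a short time, in
either direction. -/
theorem exists_nonempty (hΩ : IsOpen Ω) :
    ∃ h > 0, ∀ t ∈ Icc t₀ t₁, ∀ s ∈ Icc t₀ t₁, |s - t| ≤ h → (A t).Nonempty → (A s).Nonempty := by
  obtain ⟨δ, hδ, huc⟩ := Metric.uniformContinuousOn_iff.1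
    (hT.isCompact.uniformContinuousOn_of_continuous hT.regularity.continuousOn_fderiv) 1 one_pos
  refine ⟨min r (δ / 2), lt_min hT.pos (by positivity), fun t ht s hs hst hne => ?_⟩
  obtain ⟨z, hz⟩ := hT.frontier_nonempty ht hne
  have hzt := hT.mem t ht z hz t ht z (by simpa using hT.pos.le) (by simpa using hT.pos.le)
  have hzs := hT.mem t ht z hz s hs z (by simpa using hT.pos.le) (hst.trans (min_le_left _ _))
  have hzΩ : z ∈ Ω := (hT.subset hzt).1
  have h1 := huc (z, t) hzt (z, s) hzs (by
    rw [Prod.dist_eq, dist_self, max_eq_right dist_nonneg, dist_comm, Real.dist_eq]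
    have := hst.trans (min_le_right _ _)
    linarith)
  by_contra hemp
  rw [not_nonempty_iff_eq_empty] at hemp
  have h2 : fderiv ℝ (fun y => sdistCompl Ω (A s) y) z = 0 := by
    have : (fun y => sdistCompl Ω (A s) y) =ᶠ[𝓝 z] fun _ => (0 : ℝ) := by
      filter_upwards [hΩ.mem_nhds hzΩ] with y hy
      rw [hemp, sdistCompl_empty hΩ hy]
    rw [this.fderiv_eq]
    simp
  have h3 := (hT.isOneSided t ht).norm_fderiv_eq_one hΩ hne (hT.diff_nonempty t ht hne) hzΩ
    ((hT.regularity.space _ hzt).of_le one_le_two)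
  simp only [h2] at h1
  rw [dist_zero_right] at h1
  exact absurd h3 h1.ne

theorem norm_time_sub_le {x : Pt N} {t t' τ η : ℝ} (htt : t ≤ t')
    (hK : ∀ s ∈ Icc t t', (x, s) ∈ K)
    (hη : ∀ s ∈ Icc t t', |timeDeriv t₀ t₁ (fun y s => sdistCompl Ω (A s) y) x s - τ| ≤ η) :
    |sdistCompl Ω (A t') x - sdistCompl Ω (A t) x - (t' - t) * τ| ≤ η * (t' - t) := by
  have hsub : Icc t t' ⊆ Icc t₀ t₁ := fun s hs => (hT.subset (hK s hs)).2
  have h1 := (convex_Icc t t').norm_image_sub_le_of_norm_hasDerivWithin_le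
    (f := fun s => sdistCompl Ω (A s) x - s * τ)
    (f' := fun s => timeDeriv t₀ t₁ (fun y s => sdistCompl Ω (A s) y) x s - τ) (C := η)
    (fun s hs => by
      have h2 := ((hT.regularity.time _ (hK s hs)).hasDerivWithinAt.mono hsub).sub
        ((hasDerivWithinAt_id s (Icc t t')).mul_const τ)
      rw [one_mul] at h2
      exact h2)
    hη (left_mem_Icc.2 htt) (right_mem_Icc.2 htt)
  rw [Real.norm_eq_abs, Real.norm_of_nonneg (sub_nonneg.2 htt)] at h1
  convert! h1 using 2
  ring

/-- Expanded at the later time `t'`, since that is the time at which the front is taken. -/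
theorem exists_time_expansion {η : ℝ} (hη : 0 < η) :
    ∃ h > 0, ∀ (x : Pt N) (t t' : ℝ), t ≤ t' → t' - t ≤ h → (∀ s ∈ Icc t t', (x, s) ∈ K) →
      |sdistCompl Ω (A t') x - sdistCompl Ω (A t) x -
        (t' - t) * timeDeriv t₀ t₁ (fun y s => sdistCompl Ω (A s) y) x t'| ≤ η * (t' - t) := by
  obtain ⟨δ, hδ, huc⟩ := Metric.uniformContinuousOn_iff.1
    (hT.isCompact.uniformContinuousOn_of_continuous hT.regularity.continuousOn_timeDeriv) η hη
  refine ⟨δ / 2, by positivity, fun x t t' htt hh hK => hT.norm_time_sub_le htt hK fun s hs => ?_⟩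
  refine (huc (x, s) (hK s hs) (x, t') (hK t' (right_mem_Icc.2 htt)) ?_).le
  rw [Prod.dist_eq, dist_self, max_eq_right dist_nonneg, Real.dist_eq, abs_sub_comm,
    abs_of_nonneg (by linarith [hs.2])]
  linarith [hs.1]

theorem exists_time_bound :
    ∃ C > 0, ∀ (x : Pt N) (t t' : ℝ), t ≤ t' → (∀ s ∈ Icc t t', (x, s) ∈ K) →
      |sdistCompl Ω (A t') x - sdistCompl Ω (A t) x| ≤ C * (t' - t) := by
  obtain ⟨C, hC⟩ := hT.isCompact.exists_bound_of_continuousOn hT.regularity.continuousOn_timeDeriv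
  refine ⟨|C| + 1, by positivity, fun x t t' htt hK => ?_⟩
  have := hT.norm_time_sub_le (τ := 0) (η := |C| + 1) htt hK fun s hs => by
    rw [sub_zero]
    exact (hC _ (hK s hs)).trans ((le_abs_self C).trans (by linarith))
  simpa using this

end IsTube

end Tube

/-! ### Level sets of the signed distance as fronts -/

section Characteristics

variable {N : ℕ} {Ω : Set (Pt N)} {t₀ t₁ : ℝ} {A : ℝ → Set (Pt N)} {B K : Set (Pt N × ℝ)} {r : ℝ}

theorem fderiv_const_mul_field (σ : ℝ) (f : Pt N → ℝ) :
    fderiv ℝ (fun y => σ * f y) = fun y => σ • fderiv ℝ f y :=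
  fderiv_const_smul_field (𝕜 := ℝ) (f := f) σ

theorem norm_fderiv_fderiv_const_mul_le (σ : ℝ) (f : Pt N → ℝ) (x : Pt N) :
    ‖fderiv ℝ (fderiv ℝ fun y => σ * f y) x‖ ≤ |σ| * ‖fderiv ℝ (fderiv ℝ f) x‖ := by
  have h1 : fderiv ℝ (fderiv ℝ fun y => σ * f y) x = σ • fderiv ℝ (fderiv ℝ f) x := by
    rw [fderiv_const_mul_field]
    exact congrFun (fderiv_const_smul_field (𝕜 := ℝ) (f := fderiv ℝ f) σ) x
  rw [h1]
  refine ContinuousLinearMap.opNorm_le_bound _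
    (mul_nonneg (abs_nonneg σ) (norm_nonneg (fderiv ℝ (fderiv ℝ f) x))) fun a => ?_
  rw [smul_apply, norm_smul, Real.norm_eq_abs, mul_assoc]
  gcongr
  exact (fderiv ℝ (fderiv ℝ f) x).le_opNorm a

theorem weightedLaplacian_const_mul (ρ : Pt N → ℝ) (σ : ℝ) (g : Pt N → ℝ) (x : Pt N) :
    weightedLaplacian ρ (fun y => σ * g y) x = σ * weightedLaplacian ρ g x := by
  have h : (fun y => ρ y • gradient (fun y => σ * g y) y) =
      σ • fun y => ρ y • gradient g y := by
    funext y
    rw [gradient_const_smul, smul_comm]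
    rfl
  unfold weightedLaplacian divergence
  rw [h, fderiv_const_smul_field]
  simp only [Pi.smul_apply, smul_apply, PiLp.smul_apply, smul_eq_mul]
  rw [← Finset.mul_sum]
  ring

namespace IsTube

variable (hT : IsTube Ω t₀ t₁ A K r)
include hT

theorem exists_hessian_bound : ∃ C > 0, ∀ t x, (x, t) ∈ K →
    ‖fderiv ℝ (fderiv ℝ (sdistCompl Ω (A t))) x‖ ≤ C := by
  obtain ⟨C, hC⟩ := hT.isCompact.exists_bound_of_continuousOn
    (E := Pt N →L[ℝ] Pt N →L[ℝ] ℝ) hT.regularity.continuousOn_fderiv_fderiv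
  exact ⟨|C| + 1, by positivity, fun t x hx =>
    (hC _ hx).trans ((le_abs_self C).trans (by linarith))⟩

theorem contDiffAt_signed (σ : ℝ) {t : ℝ} {x : Pt N} (hx : (x, t) ∈ K) :
    ContDiffAt ℝ 2 (fun y => σ * sdistCompl Ω (A t) y) x := by
  have h : ContDiffAt ℝ 2 (sdistCompl Ω (A t)) x := hT.regularity.space (x, t) hx
  exact (contDiffAt_const (c := σ)).mul h

theorem norm_gradient_signed (hΩ : IsOpen Ω) {σ : ℝ} (hσ : |σ| = 1) {t : ℝ}
    (hne : (A t).Nonempty) {x : Pt N} (hx : (x, t) ∈ K) :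
    ‖gradient (fun y => σ * sdistCompl Ω (A t) y) x‖ = 1 := by
  have ht := (hT.subset hx).2
  rw [gradient_const_smul, norm_smul, Real.norm_eq_abs, hσ, one_mul, norm_gradient]
  exact (hT.isOneSided t ht).norm_fderiv_eq_one hΩ hne (hT.diff_nonempty t ht hne)
    (hT.subset hx).1 ((hT.regularity.space (x, t) hx).of_le one_le_two)

/-- Some boundary point is closer than `5 * b` to `y`, so a displacement of at most `b` stays within
`6 * b < r` of it, inside the tube. -/
theorem mem_and_abs_lt_of_norm_le (hΩ : IsOpen Ω) {t b : ℝ} (ht : t ∈ Icc t₀ t₁)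
    (hne : (A t).Nonempty) (hb : 0 < b) (hbr : 7 * b ≤ r) {y : Pt N} (hy : y ∈ Ω)
    (hyb : |sdistCompl Ω (A t) y| < 5 * b) {v : Pt N} (hv : ‖v‖ ≤ b) :
    y + v ∈ Ω ∧ |sdistCompl Ω (A t) (y + v)| < r := by
  have hA := hT.isOneSided t ht
  obtain ⟨z, hz, hd⟩ := hA.exists_mem_frontier_of_abs_lt hΩ hne
    (hT.diff_nonempty t ht hne) hy hyb
  have hdist : dist (y + v) z ≤ 6 * b := by
    have h1 := dist_triangle (y + v) y z
    rw [dist_self_add_left] at h1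
    linarith
  have hzΩ : z ∈ Ω := hA.closure_subset hz.1
  have hmem := hT.mem t ht z hz t ht (y + v) (by linarith) (by simpa using hT.pos.le)
  have hΩ' := (hT.subset hmem).1
  refine ⟨hΩ', ?_⟩
  have h2 := hA.abs_sdistCompl_sub_le hΩ hzΩ hΩ'
  rw [hA.sdistCompl_frontier hΩ hz, sub_zero] at h2
  linarith

theorem characteristic (hΩ : IsOpen Ω) {σ : ℝ} (hσ : |σ| = 1) {t b : ℝ} (ht : t ∈ Icc t₀ t₁)
    (hne : (A t).Nonempty) (hb : 0 < b) (hbr : 7 * b ≤ r) {y : Pt N} (hy : y ∈ Ω)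
    (hyb : |sdistCompl Ω (A t) y| < 5 * b) {s : ℝ} (hs : |s| ≤ b) :
    gradient (fun y => σ * sdistCompl Ω (A t) y)
        (y + s • gradient (fun y => σ * sdistCompl Ω (A t) y) y) =
      gradient (fun y => σ * sdistCompl Ω (A t) y) y ∧
    σ * sdistCompl Ω (A t) (y + s • gradient (fun y => σ * sdistCompl Ω (A t) y) y) =
      σ * sdistCompl Ω (A t) y + s := by
  obtain ⟨C, hC0, hC⟩ := hT.exists_hessian_bound
  have hW : IsOpen (Ω ∩ {x | |sdistCompl Ω (A t) x| < r}) :=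
    hΩ.inter (isOpen_lt continuous_sdistCompl.abs continuous_const)
  have hWK : ∀ x ∈ Ω ∩ {x | |sdistCompl Ω (A t) x| < r}, (x, t) ∈ K := fun x hx =>
    hT.mem_of_abs_lt hΩ ht hne hx.1 hx.2 ht (by simpa using hT.pos.le)
  have hyK : (y, t) ∈ K := hWK y ⟨hy, hyb.trans_le (by linarith)⟩
  -- the statement along one half of the characteristic
  have key : ∀ τ : ℝ, |τ| = 1 → ∀ s ∈ Icc 0 b,
      gradient (fun y => τ * sdistCompl Ω (A t) y)
        (y + s • gradient (fun y => τ * sdistCompl Ω (A t) y) y) =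
        gradient (fun y => τ * sdistCompl Ω (A t) y) y ∧
      τ * sdistCompl Ω (A t) (y + s • gradient (fun y => τ * sdistCompl Ω (A t) y) y) =
        τ * sdistCompl Ω (A t) y + s := by
    intro τ hτ
    refine gradient_eq_along_ray (C := C) hW
      (fun x hx => hT.contDiffAt_signed τ (hWK x hx))
      (fun x hx => by rw [← norm_gradient]; exact hT.norm_gradient_signed hΩ hτ hne (hWK x hx))
      (fun x hx => ?_) (fun s hs => ?_)
    · refine (norm_fderiv_fderiv_const_mul_le _ _ _).trans ?_
      rw [hτ, one_mul]
      exact hC t x (hWK x hx)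
    · refine hT.mem_and_abs_lt_of_norm_le hΩ ht hne hb hbr hy hyb ?_
      rw [norm_smul, hT.norm_gradient_signed hΩ hτ hne hyK, mul_one, Real.norm_of_nonneg hs.1]
      exact hs.2
  rcases le_total 0 s with h | h
  · exact key σ hσ s ⟨h, (le_abs_self s).trans hs⟩
  -- Negative times along the characteristic are positive times for the opposite sign.
  · have hneg : ∀ x, gradient (fun y => -σ * sdistCompl Ω (A t) y) x =
        -gradient (fun y => σ * sdistCompl Ω (A t) y) x := fun x => by
      rw [gradient_const_smul, gradient_const_smul, neg_smul]
    have h1 := key (-σ) (by rwa [abs_neg]) (-s) ⟨by linarith, (neg_le_abs s).trans hs⟩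
    rw [hneg y, smul_neg, neg_smul, neg_neg, hneg, neg_inj] at h1
    exact ⟨h1.1, by linarith [h1.2]⟩

/-- Since `|k| ≤ b`, the zone of width `4 * b` around the shifted level lies where the signed
distance is below `5 * b`, so the characteristics apply. -/
theorem isFront (hΩ : IsOpen Ω) {σ : ℝ} (hσ : |σ| = 1) {t b ε k : ℝ} (ht : t ∈ Icc t₀ t₁)
    (hne : (A t).Nonempty) (hb : 0 < b) (hbr : 7 * b ≤ r) (hεb : ε ≤ b) (hk : |k| ≤ b) :
    IsFront Ω ε b (fun x => σ * sdistCompl Ω (A t) x - k)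
      (gradient fun x => σ * sdistCompl Ω (A t) x)
      (fderiv ℝ (gradient fun x => σ * sdistCompl Ω (A t) x)) := by
  have hA := hT.isOneSided t ht
  have hzone : ∀ y, |σ * sdistCompl Ω (A t) y - k| < 4 * b → |sdistCompl Ω (A t) y| < 5 * b := by
    intro y hy
    have h1 : |sdistCompl Ω (A t) y| = |σ * sdistCompl Ω (A t) y| := by rw [abs_mul, hσ, one_mul]
    rw [h1]
    have := abs_add_le (σ * sdistCompl Ω (A t) y - k) k
    rw [sub_add_cancel] at this
    linarith
  have hK : ∀ y ∈ Ω, |σ * sdistCompl Ω (A t) y - k| < 4 * b → (y, t) ∈ K := fun y hy hyb =>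
    hT.mem_of_abs_lt hΩ ht hne hy ((hzone y hyb).trans_le (by linarith)) ht
      (by simpa using hT.pos.le)
  refine ⟨?_, measurable_gradient _, ?_, ?_, ?_, ?_, ?_, ?_⟩
  · exact ((continuous_const.mul continuous_sdistCompl).sub continuous_const).measurable
  · intro x hx y hy
    have h1 := hA.abs_sdistCompl_sub_le hΩ hx hy
    have h2 : |σ * (sdistCompl Ω (A t) y - sdistCompl Ω (A t) x)| ≤ dist y x := by
      rwa [abs_mul, hσ, one_mul]
    have := (le_abs_self _).trans h2
    linarith
  · exact fun y hy hyb => (hasFDerivAt_gradient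
      (hT.contDiffAt_signed σ (hK y hy hyb))).differentiableAt.hasFDerivAt
  · exact fun y hy hyb => (hT.norm_gradient_signed hΩ hσ hne (hK y hy hyb)).le
  · intro y hy hyb s hs
    refine (hT.mem_and_abs_lt_of_norm_le hΩ ht hne hb hbr hy (hzone y hyb) ?_).1
    rw [norm_smul, hT.norm_gradient_signed hΩ hσ hne (hK y hy hyb), mul_one]
    exact hs.trans hεb
  · intro y hy hyb s hs
    have := (hT.characteristic hΩ hσ ht hne hb hbr hy (hzone y hyb) (hs.trans hεb)).2
    linarith
  · intro y hy hyb s hs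
    exact (hT.characteristic hΩ hσ ht hne hb hbr hy (hzone y hyb) (hs.trans hεb)).1

theorem norm_hessian_signed_le {C σ : ℝ} (hσ : |σ| = 1) {t : ℝ} {x : Pt N} (hx : (x, t) ∈ K)
    (hC : ‖fderiv ℝ (fderiv ℝ (sdistCompl Ω (A t))) x‖ ≤ C) :
    ‖fderiv ℝ (gradient fun y => σ * sdistCompl Ω (A t) y) x‖ ≤ C := by
  refine (norm_fderiv_gradient_le (hT.contDiffAt_signed σ hx)).trans ?_
  refine (norm_fderiv_fderiv_const_mul_le _ _ _).trans ?_
  rwa [hσ, one_mul]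

/-- Points far outside at one time are outside at a slightly earlier time. -/
theorem le_of_le (hΩ : IsOpen Ω) (hΩc : IsPreconnected Ω) {σ : ℝ} (hσ : |σ| = 1) {t t' b : ℝ}
    (ht : t ∈ Icc t₀ t₁) (hne : (A t).Nonempty) (hb : 0 < b) (hbr : b ≤ r)
    (hclose : ∀ x ∈ Ω, |sdistCompl Ω (A t) x| < r ∨ |sdistCompl Ω (A t') x| < r →
      |sdistCompl Ω (A t') x - sdistCompl Ω (A t) x| ≤ b / 8)
    {x : Pt N} (hx : x ∈ Ω) (hxq : σ * sdistCompl Ω (A t') x ≤ -(b / 2)) :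
    σ * sdistCompl Ω (A t) x ≤ -(b / 4) := by
  have habs : ∀ a : ℝ, |a| = |σ * a| := fun a => by rw [abs_mul, hσ, one_mul]
  have hclose' : ∀ x ∈ Ω, |σ * sdistCompl Ω (A t) x| < r ∨ |σ * sdistCompl Ω (A t') x| < r →
      |σ * sdistCompl Ω (A t') x - σ * sdistCompl Ω (A t) x| ≤ b / 8 := fun x hx h => by
    rw [← mul_sub, ← habs]
    rw [← habs, ← habs] at h
    exact hclose x hx h
  by_contra! hlt
  by_cases hcase : |σ * sdistCompl Ω (A t) x| < r ∨ |σ * sdistCompl Ω (A t') x| < r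
  · have := (abs_le.1 (hclose' x hx hcase)).1
    linarith
  · push Not at hcase
    have hP : r ≤ σ * sdistCompl Ω (A t) x := by
      rcases le_abs.1 hcase.1 with h | h
      · exact h
      · linarith
    have hQ : r ≤ -(σ * sdistCompl Ω (A t') x) := by
      rcases le_abs.1 hcase.2 with h | h
      · linarith
      · exact h
    obtain ⟨z, hz⟩ := hT.frontier_nonempty ht hne
    have hA := hT.isOneSided t ht
    have hzΩ : z ∈ Ω := hA.closure_subset hz.1
    -- The remaining danger is a point deep inside at time `t` and deep outside at `t'`.
    -- Connectedness of `Ω` then yields a point where this minimum is `r / 2`: it is in the regular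
    -- zone at one of the times, yet the two distances differ by at least `r`.
    have hm : ContinuousOn (fun x => min (σ * sdistCompl Ω (A t) x)
        (-(σ * sdistCompl Ω (A t') x))) Ω :=
      ((continuous_const.mul continuous_sdistCompl).min
        (continuous_const.mul continuous_sdistCompl).neg).continuousOn
    have hmz : min (σ * sdistCompl Ω (A t) z) (-(σ * sdistCompl Ω (A t') z)) ≤ r / 2 := by
      refine (min_le_left _ _).trans ?_
      rw [hA.sdistCompl_frontier hΩ hz, mul_zero]
      linarith
    have hmx : r / 2 ≤ min (σ * sdistCompl Ω (A t) x) (-(σ * sdistCompl Ω (A t') x)) :=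
      le_min (by linarith) (by linarith)
    obtain ⟨y, hy, hym⟩ := hΩc.intermediate_value hzΩ hx hm ⟨hmz, hmx⟩
    simp only at hym
    have h1 : r / 2 ≤ σ * sdistCompl Ω (A t) y := hym.symm.le.trans (min_le_left _ _)
    have h2 : r / 2 ≤ -(σ * sdistCompl Ω (A t') y) := hym.symm.le.trans (min_le_right _ _)
    have h3 : |σ * sdistCompl Ω (A t) y| < r ∨ |σ * sdistCompl Ω (A t') y| < r := by
      rcases min_choice (σ * sdistCompl Ω (A t) y) (-(σ * sdistCompl Ω (A t') y)) with h | h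
      · left
        rw [← h, hym, abs_of_pos] <;> linarith
      · right
        rw [← abs_neg, ← h, hym, abs_of_pos] <;> linarith
    have := (abs_le.1 (hclose' y hy h3)).1
    linarith

end IsTube

end Characteristics

/-! ### One time step -/

section Step

section Cutoff

/-- The piecewise linear cutoff between `-3b` and `-2b`. -/
def ramp (b s : ℝ) : ℝ := max 0 (min 1 ((s + 3 * b) / b))

theorem ramp_nonneg (b s : ℝ) : 0 ≤ ramp b s := le_max_left _ _

theorem ramp_le_one (b s : ℝ) : ramp b s ≤ 1 := max_le zero_le_one (min_le_left _ _)

theorem measurable_ramp (b : ℝ) : Measurable (ramp b) := by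
  unfold ramp
  fun_prop

theorem ramp_eq_one {b s : ℝ} (hb : 0 < b) (hs : -(2 * b) ≤ s) : ramp b s = 1 := by
  have : 1 ≤ (s + 3 * b) / b := by rw [le_div_iff₀ hb]; linarith
  rw [ramp, min_eq_left this, max_eq_right zero_le_one]

theorem ramp_eq_zero {b s : ℝ} (hb : 0 < b) (hs : s ≤ -(3 * b)) : ramp b s = 0 := by
  have : (s + 3 * b) / b ≤ 0 := div_nonpos_of_nonpos_of_nonneg (by linarith) hb.le
  rw [ramp, max_eq_left ((min_le_right _ _).trans this)]

theorem abs_ramp_sub_le {b : ℝ} (hb : 0 < b) (s s' : ℝ) :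
    |ramp b s - ramp b s'| ≤ |s - s'| / b := by
  unfold ramp
  refine (abs_max_sub_max_le_max _ _ _ _).trans ?_
  rw [sub_self, abs_zero, max_eq_right (abs_nonneg _)]
  refine (abs_min_sub_min_le_max _ _ _ _).trans ?_
  rw [sub_self, abs_zero, max_eq_right (abs_nonneg _), ← sub_div, add_sub_add_right_eq_sub,
    abs_div, abs_of_pos hb]

end Cutoff

section Balance

/-- The budget of the strictness `δ`: the two shifts and the time error use `δ / 2 * ε`, and the two
transport errors use `c * δ / 4 * ε` of the remaining `c * δ / 2 * ε`. -/
theorem balance_near {a₀ a₁ X Y m₀ m₁ c δ ε e f D S Λ : ℝ} (hε : 0 < ε) (hδ : 0 < δ) (hc : 0 < c)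
    (hca : c < a₀ + a₁) (hX : |X - a₀ - (-ε) * m₀| ≤ c * δ / 8 * ε)
    (hY : |Y - a₁ - ε * m₁| ≤ c * δ / 8 * ε) (hm : m₀ + m₁ = (a₀ + a₁) * Λ) (hD : D < 0)
    (hf : f = D + δ / 4 * ε - ε * S + e) (he : |e| ≤ δ / 4 * ε) (hS : Λ + δ ≤ S) :
    0 ≤ -f * (a₀ + a₁) + (1 * X - 1 * a₀) - (1 * Y - 1 * a₁) := by
  have h1 : ε * Λ + δ / 2 * ε ≤ -f := by
    have h2 : ε * (Λ + δ) ≤ ε * S := by gcongr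
    have := (abs_le.1 he).2
    rw [hf]
    linarith
  have h2 : (ε * Λ + δ / 2 * ε) * (a₀ + a₁) ≤ -f * (a₀ + a₁) := by gcongr; linarith
  have h3 : δ / 2 * ε * c ≤ δ / 2 * ε * (a₀ + a₁) := by gcongr
  have h4 := (abs_le.1 hX).1
  have h5 := (abs_le.1 hY).2
  have h6 : ε * m₀ + ε * m₁ = ε * Λ * (a₀ + a₁) := by rw [← mul_add, hm]; ring
  have h7 : 0 ≤ δ * ε * c := by positivity
  linarith

/-- Where the cutoff may vary only the order `ε` matters: the cutoff changes by at most `ε / b` and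
the transported density by `O(ε)`. -/
theorem transport_defect_le {a X m l l' c b η G s ε : ℝ} (hs : |s| = ε) (hl' : 0 ≤ l')
    (hl'1 : l' ≤ 1) (hll : |l' - l| ≤ ε / b) (ha : 0 ≤ a) (hac : a ≤ c⁻¹)
    (hX : |X - a - s * m| ≤ η * ε) (hm : |m| ≤ G) (hb : 0 < b) :
    |l' * X - l * a| ≤ ε * (1 / (b * c) + G + η) := by
  have hε : 0 ≤ ε := hs ▸ abs_nonneg s
  have h1 : |X - a| ≤ ε * (G + η) := by
    have h2 := abs_add_le (X - a - s * m) (s * m)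
    rw [sub_add_cancel, abs_mul, hs] at h2
    have h3 : ε * |m| ≤ ε * G := by gcongr
    linarith
  have h2 : l' * X - l * a = (l' - l) * a + l' * (X - a) := by ring
  rw [h2]
  refine (abs_add_le _ _).trans ?_
  rw [abs_mul, abs_mul, abs_of_nonneg ha, abs_of_nonneg hl']
  have h3 : |l' - l| * a ≤ ε / b * c⁻¹ := by gcongr
  have h4 : l' * |X - a| ≤ 1 * (ε * (G + η)) := by gcongr
  have h5 : ε / b * c⁻¹ = ε * (1 / (b * c)) := by field_simp
  linarith

end Balance

variable {N : ℕ} {Ω : Set (Pt N)} {t₀ t₁ : ℝ} {A : ℝ → Set (Pt N)} {B K : Set (Pt N × ℝ)} {r : ℝ}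

theorem exists_bound_of_continuous (hΩb : Bornology.IsBounded Ω) {f : Pt N → ℝ}
    (hf : Continuous f) : ∃ M, ∀ x ∈ Ω, |f x| ≤ M := by
  obtain ⟨M, hM⟩ := hΩb.isCompact_closure.exists_bound_of_continuousOn hf.continuousOn
  exact ⟨M, fun x hx => hM x (subset_closure hx)⟩

/-- One time step of the minimizing movement stays behind a strict subflow (`σ = 1`); the case
`σ = -1` is the time step of a strict superflow seen from the complement. -/
theorem IsTube.exists_step (hT : IsTube Ω t₀ t₁ A K r) (hΩ : IsOpen Ω)
    (hΩb : Bornology.IsBounded Ω) (hΩc : IsPreconnected Ω) {ρ₀ ρ₁ : Pt N → ℝ}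
    (hρ₀ : ContDiffOn ℝ 1 ρ₀ Ω) (hρ₁ : ContDiffOn ℝ 1 ρ₁ Ω) (hρ₀n : ∀ x ∈ Ω, 0 ≤ ρ₀ x)
    (hρ₁n : ∀ x ∈ Ω, 0 ≤ ρ₁ x) {c : ℝ} (hc : 0 < c)
    (hρ : ∀ x ∈ Ω, c < ρ₀ x + ρ₁ x ∧ ρ₀ x + ρ₁ x < c⁻¹) {σ δ : ℝ} (hσ : |σ| = 1) (hδ : 0 < δ)
    (hflow : ∀ x t, (x, t) ∈ K →
      σ * weightedLaplacian (fun x => ρ₀ x + ρ₁ x) (sdistCompl Ω (A t)) x + δ ≤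
        σ * timeDeriv t₀ t₁ (fun y s => sdistCompl Ω (A s) y) x t) :
    ∃ ε₀ > 0, ∀ ε : ℝ, 0 < ε → ε < ε₀ → ∀ t ∈ Icc t₀ (t₁ - ε), (A t).Nonempty →
      (A (t + ε)).Nonempty → ∀ w, IsMinimizer Ω ρ₀ ρ₁ ε
        (fun x => σ * sdistCompl Ω (A t) x + δ / 8 * ε) w →
      ∀ᵐ x ∂(volume.restrict Ω), σ * sdistCompl Ω (A (t + ε)) x < δ / 8 * ε → w x ≤ 0 := by
  have hr := hT.pos
  obtain ⟨C, hC0, hC⟩ := hT.exists_hessian_bound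
  have hK' : IsCompact (Prod.fst '' K) := hT.isCompact.image continuous_fst
  have hK'Ω : Prod.fst '' K ⊆ Ω := by
    rintro _ ⟨p, hp, rfl⟩
    exact (hT.subset hp).1
  obtain ⟨G₀, hG₀, hexp₀⟩ := exists_density_expansion hΩ hρ₀ hK' hK'Ω C
  obtain ⟨G₁, hG₁, hexp₁⟩ := exists_density_expansion hΩ hρ₁ hK' hK'Ω C
  set η := c * δ / 8 with hη
  have hη0 : 0 < η := by positivity
  obtain ⟨s₀, hs₀, hexp₀⟩ := hexp₀ η hη0
  obtain ⟨s₁, hs₁, hexp₁⟩ := hexp₁ η hη0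
  obtain ⟨h, hh, htime⟩ := hT.exists_time_expansion (η := δ / 4) (by positivity)
  obtain ⟨Ct, hCt, hbound⟩ := hT.exists_time_bound
  set b := r / 7 with hb
  have hb0 : 0 < b := by positivity
  have hbr : 7 * b ≤ r := by rw [hb]; linarith
  set Q := 1 / (b * c) + (G₀ + G₁) + η with hQ
  have hQ0 : 0 < Q := by positivity
  -- The first four bounds make the front and the expansions available; `b / δ` keeps the shift
  -- below `b / 8`, `b / (8 * Ct)` does so for the change of the distance in one step, and `b * c /
  -- (16 * Q)` makes the two transport defects smaller than `b * c / 8`.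
  refine ⟨min (min (min b h) (min s₀ s₁)) (min (min (b / δ) (b / (8 * Ct))) (b * c / (16 * Q))),
    by positivity, fun ε hε hε₀ t ht hne hne' w hw => ?_⟩
  simp only [lt_min_iff] at hε₀
  obtain ⟨⟨⟨hεb, hεh⟩, hεs₀, hεs₁⟩, ⟨hεδ, hεC⟩, hεQ⟩ := hε₀
  rw [lt_div_iff₀ (by positivity)] at hεδ hεC hεQ
  set t' := t + ε with ht'
  have htI : t ∈ Icc t₀ t₁ := ⟨ht.1, by linarith [ht.2]⟩
  have ht'I : t' ∈ Icc t₀ t₁ := ⟨by linarith [ht.1], by linarith [ht.2]⟩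
  have hsub : Icc t t' ⊆ Icc t₀ t₁ := Icc_subset_Icc htI.1 ht'I.2
  have htt' : t ≤ t' := by linarith
  have hεr : ε ≤ r := by linarith
  have hmemK : ∀ x ∈ Ω, |sdistCompl Ω (A t) x| < r ∨ |sdistCompl Ω (A t') x| < r →
      ∀ s ∈ Icc t t', (x, s) ∈ K := by
    rintro x hx (hx' | hx') s hs
    · exact hT.mem_of_abs_lt hΩ htI hne hx hx' (hsub hs)
        (abs_le.2 ⟨by linarith [hs.1], by linarith [hs.2]⟩)
    · exact hT.mem_of_abs_lt hΩ ht'I hne' hx hx' (hsub hs)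
        (abs_le.2 ⟨by linarith [hs.1], by linarith [hs.2]⟩)
  have hclose : ∀ x ∈ Ω, |sdistCompl Ω (A t) x| < r ∨ |sdistCompl Ω (A t') x| < r →
      |sdistCompl Ω (A t') x - sdistCompl Ω (A t) x| ≤ b / 8 := fun x hx hx' => by
    have := hbound x t t' htt' (hmemK x hx hx')
    rw [ht', add_sub_cancel_left] at this
    linarith
  have hfar : ∀ x ∈ Ω, σ * sdistCompl Ω (A t') x ≤ -(b / 2) →
      σ * sdistCompl Ω (A t) x ≤ -(b / 4) := fun x hx hx' =>
    hT.le_of_le hΩ hΩc hσ htI hne hb0 (by linarith) hclose hx hx'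
  -- Used twice, once to raise the data and once to shift the front; together this costs `δ / 4 *
  -- ε`.
  set k := δ / 8 * ε with hk
  have hk0 : 0 < k := by positivity
  have hkb : k ≤ b / 8 := by rw [hk]; linarith
  have hF := hT.isFront hΩ hσ (ε := ε) (k := k) ht'I hne' hb0 hbr hεb.le
    (by rw [abs_of_pos hk0]; linarith)
  set V := gradient fun x => σ * sdistCompl Ω (A t') x with hV
  have hzone : ∀ y ∈ outerZone Ω b (fun x => σ * sdistCompl Ω (A t') x - k),
      |sdistCompl Ω (A t') y| < r := by
    intro y hy
    have h1 := abs_lt_of_mem_outerZone hb0 hy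
    have h2 := abs_add_le (σ * sdistCompl Ω (A t') y - k) k
    rw [sub_add_cancel, abs_mul, hσ, one_mul, abs_of_pos hk0] at h2
    linarith
  have hzoneK : ∀ y ∈ outerZone Ω b (fun x => σ * sdistCompl Ω (A t') x - k), (y, t') ∈ K :=
    fun y hy => hmemK y hy.1 (Or.inr (hzone y hy)) t' (right_mem_Icc.2 htt')
  have hVn : ∀ y ∈ outerZone Ω b (fun x => σ * sdistCompl Ω (A t') x - k), ‖V y‖ ≤ 1 :=
    fun y hy => hF.norm_le y hy.1 (abs_lt_of_mem_outerZone hb0 hy)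
  have hHn : ∀ y ∈ outerZone Ω b (fun x => σ * sdistCompl Ω (A t') x - k),
      ‖fderiv ℝ V y‖ ≤ C := fun y hy =>
    hT.norm_hessian_signed_le hσ (hzoneK y hy) (hC t' y (hzoneK y hy))
  have hcontf : Continuous fun x => σ * sdistCompl Ω (A t) x + k :=
    (continuous_const.mul continuous_sdistCompl).add continuous_const
  obtain ⟨M, hM⟩ := exists_bound_of_continuous hΩb hcontf
  have habs : |ε| = ε := abs_of_pos hε
  have habs' : |(-ε)| = ε := by rw [abs_neg, habs]
  have hres := IsMinimizer.nonpos_of_front (lam := ramp b) hΩ hΩb hF hε hεb.le (measurable_ramp b)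
    (ramp_nonneg b) (ramp_le_one b) (fun s => ramp_eq_one hb0) (fun s => ramp_eq_zero hb0)
    (hρ₀.continuousOn.aemeasurable hΩ.measurableSet)
    (hρ₁.continuousOn.aemeasurable hΩ.measurableSet) hρ₀n hρ₁n hc hρ hcontf.measurable hM
    ?_ ?_ ?_ hw
  · filter_upwards [hres] with x hx hx'
    exact hx (by linarith)
  · intro y hy
    exact (hexp₀ y ⟨_, hzoneK y hy, rfl⟩ (V y) (hVn y hy) _ (hHn y hy) ε
      (by rw [habs]; exact hεs₀.le)).2.2
  · intro y hy
    have hyK := hzoneK y hy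
    obtain ⟨e₀, g₀, -⟩ := hexp₀ y ⟨_, hyK, rfl⟩ (V y) (hVn y hy) _ (hHn y hy) (-ε)
      (by rw [habs']; exact hεs₀.le)
    obtain ⟨e₁, g₁, -⟩ := hexp₁ y ⟨_, hyK, rfl⟩ (V y) (hVn y hy) _ (hHn y hy) ε
      (by rw [habs]; exact hεs₁.le)
    rw [habs'] at e₀
    rw [habs] at e₁
    have hyρ := hρ y hy.1
    have hρ₀y := hρ₀n y hy.1
    have hρ₁y := hρ₁n y hy.1
    -- Near the front all three cutoff values are `1`, since `ε < b`, and the flow inequality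
    -- decides. Farther out the data is at most `-b / 8`, which beats the `O(ε)` transport defects.
    by_cases hDb : -b ≤ σ * sdistCompl Ω (A t') y - k
    · have hd₀ : DifferentiableAt ℝ ρ₀ y :=
        (hρ₀.differentiableOn one_ne_zero y hy.1).differentiableAt (hΩ.mem_nhds hy.1)
      have hd₁ : DifferentiableAt ℝ ρ₁ y :=
        (hρ₁.differentiableOn one_ne_zero y hy.1).differentiableAt (hΩ.mem_nhds hy.1)
      have hL := weightedLaplacian_eq (ρ := fun x => ρ₀ x + ρ₁ x) (hd₀.add hd₁)
        (hT.contDiffAt_signed σ hyK)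
      rw [weightedLaplacian_const_mul, fderiv_fun_add hd₀ hd₁] at hL
      have hfl := hflow y t' hyK
      have htm := htime y t t' htt' (by rw [ht', add_sub_cancel_left]; exact hεh.le)
        (hmemK y hy.1 (Or.inr (hzone y hy)))
      rw [ht', add_sub_cancel_left, ← ht'] at htm
      rw [ramp_eq_one hb0 (by linarith), ramp_eq_one hb0 (by linarith),
        ramp_eq_one hb0 (by linarith)]
      refine balance_near (D := σ * sdistCompl Ω (A t') y - k) (c := c) (δ := δ)
        (e := -(σ * (sdistCompl Ω (A t') y - sdistCompl Ω (A t) y -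
          ε * timeDeriv t₀ t₁ (fun y s => sdistCompl Ω (A s) y) y t')))
        hε hδ hc hyρ.1 e₀ e₁ ?_ hy.2.2 ?_ ?_ hfl
      · rw [hL, ← mul_assoc, mul_one_div_cancel (hc.trans hyρ.1).ne', one_mul, add_apply]
        ring
      · rw [hk]; ring
      · rw [abs_neg, abs_mul, hσ, one_mul]
        exact htm
    · push Not at hDb
      have hf1 := hfar y hy.1 (by linarith)
      have q₀ := transport_defect_le (l := ramp b (σ * sdistCompl Ω (A t') y - k))
        (l' := ramp b (σ * sdistCompl Ω (A t') y - k - ε)) (c := c) (b := b)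
        habs' (ramp_nonneg _ _) (ramp_le_one _ _)
        ((abs_ramp_sub_le hb0 _ _).trans (by rw [sub_sub_cancel_left, habs']))
        hρ₀y (by linarith) e₀ g₀ hb0
      have q₁ := transport_defect_le (l := ramp b (σ * sdistCompl Ω (A t') y - k))
        (l' := ramp b (σ * sdistCompl Ω (A t') y - k + ε)) (c := c) (b := b)
        habs (ramp_nonneg _ _) (ramp_le_one _ _)
        ((abs_ramp_sub_le hb0 _ _).trans (by rw [add_sub_cancel_left, habs]))
        hρ₁y (by linarith) e₁ g₁ hb0
      have p₀ := (abs_le.1 q₀).1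
      have p₁ := (abs_le.1 q₁).2
      have hQ₀ : ε * (1 / (b * c) + G₀ + η) ≤ ε * Q := by
        gcongr; linarith
      have hQ₁ : ε * (1 / (b * c) + G₁ + η) ≤ ε * Q := by
        gcongr; linarith
      have hfρ : b / 8 * c ≤ -(σ * sdistCompl Ω (A t) y + k) * (ρ₀ y + ρ₁ y) :=
        mul_le_mul (by linarith) hyρ.1.le hc.le (by linarith)
      linarith
  · intro y hy hyD
    have := hfar y hy (by linarith)
    linarith

end Step

/-! ### Inclusions for subflows and superflows -/

section Consistency

variable {N : ℕ} {Ω : Set (Pt N)} {ρ₀ ρ₁ f w : Pt N → ℝ} {ε : ℝ}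

/-- Zero has zero energy for zero data. This covers an empty `A t`, whose signed distance is zero in
`Ω` by the convention for `infDist` to the empty set. -/
theorem IsMinimizer.ae_eq_zero (hw : IsMinimizer Ω ρ₀ ρ₁ ε f w) (hΩ : IsOpen Ω) (hε : 0 < ε)
    {c : ℝ} (hc : 0 < c) (hρ : ∀ x ∈ Ω, c < ρ₀ x + ρ₁ x)
    (hρ₀ : AEMeasurable ρ₀ (volume.restrict Ω)) (hρ₁ : AEMeasurable ρ₁ (volume.restrict Ω))
    (hf : AEMeasurable f (volume.restrict Ω)) (hf0 : ∀ x ∈ Ω, f x = 0) :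
    ∀ᵐ x ∂(volume.restrict Ω), w x = 0 := by
  have h0 : energy Ω ρ₀ ρ₁ ε f (fun _ => 0) = 0 := by
    unfold energy
    rw [TV_zero hΩ hε, setLIntegral_congr_fun (g := fun _ => 0) hΩ.measurableSet]
    · simp
    · intro x hx
      simp [hf0 x hx]
  have h1 : energy Ω ρ₀ ρ₁ ε f w = 0 := le_antisymm ((hw.2 _ MemLp.zero).trans h0.le) bot_le
  unfold energy at h1
  have h2 := (mul_eq_zero.1 (add_eq_zero.1 h1).1).resolve_left
    (ENNReal.ofReal_pos.2 (by positivity)).ne'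
  have hwm := hw.1.aemeasurable
  rw [lintegral_eq_zero_iff' (by fun_prop)] at h2
  filter_upwards [h2, ae_restrict_mem hΩ.measurableSet] with x hx hxΩ
  have h3 := (mul_eq_zero.1 hx).resolve_right
    (ENNReal.ofReal_pos.2 (hc.trans (hρ x hxΩ))).ne'
  have h4 : |w x - f x| ^ 2 = 0 := le_antisymm (ENNReal.ofReal_eq_zero.1 h3) (sq_nonneg _)
  simpa [hf0 x hxΩ] using h4

theorem notMem_densityOne_pos (hΩ : IsOpen Ω) {x : Pt N} {r : ℝ} (hr : 0 < r)
    (h : ∀ᵐ y ∂(volume.restrict Ω), dist y x < r → w y ≤ 0) :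
    x ∉ densityOne {y | y ∈ Ω ∧ 0 < w y} := by
  refine notMem_densityOne_of_ae_ball hr ?_
  rw [ae_restrict_iff' Metric.isOpen_ball.measurableSet]
  filter_upwards [(ae_restrict_iff' hΩ.measurableSet).1 h] with y hy hyx hyw
  exact absurd hyw.2 (hy hyw.1 hyx).not_gt

theorem mem_densityOne_pos (hΩ : IsOpen Ω) {U : Set (Pt N)} (hU : IsOpen U) {x : Pt N}
    (hx : x ∈ Ω) (hxU : x ∈ U) (h : ∀ᵐ y ∂(volume.restrict Ω), y ∈ U → 0 < w y) :
    x ∈ densityOne {y | y ∈ Ω ∧ 0 < w y} := by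
  obtain ⟨r, hr, hsub⟩ := Metric.isOpen_iff.1 (hΩ.inter hU) x ⟨hx, hxU⟩
  refine mem_densityOne_of_ae_ball hr ?_
  rw [ae_restrict_iff' Metric.isOpen_ball.measurableSet]
  filter_upwards [(ae_restrict_iff' hΩ.measurableSet).1 h] with y hy hyx
  exact ⟨(hsub hyx).1, hy (hsub hyx).1 (hsub hyx).2⟩

variable {t₀ t₁ : ℝ} {A : ℝ → Set (Pt N)} {c : ℝ}

/-- Around a point outside `A (t + ε)` the signed distance stays below the margin `δ / 8 * ε` on a
whole ball, so every minimizer is negative almost everywhere there in `Ω`. -/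
theorem IsSubflow.exists_oneStep_subset (hA : IsSubflow Ω (fun x => ρ₀ x + ρ₁ x) t₀ t₁ A)
    (hN : 0 < N) (hΩ : IsOpen Ω) (hΩb : Bornology.IsBounded Ω) (hΩc : Convex ℝ Ω)
    (hρ₀ : ContDiffOn ℝ 1 ρ₀ Ω) (hρ₁ : ContDiffOn ℝ 1 ρ₁ Ω)
    (hρ₀n : ∀ x ∈ Ω, 0 ≤ ρ₀ x) (hρ₁n : ∀ x ∈ Ω, 0 ≤ ρ₁ x) (hc : 0 < c)
    (hρ : ∀ x ∈ Ω, c < ρ₀ x + ρ₁ x ∧ ρ₀ x + ρ₁ x < c⁻¹) :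
    ∃ ε₀ : ℝ, 0 < ε₀ ∧ ∀ ε : ℝ, 0 < ε → ε < ε₀ → ∀ t ∈ Icc t₀ (t₁ - ε),
      oneStep Ω ρ₀ ρ₁ ε (A t) ⊆ A (t + ε) := by
  obtain ⟨B, hE, δ, hδ, hflow⟩ := hA
  obtain ⟨K, r, hKB, hT⟩ := hE.exists_isTube hN hΩ hΩb
  obtain ⟨h, hh, hne⟩ := hT.exists_nonempty hΩ
  obtain ⟨ε₀, hε₀, hstep⟩ := hT.exists_step hΩ hΩb hΩc.isPreconnected hρ₀ hρ₁ hρ₀n hρ₁n hc hρ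
    (σ := 1) abs_one hδ (fun x t hxt => by
      rw [one_mul, one_mul]
      exact hflow x t (hKB hxt))
  refine ⟨min ε₀ h, lt_min hε₀ hh, fun ε hε hεlt t ht x hx => ?_⟩
  have hfin : IsFiniteMeasure (volume.restrict Ω) :=
    ⟨by rw [Measure.restrict_apply_univ]; exact hΩb.measure_lt_top⟩
  have htI : t ∈ Icc t₀ t₁ := ⟨ht.1, by linarith [ht.2]⟩
  have ht'I : t + ε ∈ Icc t₀ t₁ := ⟨by linarith [ht.1], by linarith [ht.2]⟩
  obtain ⟨w, hw, hxw⟩ := hx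
  rcases (A t).eq_empty_or_nonempty with hemp | hAt
  · rw [hemp] at hw
    have h0 := hw.ae_eq_zero hΩ hε hc (fun x hx => (hρ x hx).1)
      (hρ₀.continuousOn.aemeasurable hΩ.measurableSet)
      (hρ₁.continuousOn.aemeasurable hΩ.measurableSet)
      continuous_sdistCompl.measurable.aemeasurable (fun x hx => sdistCompl_empty hΩ hx)
    refine absurd hxw (notMem_densityOne_pos hΩ one_pos ?_)
    filter_upwards [h0] with y hy _ using hy.le
  · have hAt' : (A (t + ε)).Nonempty := hne t htI (t + ε) ht'I
      (by rw [add_sub_cancel_left, abs_of_pos hε]; exact hεlt.le.trans (min_le_right _ _)) hAt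
    have hκ : 0 < δ / 8 * ε := by positivity
    have hmin : IsMinimizer Ω ρ₀ ρ₁ ε (fun x => 1 * sdistCompl Ω (A t) x + δ / 8 * ε)
        (fun x => w x + δ / 8 * ε) := by
      simp only [one_mul]
      exact hw.add_const _
    have hae := hstep ε hε (hεlt.trans_le (min_le_left _ _)) t ht hAt hAt' _ hmin
    have hone := hT.isOneSided _ ht'I
    by_contra hxA
    refine absurd hxw (notMem_densityOne_pos hΩ hκ ?_)
    filter_upwards [hae, ae_restrict_mem hΩ.measurableSet] with y hy hyΩ hyx
    have hd : sdistCompl Ω (A (t + ε)) y < δ / 8 * ε := by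
      by_cases hyA : y ∈ A (t + ε)
      · rw [hone.sdistCompl_of_mem hΩ hyA]
        exact (hone.infDist_diff_le hΩ hxA hyA).trans_lt hyx
      · exact (hone.sdistCompl_nonpos hΩ hyΩ hyA).trans_lt hκ
    linarith [hy (by rwa [one_mul])]

/-- The step estimate is applied with `σ = -1` and exchanged weights to `-w` raised by `-δ / 8 * ε`.
Hence `w` is at least this margin almost everywhere near each point of `A (t + ε)`. -/
theorem IsSuperflow.exists_subset_oneStep (hA : IsSuperflow Ω (fun x => ρ₀ x + ρ₁ x) t₀ t₁ A)
    (hN : 0 < N) (hΩ : IsOpen Ω) (hΩb : Bornology.IsBounded Ω) (hΩc : Convex ℝ Ω)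
    (hρ₀ : ContDiffOn ℝ 1 ρ₀ Ω) (hρ₁ : ContDiffOn ℝ 1 ρ₁ Ω)
    (hρ₀n : ∀ x ∈ Ω, 0 ≤ ρ₀ x) (hρ₁n : ∀ x ∈ Ω, 0 ≤ ρ₁ x) (hc : 0 < c)
    (hρ : ∀ x ∈ Ω, c < ρ₀ x + ρ₁ x ∧ ρ₀ x + ρ₁ x < c⁻¹) :
    ∃ ε₀ : ℝ, 0 < ε₀ ∧ ∀ ε : ℝ, 0 < ε → ε < ε₀ → ∀ t ∈ Icc t₀ (t₁ - ε),
      A (t + ε) ⊆ oneStep Ω ρ₀ ρ₁ ε (A t) := by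
  obtain ⟨B, hE, δ, hδ, hflow⟩ := hA
  obtain ⟨K, r, hKB, hT⟩ := hE.exists_isTube hN hΩ hΩb
  obtain ⟨h, hh, hne⟩ := hT.exists_nonempty hΩ
  have hδ' : 0 < -δ := neg_pos.2 hδ
  obtain ⟨ε₀, hε₀, hstep⟩ := hT.exists_step hΩ hΩb hΩc.isPreconnected hρ₁ hρ₀ hρ₁n hρ₀n hc
    (fun x hx => by rw [add_comm]; exact hρ x hx) (σ := -1) (by simp) hδ' (fun x t hxt => by
      have h1 := hflow x t (hKB hxt)
      simp only [add_comm (ρ₁ _)]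
      linarith)
  refine ⟨min ε₀ h, lt_min hε₀ hh, fun ε hε hεlt t ht x hx => ?_⟩
  have hfin : IsFiniteMeasure (volume.restrict Ω) :=
    ⟨by rw [Measure.restrict_apply_univ]; exact hΩb.measure_lt_top⟩
  have htI : t ∈ Icc t₀ t₁ := ⟨ht.1, by linarith [ht.2]⟩
  have ht'I : t + ε ∈ Icc t₀ t₁ := ⟨by linarith [ht.1], by linarith [ht.2]⟩
  -- Nonemptiness is carried backwards in time, from the point `x` of `A (t + ε)`.
  have hAt : (A t).Nonempty := hne (t + ε) ht'I t htI
    (by rw [sub_add_cancel_left, abs_neg, abs_of_pos hε]; exact hεlt.le.trans (min_le_right _ _))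
    ⟨x, hx⟩
  have hκ : 0 < -δ / 8 * ε := by positivity
  obtain ⟨M, hM⟩ := exists_bound_of_continuous hΩb (continuous_sdistCompl (Ω := Ω) (A := A t))
  obtain ⟨w, hw⟩ := exists_isMinimizer hΩ hΩb hε hc hρ
    (hρ₀.continuousOn.aemeasurable hΩ.measurableSet)
    (hρ₁.continuousOn.aemeasurable hΩ.measurableSet)
    continuous_sdistCompl.measurable.aemeasurable hM
  have hmin : IsMinimizer Ω ρ₁ ρ₀ ε (fun x => -1 * sdistCompl Ω (A t) x + -δ / 8 * ε)
      (fun x => -w x + -δ / 8 * ε) := by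
    simp only [neg_one_mul]
    exact hw.neg.add_const _
  have hae := hstep ε hε (hεlt.trans_le (min_le_left _ _)) t ht hAt ⟨x, hx⟩ _ hmin
  have hone := hT.isOneSided _ ht'I
  refine ⟨w, hw, mem_densityOne_pos hΩ (U := {y | -1 * sdistCompl Ω (A (t + ε)) y < -δ / 8 * ε})
    (isOpen_lt (continuous_const.mul continuous_sdistCompl) continuous_const)
    (hone.closure_subset (subset_closure hx)) ?_ ?_⟩
  · have := hone.sdistCompl_nonneg hΩ hx
    rw [mem_ofPred_eq]
    linarith
  · filter_upwards [hae] with y hy hyU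
    linarith [hy hyU]

end Consistency

end AdvMCF

end

theorem proposition4p13 {N : ℕ} (hN : 0 < N)
    (Ω : Set (EuclideanSpace ℝ (Fin N)))
    (hΩ_open : IsOpen Ω) (hΩ_bounded : Bornology.IsBounded Ω) (hΩ_convex : Convex ℝ Ω)
    (ρ₀ ρ₁ : EuclideanSpace ℝ (Fin N) → ℝ)
    (hρ₀_smooth : ContDiffOn ℝ 1 ρ₀ Ω) (hρ₁_smooth : ContDiffOn ℝ 1 ρ₁ Ω)
    (hρ₀_nonneg : ∀ x ∈ Ω, 0 ≤ ρ₀ x) (hρ₁_nonneg : ∀ x ∈ Ω, 0 ≤ ρ₁ x)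
    (c : ℝ) (hc : 0 < c)
    (hρ : ∀ x ∈ Ω, c < ρ₀ x + ρ₁ x ∧ ρ₀ x + ρ₁ x < c⁻¹) :
    AdvMCF.IsConsistent Ω ρ₀ ρ₁ :=
  ⟨fun _ _ _ h => h.exists_oneStep_subset hN hΩ_open hΩ_bounded hΩ_convex hρ₀_smooth hρ₁_smooth
    hρ₀_nonneg hρ₁_nonneg hc hρ,
  fun _ _ _ h => h.exists_subset_oneStep hN hΩ_open hΩ_bounded hΩ_convex hρ₀_smooth hρ₁_smooth
    hρ₀_nonneg hρ₁_nonneg hc hρ⟩
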